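/- Let $m\ge 2$ and let $L=L_1\cup\dots\cup L_d\subset\mathbb P^2$ be an arrangement of $d$ distinct complex lines with $m\mid d$, defined by $f=\ell_1\cdots\ell_d$ with $\ell_i$ linear forms. Let $P$ be a point of $L_d$ lying on no other $L_i$, and let $Z\cong\mathbb P^1$ be a line through $P$, $Z\not\subset L$. Choose $z_\infty\in Z\setminus L$ and an affine coordinate identifying $Z\setminus\{z_\infty\}$ with $\mathbb C$ so that $P$ is the origin. Put $z_d=P=0$ and $\{z_i\}=Z\cap L_i$ ($1\le i\le d-1$), and assume that the position is general in the following sense: the segments $\xi_i=[0,z_i]\subset\mathbb C$ ($1\le i\le d-1$) meet pairwise only at $0$ (so the $d$ points $z_1,\dots,z_d$ are distinct). Let $p:\widetilde Z\to Z$ be the cyclic cover of degree $m$ given by $y^m=f|_Z$, i.e. $\widetilde Z=\{(w,y)\in W\times\mathbb C : w\ne 0,\ y^m=f(w)\}/\mathbb C^*$ with $Z=\mathbb P(W)$, $W\subset\mathbb C^3$ a $2$-dimensional subspace, $t\cdot(w,y)=(tw,t^{d/m}y)$ and $p[w:y]=[w]$. It is a compact Riemann surface, unramified over $Z\setminus L$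 and totally ramified over $z_1,\dots,z_d$. Let $\gamma[w:y]=[w:\zeta y]$, with $\zeta$ a primitive $m$-th root of unity, be any generator of its group of covering transformations, and let $\lambda''=\exp(-2\pi\sqrt{-1}/m)$. Let $\widetilde z_d$ be the point over $z_d$. For $1\le i\le d-1$ let $\eta_i$ be the loop at $z_d$ that follows $\xi_i$ to a small circle around $z_i$ (whose closed disc contains no $z_k$ with $k\ne i$), runs once counterclockwise along the circle, and returns along $\xi_i$. Let $\widetilde\eta_i$ be any path in $\widetilde Z$ lifting $\eta_i$; it is a loop at $\widetilde z_d$. Let $\sigma_i\in H_1(\widetilde Z,\mathbb C)$ be its class, and let $\sigma_i^{\lambda''}$ be the component of $\sigma_i$ in the eigenspace $H_1(\widetilde Z,\mathbb C)^{\gamma_*=\lambda''}$ in the eigenspace decomposition of $H_1(\widetilde Z,\mathbb C)$ under $\gamma_*$. Then: 1. For every $j\in\{1,\dots,d-1\}$, the $\sigma_i^{\lambda''}$ with $1\le i\le d-1$, $i\ne j$, form a $\mathbb C$-basis of $H_1(\widetilde Z,\mathbb C)^{\gamma_*=\lambda''}$. 2. The $\sigma_i^{\lambda''}$ ($1\le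 i\le d-1$) span $H_1(\widetilde Z,\mathbb C)^{\gamma_*=\lambda''}$, and there are $\alpha_1,\dots,\alpha_{d-1}\in\mathbb C^*$ with $\sum_{i=1}^{d-1}\alpha_i\sigma_i^{\lambda''}=0$, such that every linear relation among the $\sigma_i^{\lambda''}$ is a multiple of this one. Hence there is an isomorphism $$\Bigl(\bigoplus_{i=1}^{d-1}\mathbb C e_i\Bigr)\Big/\mathbb C\Bigl(\sum_{i=1}^{d-1}\alpha_i e_i\Bigr)\ \cong\ H_1(\widetilde Z,\mathbb C)^{\gamma_*=\lambda''}$$ sending the class of $e_i$ to $\sigma_i^{\lambda''}$. -/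

import Mathlib

open CategoryTheory AlgebraicTopology
open scoped LinearAlgebra.Projectivization Simplicial

noncomputable section

namespace LineCover

/-! ### First singular homology with complex coefficients -/

/-- `H₁(X, ℂ)`: singular homology. -/
abbrev H1 (X : Type) [TopologicalSpace X] : ModuleCat.{0} ℂ :=
  ((singularHomologyFunctor (ModuleCat.{0} ℂ) 1).obj (ModuleCat.of ℂ ℂ)).obj (TopCat.of X)

/-- The endomorphism `g_*` of `H₁(X, ℂ)` induced by a continuous self-map `g`. -/
def pushforward {X : Type} [TopologicalSpace X] (g : C(X, X)) : Module.End ℂ (H1 X) :=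
  (((singularHomologyFunctor (ModuleCat.{0} ℂ) 1).obj (ModuleCat.of ℂ ℂ)).map
    (TopCat.ofHom g)).hom

/-- A loop, seen as a singular `1`-simplex. -/
def loopSimplex {X : Type} [TopologicalSpace X] {a : X} (c : Path a a) :
    (TopCat.toSSet.obj (TopCat.of X)) _⦋1⦌ :=
  ((TopCat.of X).toSSetObjEquiv (.op ⦋1⦌)).symm
    ((⟨c, c.continuous⟩ : C(unitInterval, X)).comp
      ⟨stdSimplexHomeomorphUnitInterval, stdSimplexHomeomorphUnitInterval.continuous⟩)

lemma loopSimplex_isCycle {X : Type} [TopologicalSpace X] {a : X} (c : Path a a) :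
    ((TopCat.toSSet.obj (TopCat.of X)).ιChainComplex (R := ModuleCat.of ℂ ℂ) (loopSimplex c)) ≫
      ((TopCat.toSSet.obj (TopCat.of X)).chainComplex (ModuleCat.of ℂ ℂ)).d 1 0 = 0 := by
  have h : (TopCat.toSSet.obj (TopCat.of X)).δ 0 (loopSimplex c) =
      (TopCat.toSSet.obj (TopCat.of X)).δ 1 (loopSimplex c) := by
    apply ((TopCat.of X).toSSetObjEquiv (.op ⦋0⦌)).injective
    ext u
    have hu : u = stdSimplex.vertex (S := ℝ) (0 : Fin 1) := Subsingleton.elim (α := stdSimplex ℝ (Fin 1)) _ _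
    subst hu
    refine (congrArg (fun v => c (stdSimplexHomeomorphUnitInterval v))
      (stdSimplex.map_vertex (S := ℝ) (SimplexCategory.δ (n := 0) 0) (0 : Fin 1))).trans ?_
    refine Eq.trans ?_ (congrArg (fun v => c (stdSimplexHomeomorphUnitInterval v))
      (stdSimplex.map_vertex (S := ℝ) (SimplexCategory.δ (n := 0) 1) (0 : Fin 1))).symm
    exact c.target.trans c.source.symm
  rw [SSet.ιChainComplex_d, Fin.sum_univ_two, h]
  simp

/-- The class in `H₁(X, ℂ)` of a loop, viewed as a singular `1`-cycle. -/
def loopClass {X : Type} [TopologicalSpace X] {a : X} (c : Path a a) : H1 X :=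
  (((TopCat.toSSet.obj (TopCat.of X)).chainComplex (ModuleCat.of ℂ ℂ)).liftCycles
      ((TopCat.toSSet.obj (TopCat.of X)).ιChainComplex (loopSimplex c)) 0 (by simp)
      (loopSimplex_isCycle c) ≫
    ((TopCat.toSSet.obj (TopCat.of X)).chainComplex (ModuleCat.of ℂ ℂ)).homologyπ 1).hom (1 : ℂ)

/-! ### Components with respect to an operator of finite order -/

/-- For an operator `T` with `T ^ m = 1` (which is diagonalizable) and an `m`-th root of unity `μ`,
the component of `x` in the `μ`-eigenspace of `T`; see `eigencomponent_mem` and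
`sub_eigencomponent_mem`. -/
def eigencomponent {H : Type*} [AddCommGroup H] [Module ℂ H] (m : ℕ) (T : Module.End ℂ H)
    (μ : ℂ) (x : H) : H :=
  (m : ℂ)⁻¹ • ∑ k ∈ Finset.range m, μ⁻¹ ^ k • (T ^ k) x

lemma eigencomponent_mem {H : Type*} [AddCommGroup H] [Module ℂ H] {m : ℕ}
    {T : Module.End ℂ H} (hT : T ^ m = 1) {μ : ℂ} (hμ : μ ^ m = 1) (hm : 0 < m) (x : H) :
    eigencomponent m T μ x ∈ T.eigenspace μ := by
  have hμ0 : μ ≠ 0 := by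
    rintro rfl
    simp [hm.ne'] at hμ
  rw [Module.End.mem_eigenspace_iff]
  unfold eigencomponent
  rw [map_smul, smul_comm μ]
  congr 1
  obtain ⟨n, rfl⟩ : ∃ n, m = n + 1 := ⟨m - 1, by omega⟩
  rw [map_sum, Finset.smul_sum, Finset.sum_range_succ, Finset.sum_range_succ']
  have h1 : T ((T ^ n) x) = x := by
    rw [← Module.End.mul_apply, ← pow_succ', hT, Module.End.one_apply]
  have h2 : μ⁻¹ ^ n = μ := by
    rw [inv_pow, inv_eq_iff_eq_inv]
    exact eq_inv_of_mul_eq_one_left (by rw [← pow_succ, hμ])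
  congr 1
  · refine Finset.sum_congr rfl fun k _ => ?_
    rw [map_smul, ← Module.End.mul_apply, ← pow_succ', smul_smul, pow_succ (μ⁻¹), mul_comm μ,
      mul_assoc, inv_mul_cancel₀ hμ0, mul_one]
  · rw [map_smul, h1, h2]
    simp

lemma sub_eigencomponent_mem {H : Type*} [AddCommGroup H] [Module ℂ H] {m : ℕ}
    {T : Module.End ℂ H} (hT : T ^ m = 1) {μ : ℂ} (hμ : μ ^ m = 1) (hm : 0 < m) (x : H) :
    x - eigencomponent m T μ x ∈ ⨆ ν : {ν : ℂ // ν ≠ μ}, T.eigenspace ν := by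
  have hm0 : m ≠ 0 := hm.ne'
  have hμ0 : μ ≠ 0 := by
    rintro rfl
    simp [hm0] at hμ
  obtain ⟨ω, hω⟩ : ∃ ω : ℂ, IsPrimitiveRoot ω m := ⟨_, Complex.isPrimitiveRoot_exp m hm0⟩
  have hωj (j : ℕ) : (μ * ω ^ j) ^ m = 1 := by
    rw [mul_pow, hμ, one_mul, ← pow_mul, mul_comm, pow_mul, hω.pow_eq_one, one_pow]
  have hsum : ∑ j ∈ Finset.range m, eigencomponent m T (μ * ω ^ j) x = x := by
    unfold eigencomponent
    rw [← Finset.smul_sum, Finset.sum_comm]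
    have hk : ∀ k ∈ Finset.range m,
        ∑ j ∈ Finset.range m, (μ * ω ^ j)⁻¹ ^ k • (T ^ k) x = if k = 0 then (m : ℂ) • x else 0 := by
      intro k hk
      rw [← Finset.sum_smul]
      split_ifs with h0
      · simp [h0]
      · have hne : (ω ^ k)⁻¹ ≠ 1 := by
          rw [Ne, inv_eq_one]
          exact hω.pow_ne_one_of_pos_of_lt h0 (Finset.mem_range.1 hk)
        have h1 : ∑ j ∈ Finset.range m, (μ * ω ^ j)⁻¹ ^ k =
            μ⁻¹ ^ k * ∑ j ∈ Finset.range m, ((ω ^ k)⁻¹) ^ j := by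
          rw [Finset.mul_sum]
          refine Finset.sum_congr rfl fun j _ => ?_
          rw [mul_inv, mul_pow, inv_pow (ω ^ j), inv_pow (ω ^ k), ← pow_mul, ← pow_mul,
            mul_comm j k]
        rw [h1, geom_sum_eq hne, inv_pow (ω ^ k), ← pow_mul, mul_comm k m, pow_mul, hω.pow_eq_one]
        simp
    rw [Finset.sum_congr rfl hk, Finset.sum_ite_eq' (Finset.range m) 0]
    rw [if_pos (Finset.mem_range.2 hm), smul_smul, inv_mul_cancel₀ (by exact_mod_cast hm0), one_smul]
  obtain ⟨n, rfl⟩ : ∃ n, m = n + 1 := ⟨m - 1, by omega⟩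
  rw [Finset.sum_range_succ', pow_zero, mul_one] at hsum
  rw [← eq_sub_iff_add_eq.2 hsum]
  refine Submodule.sum_mem _ fun j hj => ?_
  refine Submodule.mem_iSup_of_mem ⟨μ * ω ^ (j + 1), ?_⟩ (eigencomponent_mem hT (hωj _) hm x)
  intro h
  exact hω.pow_ne_one_of_pos_of_lt (Nat.succ_ne_zero j) (by
    have := Finset.mem_range.1 hj
    omega) (mul_left_cancel₀ hμ0 (h.trans (mul_one μ).symm))

/-! ### The cyclic cover of a line

`ℓ i` are the linear forms defining the lines `L i ⊂ ℙ²`, so that `∏ i, ℓ i` is a defining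
polynomial of their union, and `W ⊂ ℂ³` is a linear subspace with `Z = ℙ(W)`. -/

variable {d : ℕ} (ℓ : Fin d → Module.Dual ℂ (Fin 3 → ℂ)) (W : Submodule ℂ (Fin 3 → ℂ)) (m : ℕ)

/-- Weighted homogeneous coordinates on the cover: pairs `(w, y)`, `0 ≠ w ∈ W`, `y ∈ ℂ`, with
`y ^ m = ∏ i, ℓ i w`. -/
def CoverCone : Type :=
  {q : W × ℂ // q.1 ≠ 0 ∧ q.2 ^ m = ∏ i, ℓ i q.1}

instance : TopologicalSpace (CoverCone ℓ W m) :=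
  inferInstanceAs (TopologicalSpace {q : W × ℂ // q.1 ≠ 0 ∧ q.2 ^ m = ∏ i, ℓ i q.1})

/-- `(w, y)` and `(t w, t ^ (d / m) y)`, `t ∈ ℂ \ {0}`, are coordinates of the same point. -/
def coverSetoid : Setoid (CoverCone ℓ W m) where
  r a b := ∃ t : ℂˣ, b.1.1 = (t : ℂ) • a.1.1 ∧ b.1.2 = (t : ℂ) ^ (d / m) * a.1.2
  iseqv :=
    { refl := fun a => ⟨1, by simp, by simp⟩
      symm := by
        rintro a b ⟨t, h1, h2⟩
        refine ⟨t⁻¹, ?_, ?_⟩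
        · simp [h1, smul_smul]
        · rw [h2, ← mul_assoc, ← mul_pow]
          simp
      trans := by
        rintro a b c ⟨t, h1, h2⟩ ⟨s, h3, h4⟩
        refine ⟨s * t, ?_, ?_⟩
        · simp [h3, h1, smul_smul]
        · rw [h4, h2]
          push_cast
          ring }

/-- The cyclic cover `y ^ m = ∏ i, ℓ i` of `ℙ(W)` (for `m ∣ d`), with its analytic topology: if
the `ℓ i` have distinct zeros on `ℙ(W) ≅ ℙ¹` it is a compact Riemann surface. -/
def Cover : Type := Quotient (coverSetoid ℓ W m)

instance : TopologicalSpace (Cover ℓ W m) :=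
  inferInstanceAs (TopologicalSpace (Quotient (coverSetoid ℓ W m)))

/-- The covering projection `[w : y] ↦ [w]`. -/
def proj : Cover ℓ W m → ℙ ℂ W :=
  Quotient.lift (fun a : CoverCone ℓ W m => Projectivization.mk ℂ a.1.1 a.2.1) (by
    rintro a b ⟨t, h1, -⟩
    refine (Projectivization.mk_eq_mk_iff' ℂ _ _ _ _).2 ⟨(t : ℂ)⁻¹, ?_⟩
    simp [h1, smul_smul])

/-- The covering transformation `[w : y] ↦ [w : ζ y]`, for `ζ ^ m = 1`. -/
def deck (ζ : ℂ) (hζ : ζ ^ m = 1) : C(Cover ℓ W m, Cover ℓ W m) where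
  toFun := Quotient.map (sa := coverSetoid ℓ W m) (sb := coverSetoid ℓ W m)
    (fun a => ⟨(a.1.1, ζ * a.1.2), a.2.1, by rw [mul_pow, hζ, one_mul, a.2.2]⟩) (by
      rintro a b ⟨t, h1, h2⟩
      exact ⟨t, h1, by simp only [h2]; ring⟩)
  continuous_toFun := by
    refine Continuous.quotient_map' (s := coverSetoid ℓ W m) (t := coverSetoid ℓ W m) ?_ _
    exact Continuous.subtype_mk (by
      have h : Continuous (fun a : CoverCone ℓ W m => a.1) := continuous_subtype_val
      fun_prop) _

variable {W}

/-- The point of `ℙ(W)` with affine coordinate `x ∈ ℂ`, in the affine coordinate with origin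
`[b 0]` and point at infinity `[b 1]` given by a basis `b` of `W`. -/
def affinePoint (b : Module.Basis (Fin 2) ℂ W) (x : ℂ) : ℙ ℂ W :=
  Projectivization.mk ℂ (b 0 + x • b 1) (by
    intro h
    simpa using congrArg (fun w => b.repr w 0) h)

/-- The circle of radius `r ‖z‖` around `z`, run through once counterclockwise from `(1 - r) z`. -/
def circleLoop (z : ℂ) (r : ℝ) : Path ((1 - r) * z : ℂ) ((1 - r) * z : ℂ) where
  toFun t := (1 - r * Complex.exp (2 * Real.pi * Complex.I * (t : ℝ))) * z
  continuous_toFun := by fun_prop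
  source' := by simp
  target' := by simp

/-- The loop at the origin which follows the segment `[0, z]` until distance `r ‖z‖` from `z`, runs
once counterclockwise around `z`, and returns along the segment. -/
def lasso (z : ℂ) (r : ℝ) : Path (0 : ℂ) 0 :=
  ((Path.segment 0 ((1 - r) * z : ℂ)).trans (circleLoop z r)).trans
    (Path.segment 0 ((1 - r) * z : ℂ)).symm

end LineCover

end

open CategoryTheory AlgebraicTopology
open scoped LinearAlgebra.Projectivization Simplicial

noncomputable section

namespace LineCover

section Cochains

variable {X : Type} [TopologicalSpace X]

/-- The straight segment from `a` to `b`, mapped to `X` by `h`. -/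
def seg (h : C(ℝ × ℝ, X)) (a b : ℝ × ℝ) : C(unitInterval, X) :=
  h.comp ⟨fun t => AffineMap.lineMap a b (t : ℝ), by
    simp only [AffineMap.lineMap_apply]
    fun_prop⟩

/-- Closed singular `1`-cochains. -/
def IsCocycle (ψ : C(unitInterval, X) → ℂ) : Prop :=
  ∀ (h : C(ℝ × ℝ, X)) (a b c : ℝ × ℝ), ψ (seg h a b) + ψ (seg h b c) = ψ (seg h a c)

/-- A path, seen as a singular `1`-simplex. -/
def pathSimplex (c : C(unitInterval, X)) : (TopCat.toSSet.obj (TopCat.of X)) _⦋1⦌ :=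
  ((TopCat.of X).toSSetObjEquiv (.op ⦋1⦌)).symm
    (c.comp ⟨stdSimplexHomeomorphUnitInterval, stdSimplexHomeomorphUnitInterval.continuous⟩)

/-- The path underlying a singular `1`-simplex. -/
def simplexPath (s : (TopCat.toSSet.obj (TopCat.of X)) _⦋1⦌) : C(unitInterval, X) :=
  ((TopCat.of X).toSSetObjEquiv (.op ⦋1⦌) s).comp
    ⟨stdSimplexHomeomorphUnitInterval.symm, stdSimplexHomeomorphUnitInterval.symm.continuous⟩

lemma simplexPath_pathSimplex (c : C(unitInterval, X)) : simplexPath (pathSimplex c) = c := by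
  ext t
  simp only [simplexPath, pathSimplex, Equiv.apply_symm_apply]
  exact congrArg c (stdSimplexHomeomorphUnitInterval.apply_symm_apply t)

lemma pathSimplex_simplexPath (s : (TopCat.toSSet.obj (TopCat.of X)) _⦋1⦌) :
    pathSimplex (simplexPath s) = s := by
  apply ((TopCat.of X).toSSetObjEquiv (.op ⦋1⦌)).injective
  ext t
  simp only [simplexPath, pathSimplex, Equiv.apply_symm_apply]
  exact congrArg ((TopCat.of X).toSSetObjEquiv (.op ⦋1⦌) s)
    (stdSimplexHomeomorphUnitInterval.symm_apply_apply t)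

lemma face_coe (i : Fin 3) (t : unitInterval) :
    (stdSimplex.map (S := ℝ) i.succAbove (stdSimplexHomeomorphUnitInterval.symm t) : Fin 3 → ℝ) =
      (![![0, 1 - (t : ℝ), t], ![1 - (t : ℝ), 0, t], ![1 - (t : ℝ), t, 0]] : Fin 3 → Fin 3 → ℝ) i := by
  have h0 : stdSimplexHomeomorphUnitInterval.symm t 0 = 1 - (t : ℝ) := rfl
  have h1 : stdSimplexHomeomorphUnitInterval.symm t 1 = (t : ℝ) := rfl
  funext j
  rw [stdSimplex.map_coe, FunOnFinite.linearMap_apply_apply, Finset.sum_filter, Fin.sum_univ_two,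
    h0, h1]
  fin_cases i <;> fin_cases j <;> simp [Fin.succAbove, Fin.lt_def]

/-- The singular triangle with vertices `h a`, `h b`, `h c`. -/
def triangle (h : C(ℝ × ℝ, X)) (a b c : ℝ × ℝ) : (TopCat.toSSet.obj (TopCat.of X)) _⦋2⦌ :=
  ((TopCat.of X).toSSetObjEquiv (.op ⦋2⦌)).symm
    (h.comp (⟨fun w : stdSimplex ℝ (Fin 3) => w.1 0 • a + w.1 1 • b + w.1 2 • c, by
      have h (i : Fin 3) : Continuous fun w : stdSimplex ℝ (Fin 3) => w.1 i :=
        (continuous_apply i).comp continuous_subtype_val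
      exact (((h 0).smul continuous_const).add ((h 1).smul continuous_const)).add
        ((h 2).smul continuous_const)⟩ :
      C(stdSimplex ℝ (Fin 3), ℝ × ℝ)))

lemma face_triangle (h : C(ℝ × ℝ, X)) (a b c : ℝ × ℝ) (i : Fin 3) :
    (TopCat.toSSet.obj (TopCat.of X)).δ i (triangle h a b c) =
      pathSimplex (seg h (![b, a, a] i) (![c, c, b] i)) := by
  rw [← pathSimplex_simplexPath ((TopCat.toSSet.obj (TopCat.of X)).δ i (triangle h a b c))]
  congr 1
  ext t
  refine congrArg h ?_
  have := face_coe i t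
  change (stdSimplex.map (S := ℝ) i.succAbove (stdSimplexHomeomorphUnitInterval.symm t) :
      Fin 3 → ℝ) 0 • a +
    (stdSimplex.map (S := ℝ) i.succAbove (stdSimplexHomeomorphUnitInterval.symm t) :
      Fin 3 → ℝ) 1 • b +
    (stdSimplex.map (S := ℝ) i.succAbove (stdSimplexHomeomorphUnitInterval.symm t) :
      Fin 3 → ℝ) 2 • c = _
  rw [this]
  fin_cases i <;> ext <;> simp [AffineMap.lineMap_apply] <;> ring

/-- The retraction of the plane onto a triangle. -/
def triangleRetraction : C(ℝ × ℝ, stdSimplex ℝ (Fin 3)) where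
  toFun p :=
    ⟨![1 - max 0 (min p.1 1), max 0 (min p.1 1) - max 0 (min p.2 (max 0 (min p.1 1))),
      max 0 (min p.2 (max 0 (min p.1 1)))], by
      constructor
      · intro i
        fin_cases i
        · simp
        · exact sub_nonneg.2 (max_le (le_max_left _ _) (min_le_right _ _))
        · simp
      · simp [Fin.sum_univ_three]⟩
  continuous_toFun := by
    refine Continuous.subtype_mk (continuous_pi fun i => ?_) _
    fin_cases i
    · simp only [Fin.zero_eta, Matrix.cons_val_zero]; fun_prop
    · simp only [Fin.mk_one, Matrix.cons_val_one, Matrix.cons_val_zero]; fun_prop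
    · simp only [Fin.reduceFinMk, Matrix.cons_val]; fun_prop

lemma exists_triangle (s : (TopCat.toSSet.obj (TopCat.of X)) _⦋2⦌) :
    ∃ (h : C(ℝ × ℝ, X)) (a b c : ℝ × ℝ), s = triangle h a b c := by
  refine ⟨((TopCat.of X).toSSetObjEquiv (.op ⦋2⦌) s).comp triangleRetraction,
    (0, 0), (1, 0), (1, 1), ?_⟩
  apply ((TopCat.of X).toSSetObjEquiv (.op ⦋2⦌)).injective
  unfold triangle
  rw [Equiv.apply_symm_apply]
  ext w
  refine congrArg ((TopCat.of X).toSSetObjEquiv (.op ⦋2⦌) s) ?_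
  have hw := w.2.2
  have h0 := w.2.1 0
  have h1 := w.2.1 1
  have h2 := w.2.1 2
  rw [Fin.sum_univ_three] at hw
  apply Subtype.ext
  have e1 : max 0 (min (w.1 1 + w.1 2) 1) = w.1 1 + w.1 2 := by
    rw [min_eq_left (by linarith), max_eq_right (by linarith)]
  have e2 : max 0 (min (w.1 2) (w.1 1 + w.1 2)) = w.1 2 := by
    rw [min_eq_left (by linarith), max_eq_right (by linarith)]
  funext i
  fin_cases i
  · simp [triangleRetraction, e1]; linarith
  · simp [triangleRetraction, e1, e2]
  · simp [triangleRetraction, e1, e2]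

/-- The value of a linear map on the generator given by a `1`-simplex. -/
def evalCochain (g : ((TopCat.toSSet.obj (TopCat.of X)).chainComplex (ModuleCat.of ℂ ℂ)).X 1 ⟶
    ModuleCat.of ℂ ℂ) (c : C(unitInterval, X)) : ℂ :=
  ((TopCat.toSSet.obj (TopCat.of X)).ιChainComplex (R := ModuleCat.of ℂ ℂ) (pathSimplex c) ≫ g).hom 1

lemma hom_eq_zero_iff {M : ModuleCat.{0} ℂ} (g : ModuleCat.of ℂ ℂ ⟶ M) :
    g = 0 ↔ g.hom (1 : ℂ) = 0 := by
  constructor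
  · rintro rfl
    rfl
  · intro h
    ext
    exact h

lemma isCocycle_evalCochain_iff
    (g : ((TopCat.toSSet.obj (TopCat.of X)).chainComplex (ModuleCat.of ℂ ℂ)).X 1 ⟶
      ModuleCat.of ℂ ℂ) :
    IsCocycle (evalCochain g) ↔
      ((TopCat.toSSet.obj (TopCat.of X)).chainComplex (ModuleCat.of ℂ ℂ)).d 2 1 ≫ g = 0 := by
  have key (h : C(ℝ × ℝ, X)) (a b c : ℝ × ℝ) :
      ((TopCat.toSSet.obj (TopCat.of X)).ιChainComplex (R := ModuleCat.of ℂ ℂ) (triangle h a b c) ≫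
        ((TopCat.toSSet.obj (TopCat.of X)).chainComplex (ModuleCat.of ℂ ℂ)).d 2 1 ≫ g).hom (1 : ℂ) =
      evalCochain g (seg h a b) + evalCochain g (seg h b c) - evalCochain g (seg h a c) := by
    rw [SSet.ιChainComplex_d_assoc, Preadditive.sum_comp, Fin.sum_univ_three, face_triangle,
      face_triangle, face_triangle]
    simp [evalCochain]
    ring
  constructor
  · intro H
    apply SSet.chainComplex_hom_ext
    intro s
    obtain ⟨h, a, b, c, rfl⟩ := exists_triangle s
    rw [Limits.comp_zero, hom_eq_zero_iff, key, H, sub_self]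
  · intro H h a b c
    rw [← sub_eq_zero, ← key, H, Limits.comp_zero]
    rfl

lemma evalCochain_surjective (ψ : C(unitInterval, X) → ℂ) :
    ∃ g, evalCochain g = ψ := by
  let K := TopCat.toSSet.obj (TopCat.of X)
  let f (s : K _⦋1⦌) : ModuleCat.of ℂ ℂ ⟶ ModuleCat.of ℂ ℂ :=
    ModuleCat.ofHom (LinearMap.toSpanSingleton ℂ ℂ (ψ (simplexPath s)))
  refine ⟨Limits.Cofan.IsColimit.desc (K.isColimitChainComplexXCofan (ModuleCat.of ℂ ℂ) 1) f, ?_⟩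
  funext c
  have := Limits.Cofan.IsColimit.fac (K.isColimitChainComplexXCofan (ModuleCat.of ℂ ℂ) 1) f
    (pathSimplex c)
  unfold evalCochain
  refine (congrArg (fun g => g.hom (1 : ℂ)) this).trans ?_
  simp [f, simplexPath_pathSimplex]

/-- A functional on `H₁(X, ℂ)`, as a morphism from the homology of the singular chain complex. -/
def dualHom (φ : Module.Dual ℂ (H1 X)) :
    ((TopCat.toSSet.obj (TopCat.of X)).chainComplex (ModuleCat.of ℂ ℂ)).homology 1 ⟶
      ModuleCat.of ℂ ℂ :=
  (ModuleCat.ofHom φ : H1 X ⟶ ModuleCat.of ℂ ℂ)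

lemma dual_loopClass {a : X} (c : Path a a) (φ : Module.Dual ℂ (H1 X))
    (g : ((TopCat.toSSet.obj (TopCat.of X)).chainComplex (ModuleCat.of ℂ ℂ)).X 1 ⟶
      ModuleCat.of ℂ ℂ)
    (hg : ((TopCat.toSSet.obj (TopCat.of X)).chainComplex (ModuleCat.of ℂ ℂ)).homologyπ 1 ≫
        dualHom φ =
      ((TopCat.toSSet.obj (TopCat.of X)).chainComplex (ModuleCat.of ℂ ℂ)).iCycles 1 ≫ g) :
    φ (loopClass c) = evalCochain g c.toContinuousMap := by
  have h : (((TopCat.toSSet.obj (TopCat.of X)).chainComplex (ModuleCat.of ℂ ℂ)).liftCycles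
      ((TopCat.toSSet.obj (TopCat.of X)).ιChainComplex (loopSimplex c)) 0 (by simp)
      (loopSimplex_isCycle c) ≫
    ((TopCat.toSSet.obj (TopCat.of X)).chainComplex (ModuleCat.of ℂ ℂ)).homologyπ 1) ≫ dualHom φ =
      (TopCat.toSSet.obj (TopCat.of X)).ιChainComplex (pathSimplex c.toContinuousMap) ≫ g := by
    rw [Category.assoc, hg, HomologicalComplex.liftCycles_i_assoc]
    rfl
  exact congrArg (fun f => f.hom (1 : ℂ)) h

/-- A closed cochain defines a functional on `H₁`. -/
lemma IsCocycle.exists_dual {ψ : C(unitInterval, X) → ℂ} (hψ : IsCocycle ψ) :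
    ∃ φ : Module.Dual ℂ (H1 X), ∀ (a : X) (c : Path a a),
      φ (loopClass c) = ψ c.toContinuousMap := by
  obtain ⟨g, rfl⟩ := evalCochain_surjective ψ
  rw [isCocycle_evalCochain_iff] at hψ
  let K := (TopCat.toSSet.obj (TopCat.of X)).chainComplex (ModuleCat.of ℂ ℂ)
  let f : K.homology 1 ⟶ ModuleCat.of ℂ ℂ := K.homologyι 1 ≫ K.descOpcycles g 2 (by simp) hψ
  refine ⟨(show H1 X ⟶ ModuleCat.of ℂ ℂ from f).hom, fun a c => dual_loopClass c _ g ?_⟩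
  change K.homologyπ 1 ≫ f = K.iCycles 1 ≫ g
  simp [f]

/-- Every functional on `H₁` comes from a closed cochain. -/
lemma exists_cochain (φ : Module.Dual ℂ (H1 X)) :
    ∃ g : ((TopCat.toSSet.obj (TopCat.of X)).chainComplex (ModuleCat.of ℂ ℂ)).X 1 ⟶
      ModuleCat.of ℂ ℂ, IsCocycle (evalCochain g) ∧
      ((TopCat.toSSet.obj (TopCat.of X)).chainComplex (ModuleCat.of ℂ ℂ)).homologyπ 1 ≫
        dualHom φ =
      ((TopCat.toSSet.obj (TopCat.of X)).chainComplex (ModuleCat.of ℂ ℂ)).iCycles 1 ≫ g := by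
  let K := (TopCat.toSSet.obj (TopCat.of X)).chainComplex (ModuleCat.of ℂ ℂ)
  have hinj : Function.Injective (K.iCycles 1).hom :=
    (ModuleCat.mono_iff_injective _).1 inferInstance
  obtain ⟨r, hr⟩ : ∃ r : K.X 1 ⟶ K.cycles 1, K.iCycles 1 ≫ r = 𝟙 _ := by
    obtain ⟨r, hr⟩ := LinearMap.exists_leftInverse_of_injective (K.iCycles 1).hom
      (LinearMap.ker_eq_bot.2 hinj)
    refine ⟨ModuleCat.ofHom r, ?_⟩
    ext x
    exact LinearMap.congr_fun hr x
  let g : K.X 1 ⟶ ModuleCat.of ℂ ℂ := r ≫ K.homologyπ 1 ≫ dualHom φ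
  have hg : K.homologyπ 1 ≫ dualHom φ = K.iCycles 1 ≫ g := by
    dsimp only [g]
    rw [← Category.assoc (K.iCycles 1), hr, Category.id_comp]
  refine ⟨g, ?_, hg⟩
  rw [isCocycle_evalCochain_iff]
  change K.d 2 1 ≫ g = 0
  rw [← K.toCycles_i 2 1, Category.assoc, ← hg, K.toCycles_comp_homologyπ_assoc, Limits.zero_comp]

lemma exists_isCocycle (φ : Module.Dual ℂ (H1 X)) :
    ∃ ψ : C(unitInterval, X) → ℂ, IsCocycle ψ ∧ ∀ (a : X) (c : Path a a),
      φ (loopClass c) = ψ c.toContinuousMap := by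
  obtain ⟨g, hg, h⟩ := exists_cochain φ
  exact ⟨_, hg, fun a c => dual_loopClass c φ g h⟩

/-- The part of `γ` between the parameters `a` and `b`. -/
def subpath (γ : C(ℝ, X)) (a b : ℝ) : C(unitInterval, X) :=
  γ.comp ⟨fun t => AffineMap.lineMap a b (t : ℝ), by
    simp only [AffineMap.lineMap_apply]
    fun_prop⟩

lemma subpath_apply (γ : C(ℝ, X)) (a b : ℝ) (t : unitInterval) :
    subpath γ a b t = γ (a + t * (b - a)) := by
  change γ (AffineMap.lineMap a b (t : ℝ)) = _
  rw [AffineMap.lineMap_apply, smul_eq_mul, vsub_eq_sub, vadd_eq_add, add_comm]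

lemma IsCocycle.subpath_add {ψ : C(unitInterval, X) → ℂ} (hψ : IsCocycle ψ) (γ : C(ℝ, X))
    (a b c : ℝ) : ψ (subpath γ a b) + ψ (subpath γ b c) = ψ (subpath γ a c) := by
  have h (a b : ℝ) : subpath γ a b = seg (γ.comp ⟨Prod.fst, continuous_fst⟩) (a, 0) (b, 0) := by
    ext t
    refine congrArg γ ?_
    simp [AffineMap.lineMap_apply]
  rw [h, h, h]
  exact hψ _ _ _ _

lemma IsCocycle.const {ψ : C(unitInterval, X) → ℂ} (hψ : IsCocycle ψ) (x : X) :
    ψ (ContinuousMap.const _ x) = 0 := by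
  have h := hψ (ContinuousMap.const _ x) 0 0 0
  have e : seg (ContinuousMap.const (ℝ × ℝ) x) 0 0 = ContinuousMap.const _ x := rfl
  rw [e] at h
  simpa using h

/-- A path, extended to the real line. -/
def extendReal (γ : C(unitInterval, X)) : C(ℝ, X) :=
  γ.comp ⟨Set.projIcc 0 1 zero_le_one, continuous_projIcc⟩

lemma extendReal_apply (γ : C(unitInterval, X)) (t : unitInterval) :
    extendReal γ t = γ t :=
  congrArg γ (Set.projIcc_val zero_le_one t)

lemma extendReal_zero (γ : C(unitInterval, X)) : extendReal γ 0 = γ 0 :=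
  extendReal_apply γ 0

lemma extendReal_one (γ : C(unitInterval, X)) : extendReal γ 1 = γ 1 :=
  extendReal_apply γ 1

lemma subpath_extendReal (γ : C(unitInterval, X)) : subpath (extendReal γ) 0 1 = γ := by
  ext t
  rw [subpath_apply]
  simpa using extendReal_apply γ t

lemma IsCocycle.trans {ψ : C(unitInterval, X) → ℂ} (hψ : IsCocycle ψ) {x y z : X}
    (p : Path x y) (q : Path y z) :
    ψ (p.trans q).toContinuousMap = ψ p.toContinuousMap + ψ q.toContinuousMap := by
  set γ : C(ℝ, X) := extendReal (p.trans q).toContinuousMap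
  have hγ (t : unitInterval) : γ t = p.trans q t := extendReal_apply _ t
  rw [← subpath_extendReal (p.trans q).toContinuousMap, ← hψ.subpath_add γ 0 (1 / 2) 1]
  congr 2
  · ext t
    rw [subpath_apply]
    have h : (t : ℝ) / 2 ∈ unitInterval := ⟨by linarith [t.2.1], by linarith [t.2.2]⟩
    have := hγ ⟨t / 2, h⟩
    rw [Path.trans_apply, dif_pos (by dsimp only; linarith [t.2.2])] at this
    convert this using 2
    · dsimp only
      ring
    · exact congrArg p (Subtype.ext (by dsimp only; ring))
  · ext t
    rw [subpath_apply]
    have h : (1 + t : ℝ) / 2 ∈ unitInterval := ⟨by linarith [t.2.1], by linarith [t.2.2]⟩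
    have hq : γ (((1 + t : ℝ)) / 2) = q t := by
      rw [hγ ⟨(1 + t : ℝ) / 2, h⟩, Path.trans_apply]
      split_ifs with h1
      · have ht : (t : ℝ) = 0 := le_antisymm (by dsimp only at h1; linarith) t.2.1
        have ht' : t = 0 := Subtype.ext ht
        subst ht'
        simp
      · exact congrArg q (Subtype.ext (by dsimp only; ring))
    refine Eq.trans (congrArg γ ?_) hq
    ring

lemma IsCocycle.symm {ψ : C(unitInterval, X) → ℂ} (hψ : IsCocycle ψ) {x y : X} (p : Path x y) :
    ψ p.symm.toContinuousMap = -ψ p.toContinuousMap := by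
  have h := hψ.subpath_add (extendReal p.toContinuousMap) 0 1 0
  have h0 : subpath (extendReal p.toContinuousMap) 0 0 = ContinuousMap.const _ x := by
    ext t
    rw [subpath_apply]
    simpa using (extendReal_zero p.toContinuousMap).trans p.source
  have h1 : subpath (extendReal p.toContinuousMap) 1 0 = p.symm.toContinuousMap := by
    ext t
    rw [subpath_apply]
    have := extendReal_apply p.toContinuousMap (unitInterval.symm t)
    simpa [sub_eq_add_neg] using this
  rw [subpath_extendReal, h0, h1, hψ.const] at h
  linear_combination h

/-- A closed cochain vanishing on loops is exact. -/
lemma IsCocycle.exists_primitive {ψ : C(unitInterval, X) → ℂ} (hψ : IsCocycle ψ)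
    (h : ∀ (a : X) (c : Path a a), ψ c.toContinuousMap = 0) :
    ∃ F : X → ℂ, ∀ γ : C(unitInterval, X), ψ γ = F (γ 1) - F (γ 0) := by
  have hbase (x : X) : Joined (Quotient.out (s := pathSetoid X) (Quotient.mk _ x)) x :=
    @Quotient.exact _ (pathSetoid X) _ _ (Quotient.out_eq _)
  let F (x : X) : ℂ := ψ (hbase x).somePath.toContinuousMap
  refine ⟨F, fun γ => ?_⟩
  have key {a x y : X} (p : Path a x) (q : Path a y) (r : Path x y) :
      ψ r.toContinuousMap = ψ q.toContinuousMap - ψ p.toContinuousMap := by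
    have := h a ((p.trans r).trans q.symm)
    rw [hψ.trans, hψ.trans, hψ.symm] at this
    linear_combination this
  have hj : Quotient.out (s := pathSetoid X) (Quotient.mk _ (γ 1)) =
      Quotient.out (s := pathSetoid X) (Quotient.mk _ (γ 0)) :=
    congrArg _ (Quotient.sound ⟨(⟨γ, rfl, rfl⟩ : Path (γ 0) (γ 1)).symm⟩)
  exact key (hbase (γ 0)).somePath ((hbase (γ 1)).somePath.cast hj.symm rfl) ⟨γ, rfl, rfl⟩

/-- A point, seen as a singular `0`-simplex. -/
def pointSimplex (x : X) : (TopCat.toSSet.obj (TopCat.of X)) _⦋0⦌ :=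
  ((TopCat.of X).toSSetObjEquiv (.op ⦋0⦌)).symm (ContinuousMap.const _ x)

lemma face_pathSimplex (c : C(unitInterval, X)) (i : Fin 2) :
    (TopCat.toSSet.obj (TopCat.of X)).δ i (pathSimplex c) = pointSimplex (c (![1, 0] i)) := by
  apply ((TopCat.of X).toSSetObjEquiv (.op ⦋0⦌)).injective
  ext u
  have hu : u = stdSimplex.vertex (S := ℝ) (0 : Fin 1) :=
    Subsingleton.elim (α := stdSimplex ℝ (Fin 1)) _ _
  subst hu
  refine (congrArg (fun v => c (stdSimplexHomeomorphUnitInterval v))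
    (stdSimplex.map_vertex (S := ℝ) (SimplexCategory.δ (n := 0) i) (0 : Fin 1))).trans ?_
  change _ = c (![1, 0] i)
  congr 1
  fin_cases i <;> rfl

/-- The classes of loops span the first homology: a functional vanishing on them is zero. -/
lemma dual_eq_zero (φ : Module.Dual ℂ (H1 X))
    (h : ∀ (a : X) (c : Path a a), φ (loopClass c) = 0) : φ = 0 := by
  let K := (TopCat.toSSet.obj (TopCat.of X)).chainComplex (ModuleCat.of ℂ ℂ)
  obtain ⟨g, hg, hgφ⟩ := exists_cochain φ
  obtain ⟨F, hF⟩ := hg.exists_primitive fun a c => (dual_loopClass c φ g hgφ).symm.trans (h a c)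
  let f (s : (TopCat.toSSet.obj (TopCat.of X)) _⦋0⦌) : ModuleCat.of ℂ ℂ ⟶ ModuleCat.of ℂ ℂ :=
    ModuleCat.ofHom (LinearMap.toSpanSingleton ℂ ℂ
      (F ((TopCat.of X).toSSetObjEquiv (.op ⦋0⦌) s (stdSimplex.vertex (S := ℝ) (0 : Fin 1)))))
  let G : K.X 0 ⟶ ModuleCat.of ℂ ℂ := Limits.Cofan.IsColimit.desc
    ((TopCat.toSSet.obj (TopCat.of X)).isColimitChainComplexXCofan (ModuleCat.of ℂ ℂ) 0) f
  have hG (x : X) : ((TopCat.toSSet.obj (TopCat.of X)).ιChainComplex (R := ModuleCat.of ℂ ℂ)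
      (pointSimplex x) ≫ G).hom (1 : ℂ) = F x := by
    have := Limits.Cofan.IsColimit.fac
      ((TopCat.toSSet.obj (TopCat.of X)).isColimitChainComplexXCofan (ModuleCat.of ℂ ℂ) 0) f
      (pointSimplex x)
    refine (congrArg (fun g => g.hom (1 : ℂ)) this).trans ?_
    simp [f, pointSimplex]
  have hgG : g = K.d 1 0 ≫ G := by
    apply SSet.chainComplex_hom_ext
    intro s
    refine sub_eq_zero.1 ((hom_eq_zero_iff _).2 ?_)
    rw [← pathSimplex_simplexPath s, SSet.ιChainComplex_d_assoc,
      Preadditive.sum_comp, Fin.sum_univ_two, face_pathSimplex, face_pathSimplex]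
    have h1 := hG (simplexPath s 1)
    have h0 := hG (simplexPath s 0)
    have h2 := hF (simplexPath s)
    unfold evalCochain at h2
    simp only [Fin.val_zero, pow_zero, one_smul, Fin.val_one, pow_one, neg_smul,
      Preadditive.neg_comp, ModuleCat.hom_sub, ModuleCat.hom_add, ModuleCat.hom_neg,
      LinearMap.sub_apply, LinearMap.add_apply, LinearMap.neg_apply, Matrix.cons_val_zero,
      Matrix.cons_val_one] 
    rw [h2, h1, h0]
    ring
  have hz : K.homologyπ 1 ≫ dualHom φ = 0 := by
    rw [hgφ, hgG, ← Category.assoc (K.iCycles 1), K.iCycles_d, Limits.zero_comp]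
  have hz' : dualHom φ = 0 := by
    rw [← cancel_epi (K.homologyπ 1), hz, Limits.comp_zero]
  exact congrArg (fun f => f.hom) hz'

lemma pushforward_loopClass (g : C(X, X)) {a : X} (c : Path a a) :
    pushforward g (loopClass c) = loopClass (c.map g.continuous) := by
  let K := (TopCat.toSSet.obj (TopCat.of X)).chainComplex (ModuleCat.of ℂ ℂ)
  let f : K ⟶ K := SSet.chainComplexMap (TopCat.toSSet.map (TopCat.ofHom g)) (ModuleCat.of ℂ ℂ)
  have h : (K.liftCycles ((TopCat.toSSet.obj (TopCat.of X)).ιChainComplex (loopSimplex c)) 0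
      (by simp) (loopSimplex_isCycle c) ≫ K.homologyπ 1) ≫ HomologicalComplex.homologyMap f 1 =
      K.liftCycles ((TopCat.toSSet.obj (TopCat.of X)).ιChainComplex
        (loopSimplex (c.map g.continuous))) 0
        (by simp) (loopSimplex_isCycle (c.map g.continuous)) ≫ K.homologyπ 1 := by
    rw [Category.assoc, HomologicalComplex.homologyπ_naturality, ← Category.assoc]
    congr 1
    rw [← cancel_mono (K.iCycles 1), Category.assoc, HomologicalComplex.cyclesMap_i,
      HomologicalComplex.liftCycles_i_assoc, HomologicalComplex.liftCycles_i]
    exact SSet.ι_chainComplexMap_f _ _ (TopCat.toSSet.map (TopCat.ofHom g)) (ModuleCat.of ℂ ℂ)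
      (loopSimplex c)
  exact congrArg (fun f => f.hom (1 : ℂ)) h

end Cochains

section Potentials

open Filter Topology

variable {X : Type} [TopologicalSpace X]

/-- `F` is a primitive of the cochain `ψ` along the paths in `U`. -/
def IsPotential (ψ : C(unitInterval, X) → ℂ) (F : X → ℂ) (U : Set X) : Prop :=
  ∀ γ : C(unitInterval, X), (∀ t, γ t ∈ U) → ψ γ = F (γ 1) - F (γ 0)

lemma IsPotential.mono {ψ : C(unitInterval, X) → ℂ} {F : X → ℂ} {U V : Set X}
    (h : IsPotential ψ F U) (hVU : V ⊆ U) : IsPotential ψ F V :=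
  fun γ hγ => h γ fun t => hVU (hγ t)

lemma IsPotential.congr {ψ : C(unitInterval, X) → ℂ} {F G : X → ℂ} {U : Set X}
    (h : IsPotential ψ F U) (hFG : ∀ x ∈ U, F x = G x) : IsPotential ψ G U := fun γ hγ => by
  rw [h γ hγ, hFG _ (hγ 1), hFG _ (hγ 0)]

lemma IsPotential.sub {ψ ψ' : C(unitInterval, X) → ℂ} {F F' : X → ℂ} {U : Set X}
    (h : IsPotential ψ F U) (h' : IsPotential ψ' F' U) : IsPotential (ψ - ψ') (F - F') U :=
  fun γ hγ => by
    rw [Pi.sub_apply, h γ hγ, h' γ hγ, Pi.sub_apply, Pi.sub_apply]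
    ring

lemma IsPotential.sub_self {ψ : C(unitInterval, X) → ℂ} {F F' : X → ℂ} {U : Set X}
    (h : IsPotential ψ F U) (h' : IsPotential ψ F' U) : IsPotential 0 (F - F') U := by
  simpa using h.sub h'

lemma isCocycle_zero : IsCocycle (0 : C(unitInterval, X) → ℂ) := fun h a b c => by simp

lemma IsCocycle.add {ψ ψ' : C(unitInterval, X) → ℂ} (h : IsCocycle ψ) (h' : IsCocycle ψ') :
    IsCocycle (ψ + ψ') := fun k a b c => by
  simp only [Pi.add_apply, ← h k a b c, ← h' k a b c]
  ring

lemma IsCocycle.smul {ψ : C(unitInterval, X) → ℂ} (h : IsCocycle ψ) (r : ℂ) :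
    IsCocycle (r • ψ) := fun k a b c => by
  simp only [Pi.smul_apply, ← h k a b c, smul_add]

lemma IsCocycle.sum {ι : Type*} (s : Finset ι) {ψ : ι → C(unitInterval, X) → ℂ}
    (h : ∀ i ∈ s, IsCocycle (ψ i)) : IsCocycle (∑ i ∈ s, ψ i) := by
  induction s using Finset.cons_induction with
  | empty => simpa using isCocycle_zero
  | cons i s his ih =>
    rw [Finset.sum_cons]
    exact (h i (Finset.mem_cons_self i s)).add
      (ih fun j hj => h j (Finset.mem_cons_of_mem hj))

lemma IsCocycle.comp {ψ : C(unitInterval, X) → ℂ} (h : IsCocycle ψ) (g : C(X, X)) :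
    IsCocycle fun γ => ψ (g.comp γ) :=
  fun k a b c => h (g.comp k) a b c

/-- A function which is a potential near each point of a path is a potential along this path. -/
lemma IsCocycle.eq_sub_of_local {ψ : C(unitInterval, X) → ℂ} (hψ : IsCocycle ψ) {F : X → ℂ}
    (γ : C(unitInterval, X)) (h : ∀ t, ∃ U ∈ 𝓝 (γ t), IsPotential ψ F U) :
    ψ γ = F (γ 1) - F (γ 0) := by
  set g := extendReal γ
  have hloc : IsLocallyConstant fun t => ψ (subpath g 0 t) - F (g t) := by
    rw [IsLocallyConstant.iff_eventually_eq]
    intro t₀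
    obtain ⟨U, hU, hF⟩ := h (Set.projIcc 0 1 zero_le_one t₀)
    have hU' : g ⁻¹' U ∈ 𝓝 t₀ := g.continuous.continuousAt hU
    obtain ⟨ε, hε, hball⟩ := Metric.mem_nhds_iff.1 hU'
    filter_upwards [Metric.ball_mem_nhds t₀ hε] with t ht
    have h1 := hF (subpath g t₀ t) fun s => by
      apply hball
      refine (convex_ball t₀ ε).segment_subset (Metric.mem_ball_self hε) ht ?_
      rw [segment_eq_image_lineMap]
      exact ⟨s, s.2, rfl⟩
    have h2 := hψ.subpath_add g 0 t₀ t
    have e1 : subpath g t₀ t 1 = g t := by simp [subpath_apply]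
    have e0 : subpath g t₀ t 0 = g t₀ := by simp [subpath_apply]
    rw [e1, e0] at h1
    linear_combination h1 - h2
  have h01 := hloc.apply_eq_of_preconnectedSpace 0 1
  have e : subpath g 0 0 = ContinuousMap.const _ (γ 0) := by
    ext t
    rw [subpath_apply]
    simpa using extendReal_zero γ
  rw [e, hψ.const, subpath_extendReal, extendReal_zero, extendReal_one] at h01
  linear_combination -h01

lemma IsCocycle.isPotential_of_local {ψ : C(unitInterval, X) → ℂ} (hψ : IsCocycle ψ) {F : X → ℂ}
    {U : Set X} (h : ∀ x ∈ U, ∃ V ∈ 𝓝 x, IsPotential ψ F V) : IsPotential ψ F U :=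
  fun γ hγ => hψ.eq_sub_of_local γ fun t => h _ (hγ t)

/-- A function which is locally constant on an open set is constant along its paths. -/
lemma isPotential_zero_of_eventually {F : X → ℂ} {U : Set X}
    (h : ∀ x ∈ U, ∀ᶠ y in 𝓝 x, F y = F x) : IsPotential 0 F U := by
  refine isCocycle_zero.isPotential_of_local fun x hx => ⟨_, h x hx, fun γ hγ => ?_⟩
  rw [hγ 1, hγ 0, sub_self, Pi.zero_apply]

/-- A set which can be contracted in `X` has a potential. -/
lemma IsCocycle.isPotential_of_contraction {ψ : C(unitInterval, X) → ℂ} (hψ : IsCocycle ψ)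
    {U : Set X} (H : X → C(unitInterval, X))
    (hcont : ContinuousOn (fun p : X × unitInterval => H p.1 p.2) (U ×ˢ Set.univ))
    (hone : ∀ x ∈ U, H x 1 = x)
    (hzero : ∀ γ : C(unitInterval, X), (∀ t, γ t ∈ U) → ∀ t, H (γ t) 0 = H (γ 0) 0) :
    IsPotential ψ (fun x => ψ (H x)) U := by
  intro γ hγ
  have hc : Continuous fun p : ℝ × ℝ => ((extendReal γ p.1, Set.projIcc 0 1 zero_le_one p.2) :
      X × unitInterval) := by
    refine Continuous.prodMk ((extendReal γ).continuous.comp continuous_fst) ?_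
    exact continuous_projIcc.comp continuous_snd
  let h : C(ℝ × ℝ, X) := ⟨_, hcont.comp_continuous hc fun p => ⟨hγ _, Set.mem_univ _⟩⟩
  have hh (s t : unitInterval) : h (s, t) = H (γ s) t := by
    change H (extendReal γ s) (Set.projIcc 0 1 zero_le_one (t : ℝ)) = _
    rw [extendReal_apply, Set.projIcc_val]
  have e1 : seg h (0, 1) (1, 1) = γ := by
    ext t
    have := hh t 1
    rw [hone _ (hγ t)] at this
    rw [← this]
    exact congrArg h (by simp [AffineMap.lineMap_apply])
  have e2 : seg h (0, 0) (1, 0) = ContinuousMap.const _ (H (γ 0) 0) := by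
    ext t
    have := hh t 0
    rw [hzero γ hγ t] at this
    refine Eq.trans (congrArg h ?_) this
    simp [AffineMap.lineMap_apply]
  have e3 : seg h (0, 0) (0, 1) = H (γ 0) := by
    ext t
    refine Eq.trans (congrArg h ?_) (hh 0 t)
    simp [AffineMap.lineMap_apply]
  have e4 : seg h (1, 0) (1, 1) = H (γ 1) := by
    ext t
    refine Eq.trans (congrArg h ?_) (hh 1 t)
    simp [AffineMap.lineMap_apply]
  have h1 := hψ h (0, 0) (0, 1) (1, 1)
  have h2 := hψ h (0, 0) (1, 0) (1, 1)
  rw [e1, e3] at h1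
  rw [e2, e4, hψ.const] at h2
  linear_combination h1 - h2

end Potentials

section Torsors

open Filter Topology

variable {X : Type} {ι : Type} (U : ι → Set X) (F : ι → X → ℂ)

/-- `f` is a primitive of the multivalued function given by the branches `F a` on `U a`, pulled
back by `h`. -/
def IsBranch {K : Type} [TopologicalSpace K] (h : K → X) (f : K → ℂ) : Prop :=
  ∀ a k, h k ∈ U a → ∀ᶠ k' in 𝓝 k, f k' - F a (h k') = f k - F a (h k)

variable {U F}

lemma IsBranch.comp {K K' : Type} [TopologicalSpace K] [TopologicalSpace K'] {h : K → X}
    {f : K → ℂ} (hf : IsBranch U F h f) {g : K' → K} (hg : Continuous g) :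
    IsBranch U F (h ∘ g) (f ∘ g) :=
  fun a k hk => (hg.tendsto k).eventually (hf a (g k) hk)

lemma IsBranch.sub_eq {K : Type} [TopologicalSpace K] [PreconnectedSpace K]
    (hU : ⋃ a, U a = Set.univ) {h : K → X} {f f' : K → ℂ} (hf : IsBranch U F h f) (hf' : IsBranch U F h f') (k l : K) :
    f k - f l = f' k - f' l := by
  have hloc : IsLocallyConstant (fun k => f k - f' k) := by
    rw [IsLocallyConstant.iff_eventually_eq]
    intro k
    obtain ⟨a, ha⟩ := Set.mem_iUnion.1 (hU.symm ▸ Set.mem_univ (h k))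
    filter_upwards [hf a k ha, hf' a k ha] with k' h1 h2
    linear_combination h1 - h2
  have := hloc.apply_eq_of_preconnectedSpace k l
  linear_combination this

variable [TopologicalSpace X]

/-- The complex numbers with the discrete topology. -/
@[ext]
structure DiscreteComplex where
  /-- The underlying complex number. -/
  val : ℂ

instance : TopologicalSpace DiscreteComplex := ⊥

instance : DiscreteTopology DiscreteComplex := ⟨rfl⟩

/-- The sheaf of branches of a multivalued function, as a covering space. -/
def branchBundle (hopen : ∀ a, IsOpen (U a)) (hU : ⋃ a, U a = Set.univ)
    (hF : ∀ a b, ∀ x ∈ U a ∩ U b, ∀ᶠ y in 𝓝 x, F a y - F b y = F a x - F b x) :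
    FiberBundleCore ι X DiscreteComplex where
  baseSet := U
  isOpen_baseSet := hopen
  indexAt x := (Set.mem_iUnion.1 (hU.symm ▸ Set.mem_univ x)).choose
  mem_baseSet_at x := (Set.mem_iUnion.1 (hU.symm ▸ Set.mem_univ x)).choose_spec
  coordChange a b x v := ⟨v.val + (F a x - F b x)⟩
  coordChange_self a x _ v := by
    simp
  continuousOn_coordChange a b := by
    rintro ⟨x, v⟩ ⟨hx, -⟩
    refine ContinuousAt.continuousWithinAt ?_
    refine Tendsto.congr' (f₁ := fun _ => (⟨v.val + (F a x - F b x)⟩ : DiscreteComplex)) ?_ tendsto_const_nhds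
    have hv : ∀ᶠ w in 𝓝 v, w = v := by
      rw [nhds_discrete]
      exact eventually_pure.2 rfl
    filter_upwards [(hF a b x hx).prod_nhds hv] with p hp
    rw [hp.1, hp.2]
  coordChange_comp a b c x _ v := by
    ext
    simp only
    ring

/-- Multivalued functions with locally constant differences of branches can be continued along
simply connected domains. -/
lemma exists_isBranch (hopen : ∀ a, IsOpen (U a)) (hU : ⋃ a, U a = Set.univ)
    (hF : ∀ a b, ∀ x ∈ U a ∩ U b, ∀ᶠ y in 𝓝 x, F a y - F b y = F a x - F b x)
    {K : Type} [TopologicalSpace K] [SimplyConnectedSpace K] [LocallyPathConnectedSpace K]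
    (h : C(K, X)) : ∃ f : K → ℂ, IsBranch U F h f := by
  let Z := branchBundle hopen hU hF
  obtain ⟨k₀⟩ : Nonempty K := inferInstance
  let e₀ : Bundle.TotalSpace DiscreteComplex Z.Fiber := ⟨h k₀, (⟨0⟩ : DiscreteComplex)⟩
  have hcov : IsCoveringMap (Bundle.TotalSpace.proj : Bundle.TotalSpace DiscreteComplex Z.Fiber → X) :=
    FiberBundle.isCoveringMap
  obtain ⟨H, ⟨-, hH⟩, -⟩ := hcov.existsUnique_continuousMap_lifts h k₀ e₀ rfl
  have hproj (k : K) : (H k).proj = h k := congrFun hH k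
  refine ⟨fun k => DiscreteComplex.val (H k).snd + F (Z.indexAt (H k).proj) (H k).proj, fun a k hk => ?_⟩
  have hcont : ContinuousAt (fun k' => (Z.localTriv a (H k')).2) k := by
    refine continuous_snd.continuousAt.comp
      (ContinuousAt.comp (f := H) ?_ H.continuous.continuousAt)
    refine (Z.localTriv a).continuousAt ?_
    rw [(Z.localTriv a).mem_source]
    change (H k).proj ∈ U a
    rw [hproj]
    exact hk
  have hev : ∀ᶠ k' in 𝓝 k, (Z.localTriv a (H k')).2 = (Z.localTriv a (H k)).2 := by
    have := hcont.tendsto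
    rw [nhds_discrete DiscreteComplex, tendsto_pure] at this
    exact this
  filter_upwards [hev] with k' hk'
  have hval (k : K) : (Z.localTriv a (H k)).2.val =
      DiscreteComplex.val (H k).snd + (F (Z.indexAt (H k).proj) (H k).proj - F a (H k).proj) := rfl
  rw [← hproj k, ← hproj k']
  have := (hval k').symm.trans (Eq.trans (congrArg DiscreteComplex.val hk') (hval k))
  linear_combination this

/-- Multivalued functions with locally constant differences of branches define cocycles. -/
theorem exists_isCocycle_of_branches (hopen : ∀ a, IsOpen (U a)) (hU : ⋃ a, U a = Set.univ)
    (hF : ∀ a b, ∀ x ∈ U a ∩ U b, ∀ᶠ y in 𝓝 x, F a y - F b y = F a x - F b x) :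
    ∃ ψ : C(unitInterval, X) → ℂ, IsCocycle ψ ∧ ∀ a, IsPotential ψ (F a) (U a) := by
  have hex (γ : C(unitInterval, X)) : ∃ f : unitInterval → ℂ, IsBranch U F γ f := by
    obtain ⟨f, hf⟩ := exists_isBranch hopen hU hF
      ((extendReal γ).comp ⟨(Prod.fst : ℝ × ℝ → ℝ), continuous_fst⟩)
    refine ⟨fun t => f (t, 0), ?_⟩
    have := hf.comp (g := fun t : unitInterval => ((t : ℝ), (0 : ℝ))) (by fun_prop)
    have e : ⇑((extendReal γ).comp ⟨(Prod.fst : ℝ × ℝ → ℝ), continuous_fst⟩) ∘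
        (fun t : unitInterval => ((t : ℝ), (0 : ℝ))) = γ :=
      funext fun t => extendReal_apply γ t
    rwa [e] at this
  choose f hf using hex
  have huniq {γ : C(unitInterval, X)} {g : unitInterval → ℂ} (hg : IsBranch U F γ g) :
      f γ 1 - f γ 0 = g 1 - g 0 := (hf γ).sub_eq hU hg 1 0
  refine ⟨fun γ => f γ 1 - f γ 0, fun h a b c => ?_, fun a γ hγ => ?_⟩
  · obtain ⟨g, hg⟩ := exists_isBranch hopen hU hF h
    have key (a b : ℝ × ℝ) : f (seg h a b) 1 - f (seg h a b) 0 = g b - g a := by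
      have := huniq (γ := seg h a b) (hg.comp
        (g := fun t : unitInterval => AffineMap.lineMap a b (t : ℝ))
        (by simp only [AffineMap.lineMap_apply]; fun_prop))
      simpa using this
    simp only [key]
    ring
  · refine huniq (g := fun t => F a (γ t)) fun b t ht => ?_
    exact (γ.continuous.tendsto t).eventually (hF a b (γ t) ⟨hγ t, ht⟩)

end Torsors

section Roots

open Filter Topology

/-- The `m`-th roots of a number form a finite set. -/
lemma finite_setOf_pow_eq {m : ℕ} (hm : m ≠ 0) (κ : ℂ) : {w | (w : ℂ) ^ m = κ}.Finite := by
  refine (Multiset.finite_toSet (Polynomial.nthRoots m κ)).subset fun w hw => ?_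
  exact (Polynomial.mem_nthRoots (Nat.pos_of_ne_zero hm)).2 hw

lemma eq_of_pow_eq_of_isPreconnected {α : Type*} [TopologicalSpace α] {m : ℕ} (hm : m ≠ 0) {κ : ℂ}
    {s : Set α} (hs : IsPreconnected s) {w : α → ℂ} (hw : ContinuousOn w s)
    (h : ∀ x ∈ s, w x ^ m = κ) {x y : α} (hx : x ∈ s) (hy : y ∈ s) : w x = w y := by
  exact hs.constant_of_mapsTo (finite_setOf_pow_eq hm κ).isDiscrete hw h hx hy

lemma eventually_eq_of_pow_eq {α : Type*} [TopologicalSpace α] {m : ℕ} (hm : m ≠ 0) {κ : ℂ}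
    {w : α → ℂ} {x : α} (hw : ContinuousAt w x) (h : ∀ᶠ y in 𝓝 x, w y ^ m = κ) :
    ∀ᶠ y in 𝓝 x, w y = w x := by
  have hfin : ({v | (v : ℂ) ^ m = κ} \ {w x}).Finite := (finite_setOf_pow_eq hm κ).sdiff
  have hmem : ({v | (v : ℂ) ^ m = κ} \ {w x})ᶜ ∈ 𝓝 (w x) :=
    hfin.isClosed.isOpen_compl.mem_nhds fun hx => hx.2 rfl
  filter_upwards [hw hmem, h] with y hy hy'
  by_contra hne
  exact hy ⟨hy', hne⟩

/-- The principal `m`-th root. -/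
def proot (m : ℕ) (u : ℂ) : ℂ := u ^ ((m : ℂ)⁻¹)

lemma proot_pow {m : ℕ} (hm : m ≠ 0) (u : ℂ) : proot m u ^ m = u :=
  Complex.cpow_nat_inv_pow u hm

lemma proot_ne_zero {m : ℕ} {u : ℂ} (hu : u ≠ 0) : proot m u ≠ 0 := by
  rw [proot, Complex.cpow_def_of_ne_zero hu]
  exact Complex.exp_ne_zero _

lemma continuousAt_proot {m : ℕ} {u : ℂ} (hu : u ∈ Complex.slitPlane) :
    ContinuousAt (proot m) u :=
  continuousAt_id.cpow continuousAt_const hu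

variable {n : ℕ}

/-- The plane, slit along the rays from `x₀ + a k` in the direction of `a k`. -/
def starSet (x₀ : ℂ) (a : Fin n → ℂ) : Set ℂ :=
  {x | ∀ k, 1 - (x - x₀) / a k ∈ Complex.slitPlane}

/-- The branch of the `m`-th root of `∏ k, (1 - (x - x₀) / a k)` on `starSet x₀ a`. -/
def starRoot (m : ℕ) (x₀ : ℂ) (a : Fin n → ℂ) (x : ℂ) : ℂ :=
  ∏ k, proot m (1 - (x - x₀) / a k)

lemma isOpen_starSet (x₀ : ℂ) (a : Fin n → ℂ) : IsOpen (starSet x₀ a) := by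
  have : starSet x₀ a = ⋂ k, (fun x => 1 - (x - x₀) / a k) ⁻¹' Complex.slitPlane := by
    ext x
    simp [starSet]
  rw [this]
  refine isOpen_iInter_of_finite fun k => Complex.isOpen_slitPlane.preimage ?_
  fun_prop

lemma starSet_line {x₀ : ℂ} {a : Fin n → ℂ} {x : ℂ} (hx : x ∈ starSet x₀ a) {t : ℝ} (h0 : 0 ≤ t)
    (h1 : t ≤ 1) : x₀ + t * (x - x₀) ∈ starSet x₀ a := by
  intro k
  have := Complex.starConvex_one_slitPlane (hx k) (sub_nonneg.2 h1) h0 (by ring)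
  convert this using 1
  simp only [Complex.real_smul]
  push_cast
  ring

lemma continuousOn_starRoot (m : ℕ) (x₀ : ℂ) (a : Fin n → ℂ) :
    ContinuousOn (starRoot m x₀ a) (starSet x₀ a) := by
  unfold starRoot
  refine continuousOn_finsetProd _ fun k _ x hx => ContinuousAt.continuousWithinAt ?_
  exact (continuousAt_proot (hx k)).comp
    (f := fun x => 1 - (x - x₀) / a k) (by fun_prop)

lemma starRoot_ne_zero {m : ℕ} {x₀ : ℂ} {a : Fin n → ℂ} {x : ℂ} (hx : x ∈ starSet x₀ a) :
    starRoot m x₀ a x ≠ 0 :=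
  Finset.prod_ne_zero_iff.2 fun k _ => proot_ne_zero (Complex.slitPlane_ne_zero (hx k))

lemma starRoot_pow {m : ℕ} (hm : m ≠ 0) (x₀ : ℂ) (a : Fin n → ℂ) (x : ℂ) :
    starRoot m x₀ a x ^ m = ∏ k, (1 - (x - x₀) / a k) := by
  rw [starRoot, ← Finset.prod_pow]
  exact Finset.prod_congr rfl fun k _ => proot_pow hm _

end Roots

section Charts

open Filter Topology

/-- A chart identifying an open subset of `X` with the plane curve `y ^ m = f x`. -/
structure PlaneChart (X : Type) [TopologicalSpace X] (m : ℕ) (f : ℂ → ℂ) where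
  /-- The domain of the chart. -/
  dom : Set X
  /-- The first coordinate. -/
  x : X → ℂ
  /-- The second coordinate. -/
  y : X → ℂ
  /-- The point with given coordinates. -/
  pt : ℂ → ℂ → X
  isOpen_dom : IsOpen dom
  continuousOn_x : ContinuousOn x dom
  continuousOn_y : ContinuousOn y dom
  y_pow : ∀ q ∈ dom, y q ^ m = f (x q)
  continuousOn_pt : ContinuousOn (fun p : ℂ × ℂ => pt p.1 p.2) {p | p.2 ^ m = f p.1}
  pt_mem : ∀ {a b : ℂ}, b ^ m = f a → pt a b ∈ dom
  x_pt : ∀ {a b : ℂ}, b ^ m = f a → x (pt a b) = a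
  y_pt : ∀ {a b : ℂ}, b ^ m = f a → y (pt a b) = b
  pt_x_y : ∀ q ∈ dom, pt (x q) (y q) = q

namespace PlaneChart

variable {X : Type} [TopologicalSpace X] {m : ℕ} {f : ℂ → ℂ} (c : PlaneChart X m f)

/-- The points of the chart over a set `V` of the plane. -/
def above (V : Set ℂ) : Set X := {q | q ∈ c.dom ∧ c.x q ∈ V}

lemma isOpen_above {V : Set ℂ} (hV : IsOpen V) : IsOpen (c.above V) :=
  c.continuousOn_x.isOpen_inter_preimage c.isOpen_dom hV

lemma continuousAt_x {q : X} (hq : q ∈ c.dom) : ContinuousAt c.x q :=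
  c.continuousOn_x.continuousAt (c.isOpen_dom.mem_nhds hq)

lemma continuousAt_y {q : X} (hq : q ∈ c.dom) : ContinuousAt c.y q :=
  c.continuousOn_y.continuousAt (c.isOpen_dom.mem_nhds hq)

lemma ext_of_coord {q q' : X} (hq : q ∈ c.dom) (hq' : q' ∈ c.dom) (hx : c.x q = c.x q')
    (hy : c.y q = c.y q') : q = q' := by
  rw [← c.pt_x_y q hq, ← c.pt_x_y q' hq', hx, hy]

/-- The path with given coordinates. -/
def curve (x y : C(unitInterval, ℂ)) (h : ∀ t, y t ^ m = f (x t)) : C(unitInterval, X) where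
  toFun t := c.pt (x t) (y t)
  continuous_toFun := c.continuousOn_pt.comp_continuous (x.continuous.prodMk y.continuous) h

/-- Paths in the plane lift along a branch `Y` of the curve. -/
lemma exists_lift {V : Set ℂ} {Y : ℂ → ℂ} (hYc : ContinuousOn Y V) (hY0 : ∀ x ∈ V, Y x ≠ 0)
    {κ : ℂ} (hY : ∀ x ∈ V, f x = κ * Y x ^ m) (p : C(unitInterval, ℂ)) (hp : ∀ t, p t ∈ V) {q : X}
    (hq : q ∈ c.dom) (hqp : c.x q = p 0) :
    ∃ γ : C(unitInterval, X), γ 0 = q ∧ ∀ t, γ t ∈ c.dom ∧ c.x (γ t) = p t ∧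
      c.y (γ t) = c.y q / Y (p 0) * Y (p t) := by
  let y : C(unitInterval, ℂ) := ⟨fun t => c.y q / Y (p 0) * Y (p t),
    continuous_const.mul (hYc.comp_continuous p.continuous hp)⟩
  have hy (t) : y t ^ m = f (p t) := by
    have h0 := c.y_pow q hq
    rw [hqp, hY _ (hp 0)] at h0
    change (c.y q / Y (p 0) * Y (p t)) ^ m = _
    rw [mul_pow, div_pow, h0, hY _ (hp t), mul_div_assoc, div_self (pow_ne_zero _ (hY0 _ (hp 0))),
      mul_one]
  refine ⟨c.curve p y hy, ?_, fun t => ⟨c.pt_mem (hy t), c.x_pt (hy t), c.y_pt (hy t)⟩⟩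
  have h0 : y 0 = c.y q := div_mul_cancel₀ _ (hY0 _ (hp 0))
  change c.pt (p 0) (y 0) = q
  rw [h0, ← hqp, c.pt_x_y q hq]

end PlaneChart

/-- The action of the `m`-th roots of unity on a space covered by plane curves. -/
structure DeckAction (X : Type) [TopologicalSpace X] (m : ℕ) where
  /-- The action of a root of unity. -/
  act : ∀ u : ℂ, u ^ m = 1 → C(X, X)

variable {X : Type} [TopologicalSpace X] {m : ℕ} {f : ℂ → ℂ}

/-- The action is given by `(x, y) ↦ (x, u y)` in the chart `c`. -/
def PlaneChart.Compatible (c : PlaneChart X m f) (D : DeckAction X m) : Prop :=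
  ∀ u (hu : u ^ m = 1), ∀ q ∈ c.dom,
    D.act u hu q ∈ c.dom ∧ c.x (D.act u hu q) = c.x q ∧ c.y (D.act u hu q) = u * c.y q

/-- Cochains of weight `b` under the deck transformations. -/
def DeckAction.IsEquivariant (D : DeckAction X m) (b : ℕ) (ψ : C(unitInterval, X) → ℂ) : Prop :=
  ∀ u (hu : u ^ m = 1) γ, ψ ((D.act u hu).comp γ) = u ^ b * ψ γ

/-- Functions of weight `b` under the deck transformations, on an invariant set. -/
def DeckAction.HasWeight (D : DeckAction X m) (b : ℕ) (F : X → ℂ) (U : Set X) : Prop :=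
  ∀ u (hu : u ^ m = 1), ∀ q ∈ U, F (D.act u hu q) = u ^ b * F q

/-- Potentials over star-shaped sets on which the curve has at most one branch point, the centre of
the star. -/
lemma PlaneChart.exists_potential (c : PlaneChart X m f) (D : DeckAction X m)
    (hcD : c.Compatible D) (hm : m ≠ 0) {n : ℕ} {x₀ : ℂ} {a : Fin n → ℂ} {K : ℂ} {ε : ℕ}
    (hf : ∀ x, f x = K * (x - x₀) ^ ε * ∏ k, (1 - (x - x₀) / a k)) {b : ℕ}
    {ψ : C(unitInterval, X) → ℂ} (hψ : IsCocycle ψ) (hψD : D.IsEquivariant b ψ) :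
    ∃ F : X → ℂ, IsPotential ψ F (c.above (starSet x₀ a)) ∧
      D.HasWeight b F (c.above (starSet x₀ a)) := by
  obtain ⟨τ, hτ1, hτ⟩ : ∃ τ : C(unitInterval, ℂ), τ 1 = 1 ∧ ∀ t, τ t ^ m = (t : ℂ) ^ ε := by
    refine ⟨⟨fun t => (((t : ℝ) ^ ((ε : ℝ) / m) : ℝ) : ℂ), ?_⟩, ?_, fun t => ?_⟩
    · refine Complex.continuous_ofReal.comp (continuous_subtype_val.rpow_const fun t => Or.inr ?_)
      positivity
    · change ((((1 : unitInterval) : ℝ) ^ ((ε : ℝ) / m) : ℝ) : ℂ) = 1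
      simp
    · change (((t : ℝ) ^ ((ε : ℝ) / m) : ℝ) : ℂ) ^ m = _
      rw [← Complex.ofReal_pow, ← Real.rpow_natCast, ← Real.rpow_mul t.2.1,
        div_mul_cancel₀ _ (by exact_mod_cast hm), Real.rpow_natCast]
      push_cast
      rfl
  set G := starRoot m x₀ a
  set U := c.above (starSet x₀ a)
  have hfG (x : ℂ) : f x = K * (x - x₀) ^ ε * G x ^ m := by
    rw [hf, starRoot_pow hm]
  let px (q : X) (t : unitInterval) : ℂ := x₀ + (t : ℝ) * (c.x q - x₀)
  let py (q : X) (t : unitInterval) : ℂ := τ t * (c.y q / G (c.x q)) * G (px q t)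
  have hpx {q : X} (hq : q ∈ U) (t : unitInterval) : px q t ∈ starSet x₀ a :=
    starSet_line hq.2 t.2.1 t.2.2
  have hratio {q : X} (hq : q ∈ U) : (c.y q / G (c.x q)) ^ m = K * (c.x q - x₀) ^ ε := by
    rw [div_pow, c.y_pow q hq.1, hfG, mul_div_assoc,
      div_self (pow_ne_zero _ (starRoot_ne_zero hq.2)), mul_one]
  have hcurve {q : X} (hq : q ∈ U) (t : unitInterval) : py q t ^ m = f (px q t) := by
    rw [hfG, mul_pow, mul_pow, hτ, hratio hq]
    have : (px q t - x₀) ^ ε = (t : ℂ) ^ ε * (c.x q - x₀) ^ ε := by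
      rw [← mul_pow]
      congr 1
      change x₀ + (t : ℝ) * (c.x q - x₀) - x₀ = _
      ring
    rw [this]
    ring
  have hxc : ContinuousOn (fun p : X × unitInterval => c.x p.1) (U ×ˢ Set.univ) :=
    c.continuousOn_x.comp continuousOn_fst fun p hp => hp.1.1
  have hpxc : ContinuousOn (fun p : X × unitInterval => px p.1 p.2) (U ×ˢ Set.univ) := by
    have : ContinuousOn (fun p : X × unitInterval => (((p.2 : ℝ) : ℂ))) (U ×ˢ Set.univ) := by
      fun_prop
    exact continuousOn_const.add (this.mul (hxc.sub continuousOn_const))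
  have hGc := continuousOn_starRoot m x₀ a
  have hratioc : ContinuousOn (fun q => c.y q / G (c.x q)) U :=
    (c.continuousOn_y.mono fun q hq => hq.1).div
      (hGc.comp (c.continuousOn_x.mono fun q hq => hq.1) fun q hq => hq.2)
      fun q hq => starRoot_ne_zero hq.2
  have hpyc : ContinuousOn (fun p : X × unitInterval => py p.1 p.2) (U ×ˢ Set.univ) := by
    refine ContinuousOn.mul (ContinuousOn.mul ?_ ?_) ?_
    · exact (τ.continuous.comp continuous_snd).continuousOn
    · exact hratioc.comp continuousOn_fst fun p hp => hp.1
    · exact hGc.comp hpxc fun p hp => hpx hp.1 _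
  have hHc : ContinuousOn (fun p : X × unitInterval => c.pt (px p.1 p.2) (py p.1 p.2))
      (U ×ˢ Set.univ) :=
    c.continuousOn_pt.comp (hpxc.prodMk hpyc) fun p hp => hcurve hp.1 p.2
  have hHc1 {q : X} (hq : q ∈ U) : Continuous fun t => c.pt (px q t) (py q t) :=
    hHc.comp_continuous (f := fun t : unitInterval => (q, t)) (by fun_prop)
      fun t => ⟨hq, Set.mem_univ _⟩
  classical
  let H (q : X) : C(unitInterval, X) :=
    if hq : q ∈ U then ⟨_, hHc1 hq⟩ else ContinuousMap.const _ q
  have hH {q : X} (hq : q ∈ U) (t : unitInterval) : H q t = c.pt (px q t) (py q t) := by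
    simp only [H, dif_pos hq]
    rfl
  refine ⟨fun q => ψ (H q), hψ.isPotential_of_contraction H ?_ ?_ ?_, ?_⟩
  · exact hHc.congr fun p hp => hH hp.1 p.2
  · intro q hq
    have h1 : px q 1 = c.x q := by simp [px]
    have h2 : py q 1 = c.y q := by
      simp only [py, h1, hτ1, one_mul]
      exact div_mul_cancel₀ _ (starRoot_ne_zero hq.2)
    rw [hH hq, h1, h2, c.pt_x_y q hq.1]
  · intro γ hγ t
    have h1 (t) : px (γ t) 0 = x₀ := by simp [px]
    have h2 : τ 0 * (c.y (γ t) / G (c.x (γ t))) = τ 0 * (c.y (γ 0) / G (c.x (γ 0))) := by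
      refine eq_of_pow_eq_of_isPreconnected (α := unitInterval) hm (κ := K * (0 : ℂ) ^ ε)
        (s := Set.univ) isPreconnected_univ
        (w := fun t => τ 0 * (c.y (γ t) / G (c.x (γ t)))) ?_ ?_ (Set.mem_univ _) (Set.mem_univ _)
      · exact continuousOn_const.mul
          (hratioc.comp γ.continuous.continuousOn fun t _ => hγ t)
      · intro t _
        rw [mul_pow, hτ, hratio (hγ t), mul_left_comm, ← mul_pow]
        simp
    rw [hH (hγ t), hH (hγ 0)]
    simp only [py, h1, h2]
  · intro u hu q hq
    obtain ⟨d1, d2, d3⟩ := hcD u hu q hq.1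
    have hq' : D.act u hu q ∈ U := ⟨d1, by rw [d2]; exact hq.2⟩
    have : H (D.act u hu q) = (D.act u hu).comp (H q) := by
      ext t
      rw [ContinuousMap.comp_apply, hH hq', hH hq]
      have hx : px (D.act u hu q) t = px q t := by simp only [px, d2]
      have hy : py (D.act u hu q) t = u * py q t := by
        simp only [py, d2, d3, hx]
        ring
      obtain ⟨e1, e2, e3⟩ := hcD u hu _ (c.pt_mem (hcurve hq t))
      have hcurve' := hcurve hq' t
      refine c.ext_of_coord (c.pt_mem hcurve') e1 ?_ ?_
      · rw [c.x_pt hcurve', e2, c.x_pt (hcurve hq t), hx]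
      · rw [c.y_pt hcurve', e3, c.y_pt (hcurve hq t), hy]
    change ψ (H (D.act u hu q)) = _
    rw [this, hψD]

end Charts

section Slits

open Filter Topology

lemma one_sub_mem_slitPlane {u : ℂ} (hu : -u ∈ Complex.slitPlane) :
    1 - u ∈ Complex.slitPlane := by
  rw [Complex.mem_slitPlane_iff] at hu ⊢
  simp only [Complex.neg_re, Complex.neg_im, Complex.sub_re, Complex.sub_im, Complex.one_re,
    Complex.one_im] at hu ⊢
  rcases hu with h | h
  · left; linarith
  · right; simpa using h

lemma one_sub_mem_slitPlane_of_norm_lt {u : ℂ} (hu : ‖u‖ < 1) : 1 - u ∈ Complex.slitPlane := by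
  left
  have := (Complex.abs_re_le_norm u).trans_lt hu
  rw [abs_lt] at this
  simp only [Complex.sub_re, Complex.one_re]
  linarith

lemma notMem_slitPlane {u : ℂ} (hu : u ∉ Complex.slitPlane) : u.re ≤ 0 ∧ u.im = 0 := by
  rw [Complex.mem_slitPlane_iff, not_or, not_lt, not_not] at hu
  exact hu

lemma inv_mem_slitPlane {u : ℂ} (hu : u ∈ Complex.slitPlane) : u⁻¹ ∈ Complex.slitPlane := by
  have h0 := Complex.normSq_pos.2 (Complex.slitPlane_ne_zero hu)
  rw [Complex.mem_slitPlane_iff, Complex.inv_re, Complex.inv_im]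
  rcases hu with h | h
  · exact Or.inl (div_pos h h0)
  · exact Or.inr (div_ne_zero (neg_ne_zero.2 h) h0.ne')

/-- The open sector of slope `δ` around the ray through `a`. -/
def sector (δ : ℝ) (a : ℂ) : Set ℂ := {x | |(x / a).im| < δ * (x / a).re}

lemma isOpen_sector (δ : ℝ) (a : ℂ) : IsOpen (sector δ a) := by
  have h : Continuous fun x : ℂ => x / a := by fun_prop
  exact isOpen_lt (Complex.continuous_im.comp h).abs
    (continuous_const.mul (Complex.continuous_re.comp h))

lemma re_pos_of_mem_sector {δ : ℝ} (hδ : 0 < δ) {a x : ℂ} (hx : x ∈ sector δ a) :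
    0 < (x / a).re :=
  pos_of_mul_pos_right ((abs_nonneg _).trans_lt hx) hδ.le

lemma ne_zero_of_mem_sector {δ : ℝ} {a x : ℂ} (hx : x ∈ sector δ a) : x ≠ 0 := by
  rintro rfl
  simp [sector] at hx

lemma convex_sector (δ : ℝ) (a : ℂ) : Convex ℝ (sector δ a) := by
  intro x hx y hy s t hs ht hst
  simp only [sector, Set.mem_ofPred_eq] at hx hy ⊢
  have hre : ((s • x + t • y) / a).re = s * (x / a).re + t * (y / a).re := by
    rw [add_div, smul_div_assoc, smul_div_assoc]
    simp
  have him : ((s • x + t • y) / a).im = s * (x / a).im + t * (y / a).im := by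
    rw [add_div, smul_div_assoc, smul_div_assoc]
    simp
  rw [hre, him]
  have h1 : |s * (x / a).im + t * (y / a).im| ≤ s * |(x / a).im| + t * |(y / a).im| := by
    refine (abs_add_le _ _).trans_eq ?_
    rw [abs_mul, abs_mul, abs_of_nonneg hs, abs_of_nonneg ht]
  rcases hs.eq_or_lt with rfl | hs'
  · have : t = 1 := by linarith
    subst this
    simpa using hy
  · have h2 : s * |(x / a).im| < s * (δ * (x / a).re) := mul_lt_mul_of_pos_left hx hs'
    have h3 : t * |(y / a).im| ≤ t * (δ * (y / a).re) := mul_le_mul_of_nonneg_left hy.le ht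
    linarith

lemma smul_mem_sector {δ : ℝ} (hδ : 0 < δ) {a : ℂ} (ha : a ≠ 0) {t : ℝ} (ht : 0 < t) :
    (t : ℂ) * a ∈ sector δ a := by
  simp only [sector, Set.mem_ofPred_eq, mul_div_cancel_right₀ _ ha]
  simp
  positivity

/-- Points with pairwise distinct directions from the origin; `δ` is the slope of sectors around
their rays which contain no other rays. -/
structure Separated {n : ℕ} (z : Fin n → ℂ) (δ : ℝ) : Prop where
  pos : 0 < δ
  ne_zero : ∀ i, z i ≠ 0
  le : ∀ i k, i ≠ k → δ * (z k / z i).re ≤ |(z k / z i).im|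

lemma exists_separated {n : ℕ} {z : Fin n → ℂ} (hz : ∀ i, z i ≠ 0)
    (hdir : ∀ i k, i ≠ k → -(z k / z i) ∈ Complex.slitPlane) : ∃ δ, Separated z δ := by
  have h : ∀ᶠ δ : ℝ in 𝓝[>] 0, ∀ i k, i ≠ k → δ * (z k / z i).re ≤ |(z k / z i).im| := by
    simp only [eventually_all]
    intro i k hik
    rcases hdir i k hik with h | h
    · filter_upwards [self_mem_nhdsWithin] with δ hδ
      rw [Complex.neg_re] at h
      exact (mul_neg_of_pos_of_neg hδ (by linarith)).le.trans (abs_nonneg _)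
    · rw [Complex.neg_im, neg_ne_zero] at h
      have ht : Tendsto (fun δ : ℝ => δ * (z k / z i).re) (𝓝[>] 0) (𝓝 0) := by
        have : Tendsto (fun δ : ℝ => δ * (z k / z i).re) (𝓝 0) (𝓝 (0 * (z k / z i).re)) :=
          tendsto_id.mul_const _
        rw [zero_mul] at this
        exact this.mono_left nhdsWithin_le_nhds
      exact (ht.eventually (gt_mem_nhds (abs_pos.2 h))).mono fun _ => le_of_lt
  obtain ⟨δ, hδ, hδ'⟩ := (h.and self_mem_nhdsWithin).exists
  exact ⟨δ, hδ', hz, hδ⟩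

/-- The directions of the slits of a star around `z i` avoiding the other points and the origin. -/
def starDir {n : ℕ} (z : Fin n → ℂ) (i k : Fin n) : ℂ := if k = i then -z i else z k - z i

namespace Separated

variable {n : ℕ} {z : Fin n → ℂ} {δ : ℝ} (h : Separated z δ)

include h

lemma neg_div_mem {i k : Fin n} (hik : i ≠ k) {x : ℂ} (hx : x ∈ sector δ (z i)) :
    -(x / z k) ∈ Complex.slitPlane := by
  by_contra hn
  obtain ⟨h1, h2⟩ := notMem_slitPlane hn
  simp only [Complex.neg_re, Complex.neg_im, neg_eq_zero] at h1 h2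
  set s := (x / z k).re with hs
  have hxs : x / z k = s := Complex.ext rfl (by simpa using h2)
  have hw : x / z i = s * (z k / z i) := by
    rw [← hxs]
    have := h.ne_zero k
    field_simp
  have hx' : |(x / z i).im| < δ * (x / z i).re := hx
  rw [hw, Complex.re_ofReal_mul, Complex.im_ofReal_mul, abs_mul, abs_of_nonneg (by linarith)] at hx'
  have := mul_le_mul_of_nonneg_left (h.le i k hik) (show 0 ≤ s by linarith)
  nlinarith

lemma sub_ne_zero {i k : Fin n} (hik : i ≠ k) : z k - z i ≠ 0 := by
  intro hz
  have := h.neg_div_mem hik (smul_mem_sector h.pos (h.ne_zero i) one_pos)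
  rw [← sub_eq_zero.1 hz] at this
  simp only [Complex.ofReal_one, one_mul, div_self (h.ne_zero k), Complex.mem_slitPlane_iff,
    Complex.neg_re, Complex.neg_im, Complex.one_re, Complex.one_im] at this
  norm_num at this

lemma sector_subset (i : Fin n) : sector δ (z i) ⊆ starSet (z i) (starDir z i) := by
  intro x hx k
  have hzi := h.ne_zero i
  by_cases hki : k = i
  · subst hki
    have : 1 - (x - z k) / starDir z k k = x / z k := by
      simp only [starDir, if_true]
      field_simp
      ring
    rw [this]
    exact Or.inl (re_pos_of_mem_sector h.pos hx)
  · by_contra hn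
    obtain ⟨h1, h2⟩ := notMem_slitPlane hn
    have hne := h.sub_ne_zero (Ne.symm hki)
    simp only [starDir, if_neg hki, Complex.sub_re, Complex.sub_im, Complex.one_re,
      Complex.one_im] at h1 h2
    set t := ((x - z i) / (z k - z i)).re with ht
    have hxt : (x - z i) / (z k - z i) = t := Complex.ext rfl (by simpa using h2)
    have hw : x / z i = 1 + t * (z k / z i - 1) := by
      rw [← hxt]
      field_simp
      ring
    have hx' : |(x / z i).im| < δ * (x / z i).re := hx
    rw [hw] at hx'
    simp only [Complex.add_im, Complex.one_im, Complex.im_ofReal_mul, Complex.sub_im, sub_zero,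
      Complex.add_re, Complex.one_re, Complex.re_ofReal_mul, Complex.sub_re, zero_add] at hx'
    rw [abs_mul, abs_of_nonneg (by linarith)] at hx'
    have := mul_le_mul_of_nonneg_left (h.le i k (Ne.symm hki)) (show 0 ≤ t by linarith)
    nlinarith [h.pos]

lemma mem_starSet_zero {i : Fin n} {x : ℂ} (hx : x ∈ sector δ (z i))
    (hxi : 1 - x / z i ∈ Complex.slitPlane) : x ∈ starSet 0 z := by
  intro k
  rw [sub_zero]
  by_cases hki : k = i
  · rwa [hki]
  · exact one_sub_mem_slitPlane (h.neg_div_mem (Ne.symm hki) hx)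

lemma inv_mem_starSet {i : Fin n} {x : ℂ} (hx : x ∈ sector δ (z i))
    (hxi : 1 - z i / x ∈ Complex.slitPlane) : x⁻¹ ∈ starSet 0 fun k => (z k)⁻¹ := by
  intro k
  rw [sub_zero, div_inv_eq_mul, mul_comm, ← div_eq_mul_inv]
  by_cases hki : k = i
  · rwa [hki]
  · refine one_sub_mem_slitPlane ?_
    rw [← inv_div, ← inv_neg]
    exact inv_mem_slitPlane (h.neg_div_mem (Ne.symm hki) hx)

end Separated

end Slits

section CyclicCovers

open Filter Topology

/-- The cyclic cover `y ^ m = C x ∏ (x - z i)` of the projective line, unramified over infinity,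
described by two affine charts. -/
structure CyclicCover (X : Type) [TopologicalSpace X] (m : ℕ) {n : ℕ} (z : Fin n → ℂ) where
  /-- The deck transformations. -/
  D : DeckAction X m
  /-- The leading coefficient. -/
  C : ℂ
  /-- The weight of the second coordinate. -/
  e : ℕ
  /-- The chart around the origin. -/
  c₁ : PlaneChart X m fun x => C * x * ∏ i, (x - z i)
  /-- The chart around infinity. -/
  c₂ : PlaneChart X m fun v => C * ∏ i, (1 - z i * v)
  C_ne_zero : C ≠ 0
  m_ne_zero : m ≠ 0
  e_mul : e * m = n + 1
  compat₁ : c₁.Compatible D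
  compat₂ : c₂.Compatible D
  mem_dom₂ : ∀ q, q ∉ c₁.dom → q ∈ c₂.dom ∧ c₂.x q = 0
  notMem_dom₁ : ∀ q ∈ c₂.dom, c₂.x q = 0 → q ∉ c₁.dom
  mem_dom₁ : ∀ q ∈ c₂.dom, c₂.x q ≠ 0 → q ∈ c₁.dom ∧ c₁.x q = (c₂.x q)⁻¹
  trans : ∀ q ∈ c₁.dom, c₁.x q ≠ 0 →
    q ∈ c₂.dom ∧ c₂.x q = (c₁.x q)⁻¹ ∧ c₂.y q = c₁.y q / c₁.x q ^ e

lemma PlaneChart.exists_act {X : Type} [TopologicalSpace X] {m : ℕ} {f : ℂ → ℂ}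
    {c : PlaneChart X m f} {D : DeckAction X m} (hcD : c.Compatible D) (hm : m ≠ 0) {q q' : X}
    (hq : q ∈ c.dom) (hq' : q' ∈ c.dom) (hx : c.x q = c.x q') :
    ∃ (u : ℂ) (hu : u ^ m = 1), q' = D.act u hu q := by
  have hy : c.y q ^ m = c.y q' ^ m := by rw [c.y_pow q hq, c.y_pow q' hq', hx]
  by_cases h0 : c.y q = 0
  · refine ⟨1, one_pow m, ?_⟩
    have h0' : c.y q' = 0 := by
      rw [h0, zero_pow hm] at hy
      exact pow_eq_zero_iff hm |>.1 hy.symm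
    obtain ⟨d1, d2, d3⟩ := hcD 1 (one_pow m) q hq
    exact c.ext_of_coord hq' d1 (by rw [d2, hx]) (by rw [d3, h0, h0', mul_zero])
  · have hu : (c.y q' / c.y q) ^ m = 1 := by
      rw [div_pow, ← hy, div_self (pow_ne_zero _ h0)]
    refine ⟨_, hu, ?_⟩
    obtain ⟨d1, d2, d3⟩ := hcD _ hu q hq
    exact c.ext_of_coord hq' d1 (by rw [d2, hx]) (by rw [d3, div_mul_cancel₀ _ h0])

lemma prod_eq_star_zero {n : ℕ} {z : Fin n → ℂ} (hz : ∀ i, z i ≠ 0) (C x : ℂ) :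
    C * x * ∏ i, (x - z i) = (C * ∏ i, (-z i)) * (x - 0) ^ 1 * ∏ k, (1 - (x - 0) / z k) := by
  have : ∏ i, (x - z i) = (∏ i, (-z i)) * ∏ k, (1 - (x - 0) / z k) := by
    rw [← Finset.prod_mul_distrib]
    refine Finset.prod_congr rfl fun i _ => ?_
    have := hz i
    field_simp
    ring
  rw [this]
  ring

lemma prod_eq_star {n : ℕ} {z : Fin n → ℂ} (i : Fin n) (h : ∀ k, starDir z i k ≠ 0) (C x : ℂ) :
    C * x * ∏ i, (x - z i) = (C * ∏ k, (-starDir z i k)) * (x - z i) ^ 1 *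
      ∏ k, (1 - (x - z i) / starDir z i k) := by
  have h1 : (∏ k, (-starDir z i k)) * ∏ k, (1 - (x - z i) / starDir z i k) =
      ∏ k, (x - z i - starDir z i k) := by
    rw [← Finset.prod_mul_distrib]
    refine Finset.prod_congr rfl fun k _ => ?_
    have := h k
    field_simp
    ring
  have h2 : (x - z i) * ∏ k, (x - z i - starDir z i k) = x * ∏ k, (x - z k) := by
    rw [← Finset.mul_prod_erase Finset.univ _ (Finset.mem_univ i),
      ← Finset.mul_prod_erase Finset.univ (fun k => x - z k) (Finset.mem_univ i)]
    have h3 : ∏ k ∈ Finset.univ.erase i, (x - z i - starDir z i k) =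
        ∏ k ∈ Finset.univ.erase i, (x - z k) := by
      refine Finset.prod_congr rfl fun k hk => ?_
      rw [starDir, if_neg (Finset.ne_of_mem_erase hk)]
      ring
    rw [h3, starDir, if_pos rfl]
    ring
  linear_combination C * (x - z i) * (-h1) - C * h2

lemma prod_eq_star_infty {n : ℕ} (z : Fin n → ℂ) (C v : ℂ) :
    C * ∏ i, (1 - z i * v) = C * (v - 0) ^ 0 * ∏ k, (1 - (v - 0) / (z k)⁻¹) := by
  simp only [sub_zero, div_inv_eq_mul, pow_zero, mul_one, mul_comm v]

lemma Separated.starDir_ne_zero {n : ℕ} {z : Fin n → ℂ} {δ : ℝ} (h : Separated z δ) (i k : Fin n) :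
    starDir z i k ≠ 0 := by
  unfold starDir
  split_ifs with hki
  · exact neg_ne_zero.2 (h.ne_zero i)
  · exact h.sub_ne_zero (Ne.symm hki)

end CyclicCovers

section Lasso

lemma lasso_first (z : ℂ) (r : ℝ) (t : unitInterval) (ht : (t : ℝ) ≤ 1 / 4) :
    lasso z r t = (4 * (t : ℝ) : ℝ) * ((1 - r) * z) := by
  unfold lasso
  rw [Path.trans_apply, dif_pos (by linarith), Path.trans_apply, dif_pos (by dsimp only; linarith)]
  simp only [Path.segment_apply, AffineMap.lineMap_apply, vsub_eq_sub, sub_zero, vadd_eq_add,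
    add_zero, Complex.real_smul]
  push_cast
  ring

lemma lasso_second (z : ℂ) (r : ℝ) (t : unitInterval) (ht : 1 / 4 ≤ (t : ℝ))
    (ht' : (t : ℝ) ≤ 1 / 2) :
    lasso z r t =
      (1 - r * Complex.exp (2 * Real.pi * Complex.I * (4 * (t : ℝ) - 1 : ℝ))) * z := by
  unfold lasso
  rw [Path.trans_apply, dif_pos ht', Path.trans_apply]
  split_ifs with h
  · have h4 : (t : ℝ) = 1 / 4 := le_antisymm (by dsimp only at h; linarith) ht
    simp [Path.segment, AffineMap.lineMap_apply, h4]
    ring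
  · simp only [circleLoop, Path.coe_mk_mk]
    congr 6
    ring

lemma lasso_third (z : ℂ) (r : ℝ) (t : unitInterval) (ht : 1 / 2 ≤ (t : ℝ)) :
    lasso z r t = (2 - 2 * (t : ℝ) : ℝ) * ((1 - r) * z) := by
  unfold lasso
  rw [Path.trans_apply]
  split_ifs with h
  · have h2 : (t : ℝ) = 1 / 2 := le_antisymm h ht
    rw [Path.trans_apply, dif_neg (by dsimp only; rw [h2]; norm_num)]
    simp [circleLoop, h2]
    norm_num
  · simp [Path.segment, AffineMap.lineMap_apply, unitInterval.symm]
    left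
    ring

end Lasso
section Span

open Filter Topology

lemma rootOfUnity_pow {m : ℕ} (hm : m ≠ 0) : Complex.exp (2 * Real.pi * Complex.I / m) ^ m = 1 :=
  (Complex.isPrimitiveRoot_exp m hm).pow_eq_one

lemma circle_mem_starSet {n : ℕ} {z : Fin n → ℂ} {i : Fin n} (hzi : z i ≠ 0) {r : ℝ}
    (hr1 : r < 1) (hrz : ∀ k, k ≠ i → r * ‖z i‖ < ‖z k - z i‖) {w : ℂ} (hw : ‖w‖ ≤ r) :
    (1 - w) * z i ∈ starSet (z i) (starDir z i) := by
  intro k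
  have h0 := norm_pos_iff.2 hzi
  refine one_sub_mem_slitPlane_of_norm_lt ?_
  have h1 : ‖(1 - w) * z i - z i‖ ≤ r * ‖z i‖ := by
    rw [show (1 - w) * z i - z i = -(w * z i) by ring, norm_neg, norm_mul]
    gcongr
  have h2 : r * ‖z i‖ < ‖starDir z i k‖ := by
    unfold starDir
    split_ifs with hki
    · rw [norm_neg]
      nlinarith
    · exact hrz k hki
  rw [norm_div, div_lt_one (((norm_nonneg _).trans h1).trans_lt h2)]
  exact h1.trans_lt h2

variable {X : Type} [TopologicalSpace X] {m n : ℕ} {z : Fin n → ℂ} (S : CyclicCover X m z) {δ : ℝ}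

/-- The value of an equivariant cocycle on a lifted lasso. -/
lemma CyclicCover.lasso_value (hz : Separated z δ) {b : ℕ} {ψ : C(unitInterval, X) → ℂ}
    (hψ : IsCocycle ψ) {i : Fin n} {F F' : X → ℂ}
    (hF : IsPotential ψ F (S.c₁.above (starSet 0 z)))
    (hFw : S.D.HasWeight b F (S.c₁.above (starSet 0 z)))
    (hF' : IsPotential ψ F' (S.c₁.above (starSet (z i) (starDir z i))))
    (hFw' : S.D.HasWeight b F' (S.c₁.above (starSet (z i) (starDir z i))))
    {r : ℝ} (hr : 0 < r) (hr1 : r < 1) (hrz : ∀ k, k ≠ i → r * ‖z i‖ < ‖z k - z i‖)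
    {q₀ : X} (η : Path q₀ q₀)
    (hη : ∀ t, η t ∈ S.c₁.dom ∧ S.c₁.x (η t) = lasso (z i) r t) :
    ∃ q ∈ S.c₁.dom, S.c₁.x q = (1 - r) * z i ∧
      ψ η.toContinuousMap =
        (1 - Complex.exp (2 * Real.pi * Complex.I / m) ^ b) * (F q - F' q) := by
  have hm := S.m_ne_zero
  have hzi := hz.ne_zero i
  set ω := Complex.exp (2 * Real.pi * Complex.I / m) with hω
  set g := extendReal η.toContinuousMap with hg
  have hgη (t : unitInterval) : g t = η t := extendReal_apply _ t
  have hp : (1 - r) * z i ∈ starSet 0 z := by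
    refine hz.mem_starSet_zero (i := i) ?_ ?_
    · exact_mod_cast smul_mem_sector hz.pos hzi (sub_pos.2 hr1)
    · rw [mul_div_cancel_right₀ _ hzi]
      left
      simpa using hr
  have h1 (s : unitInterval) : subpath g 0 (1 / 4) s ∈ S.c₁.above (starSet 0 z) := by
    have hs : (s : ℝ) / 4 ∈ unitInterval := ⟨by linarith [s.2.1], by linarith [s.2.2]⟩
    have e : subpath g 0 (1 / 4) s = η ⟨s / 4, hs⟩ := by
      rw [subpath_apply, ← hgη]
      congr 1
      ring
    rw [e]
    refine ⟨(hη _).1, ?_⟩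
    rw [(hη _).2, lasso_first _ _ _ (by dsimp only; linarith [s.2.2])]
    have := starSet_line hp s.2.1 s.2.2
    convert this using 1
    push_cast
    ring
  have h3 (s : unitInterval) : subpath g (1 / 2) 1 s ∈ S.c₁.above (starSet 0 z) := by
    have hs : (1 + s : ℝ) / 2 ∈ unitInterval := ⟨by linarith [s.2.1], by linarith [s.2.2]⟩
    have e : subpath g (1 / 2) 1 s = η ⟨(1 + s) / 2, hs⟩ := by
      rw [subpath_apply, ← hgη]
      congr 1
      ring
    rw [e]
    refine ⟨(hη _).1, ?_⟩
    rw [(hη _).2, lasso_third _ _ _ (by dsimp only; linarith [s.2.1])]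
    have := starSet_line hp (sub_nonneg.2 s.2.2) (sub_le_self 1 s.2.1)
    convert this using 1
    push_cast
    ring
  have h2 (s : unitInterval) : subpath g (1 / 4) (1 / 2) s ∈ S.c₁.dom ∧
      S.c₁.x (subpath g (1 / 4) (1 / 2) s) =
        (1 - r * Complex.exp (2 * Real.pi * Complex.I * (s : ℝ))) * z i := by
    have hs : (1 + s : ℝ) / 4 ∈ unitInterval := ⟨by linarith [s.2.1], by linarith [s.2.2]⟩
    have e : subpath g (1 / 4) (1 / 2) s = η ⟨(1 + s) / 4, hs⟩ := by
      rw [subpath_apply, ← hgη]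
      congr 1
      ring
    rw [e]
    refine ⟨(hη _).1, ?_⟩
    rw [(hη _).2, lasso_second _ _ _ (by dsimp only; linarith [s.2.1])
      (by dsimp only; linarith [s.2.2])]
    congr 6
    ring
  have h2' (s : unitInterval) : subpath g (1 / 4) (1 / 2) s ∈
      S.c₁.above (starSet (z i) (starDir z i)) := by
    refine ⟨(h2 s).1, ?_⟩
    rw [(h2 s).2]
    refine circle_mem_starSet hzi hr1 hrz ?_
    rw [norm_mul, show 2 * Real.pi * Complex.I * (s : ℝ) = ((2 * Real.pi * s : ℝ) : ℂ) * Complex.I by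
      push_cast; ring, Complex.norm_exp_ofReal_mul_I, mul_one, Complex.norm_real, Real.norm_eq_abs,
      abs_of_pos hr]
  set q := g (1 / 4) with hq
  set q' := g (1 / 2) with hq'
  have e0 : subpath g (1 / 4) (1 / 2) 0 = q := by rw [subpath_apply]; simp [hq]
  have e1 : subpath g (1 / 4) (1 / 2) 1 = q' := by rw [subpath_apply]; simp [hq']
  have hq1 := h2 0
  have hq1' := h2 1
  rw [e0] at hq1
  rw [e1] at hq1'
  have hxq : S.c₁.x q = (1 - r) * z i := by simpa using hq1.2
  have hxq' : S.c₁.x q' = (1 - r) * z i := by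
    have := hq1'.2
    rw [Set.Icc.coe_one, Complex.ofReal_one, mul_one, Complex.exp_two_pi_mul_I, mul_one] at this
    exact this
  have hqA : q ∈ S.c₁.above (starSet 0 z) := ⟨hq1.1, by rw [hxq]; exact hp⟩
  have hqi : q ∈ S.c₁.above (starSet (z i) (starDir z i)) := e0 ▸ h2' 0
  have hact : q' = S.D.act ω (rootOfUnity_pow hm) q := by
    set G := starRoot m (z i) (starDir z i)
    set K := S.C * ∏ k, (-starDir z i k)
    let w (s : unitInterval) : ℂ := S.c₁.y (subpath g (1 / 4) (1 / 2) s) /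
      (Complex.exp (2 * Real.pi * Complex.I * (s : ℝ) / m) *
        G (S.c₁.x (subpath g (1 / 4) (1 / 2) s)))
    have hw : w 0 = w 1 := by
      refine eq_of_pow_eq_of_isPreconnected (α := unitInterval) hm (κ := K * (-r * z i))
        (s := Set.univ) isPreconnected_univ ?_ ?_ (Set.mem_univ _) (Set.mem_univ _)
      · refine ContinuousOn.div ?_ (ContinuousOn.mul ?_ ?_) ?_
        · exact S.c₁.continuousOn_y.comp (map_continuous _).continuousOn fun s _ => (h2 s).1
        · fun_prop
        · exact (continuousOn_starRoot m _ _).comp (S.c₁.continuousOn_x.comp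
            (map_continuous _).continuousOn fun s _ => (h2 s).1) fun s _ => (h2' s).2
        · exact fun s _ => mul_ne_zero (Complex.exp_ne_zero _) (starRoot_ne_zero (h2' s).2)
      · intro s _
        have hG := starRoot_ne_zero (m := m) (h2' s).2
        have hpow := S.c₁.y_pow _ (h2 s).1
        rw [prod_eq_star i (hz.starDir_ne_zero i), ← starRoot_pow hm] at hpow
        change (_ / (_ * _)) ^ m = _
        rw [div_pow, mul_pow, hpow, ← Complex.exp_nat_mul, mul_div_cancel₀ _ (by exact_mod_cast hm),
          div_eq_iff (mul_ne_zero (Complex.exp_ne_zero _) (pow_ne_zero _ hG)), (h2 s).2]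
        ring
    have hG := starRoot_ne_zero (m := m) hqi.2
    simp only [w, e0, e1, hxq, hxq', Set.Icc.coe_zero, Set.Icc.coe_one, Complex.ofReal_zero,
      Complex.ofReal_one, mul_zero, zero_div, Complex.exp_zero, one_mul, mul_one] at hw
    rw [hxq] at hG
    rw [div_eq_div_iff hG (mul_ne_zero (Complex.exp_ne_zero _) hG)] at hw
    obtain ⟨d1, d2, d3⟩ := S.compat₁ ω (rootOfUnity_pow hm) q hq1.1
    refine S.c₁.ext_of_coord hq1'.1 d1 ?_ ?_
    · rw [d2, hxq, hxq']
    · rw [d3]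
      refine mul_right_cancel₀ hG ?_
      rw [← hw]
      ring
  refine ⟨q, hq1.1, hxq, ?_⟩
  have i1 := hF _ h1
  have i2 := hF' _ h2'
  have i3 := hF _ h3
  have a1 := hψ.subpath_add g 0 (1 / 4) (1 / 2)
  have a2 := hψ.subpath_add g 0 (1 / 2) 1
  rw [subpath_extendReal] at a2
  have f0 : subpath g 0 (1 / 4) 0 = q₀ := by
    rw [subpath_apply]
    simpa using (extendReal_zero _).trans η.source
  have f1 : subpath g 0 (1 / 4) 1 = q := by rw [subpath_apply]; simp [hq]
  have f2 : subpath g (1 / 2) 1 0 = q' := by rw [subpath_apply]; simp [hq']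
  have f3 : subpath g (1 / 2) 1 1 = q₀ := by
    rw [subpath_apply]
    norm_num
    exact (extendReal_one _).trans η.target
  rw [f0, f1] at i1
  rw [e0, e1, hact, hFw' _ _ q hqi] at i2
  rw [f2, f3, hact, hFw _ _ q hqA] at i3
  rw [← a2, ← a1, i1, i2, i3]
  ring

end Span

section Comparison

open Filter Topology

lemma IsPotential.apply_eq {X : Type} [TopologicalSpace X] {F : X → ℂ} {U : Set X}
    (h : IsPotential 0 F U) {γ : C(unitInterval, X)} (hγ : ∀ t, γ t ∈ U) : F (γ 0) = F (γ 1) := by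
  have := h γ hγ
  rw [Pi.zero_apply] at this
  linear_combination this

lemma DeckAction.HasWeight.mono {X : Type} [TopologicalSpace X] {m : ℕ} {D : DeckAction X m}
    {b : ℕ} {F : X → ℂ} {U V : Set X} (h : D.HasWeight b F U) (hVU : V ⊆ U) :
    D.HasWeight b F V :=
  fun u hu q hq => h u hu q (hVU hq)

lemma DeckAction.HasWeight.sub {X : Type} [TopologicalSpace X] {m : ℕ} {D : DeckAction X m}
    {b : ℕ} {F F' : X → ℂ} {U : Set X} (h : D.HasWeight b F U) (h' : D.HasWeight b F' U) :
    D.HasWeight b (F - F') U := fun u hu q hq => by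
  rw [Pi.sub_apply, h u hu q hq, h' u hu q hq, Pi.sub_apply, mul_sub]

/-- The sector around the ray through `z i`, slit along the part of the ray beyond `z i`. -/
def slitSector {n : ℕ} (δ : ℝ) (z : Fin n → ℂ) (i : Fin n) : Set ℂ :=
  {x | x ∈ sector δ (z i) ∧ 1 - x / z i ∈ Complex.slitPlane}

/-- A branch of the root of `x ∏ (x - z k)`, up to a constant, on `slitSector`. -/
def sectorRoot {n : ℕ} (m : ℕ) (z : Fin n → ℂ) (i : Fin n) (x : ℂ) : ℂ :=
  proot m (x / z i) * starRoot m 0 z x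

section

variable {n : ℕ} {z : Fin n → ℂ} {δ : ℝ} (hz : Separated z δ) {i : Fin n}

include hz

lemma Separated.slitSector_subset : slitSector δ z i ⊆ starSet 0 z :=
  fun _ hx => hz.mem_starSet_zero hx.1 hx.2

lemma Separated.continuousOn_sectorRoot (m : ℕ) :
    ContinuousOn (sectorRoot m z i) (slitSector δ z i) := by
  refine ContinuousOn.mul (fun x hx => ContinuousAt.continuousWithinAt ?_)
    ((continuousOn_starRoot m 0 z).mono hz.slitSector_subset)
  exact (continuousAt_proot (Or.inl (re_pos_of_mem_sector hz.pos hx.1))).comp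
    (f := fun x => x / z i) (by fun_prop)

lemma Separated.sectorRoot_ne_zero (m : ℕ) {x : ℂ} (hx : x ∈ slitSector δ z i) :
    sectorRoot m z i x ≠ 0 :=
  mul_ne_zero (proot_ne_zero (Complex.slitPlane_ne_zero
    (Or.inl (re_pos_of_mem_sector hz.pos hx.1)))) (starRoot_ne_zero (hz.slitSector_subset hx))

lemma Separated.sectorRoot_pow {m : ℕ} (hm : m ≠ 0) (C x : ℂ) :
    C * x * ∏ k, (x - z k) = C * (∏ k, (-z k)) * z i * sectorRoot m z i x ^ m := by
  have := hz.ne_zero i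
  rw [prod_eq_star_zero hz.ne_zero, sectorRoot, mul_pow, proot_pow hm, starRoot_pow hm]
  field_simp
  ring

end

variable {X : Type} [TopologicalSpace X] {m n : ℕ} {z : Fin n → ℂ} (S : CyclicCover X m z) {δ : ℝ}

lemma CyclicCover.eq_on_slitSector (hz : Separated z δ) {b : ℕ} {i : Fin n} {F : X → ℂ}
    (hF : IsPotential 0 F (S.c₁.above (slitSector δ z i)))
    (hFw : S.D.HasWeight b F (S.c₁.above (slitSector δ z i)))
    {r : ℝ} (hr : 0 < r) (hr1 : r < 1) {q : X} (hq : q ∈ S.c₁.dom)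
    (hxq : S.c₁.x q = (1 - r) * z i) (hFq : F q = 0) :
    ∀ p ∈ S.c₁.above (slitSector δ z i), F p = 0 := by
  intro p hp
  have hzi := hz.ne_zero i
  let x : C(unitInterval, ℂ) := ⟨fun t => (1 - (t : ℝ) : ℝ) • S.c₁.x p + (t : ℝ) • S.c₁.x q,
    by fun_prop⟩
  have hqs : S.c₁.x q ∈ sector δ (z i) := by
    rw [hxq]
    exact_mod_cast smul_mem_sector hz.pos hzi (sub_pos.2 hr1)
  have hx (t) : x t ∈ slitSector δ z i := by
    refine ⟨convex_sector δ (z i) hp.2.1 hqs (sub_nonneg.2 t.2.2) t.2.1 (by ring), ?_⟩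
    have h1 : 1 - x t / z i = (1 - (t : ℝ) : ℝ) * (1 - S.c₁.x p / z i) + ((t * r : ℝ) : ℂ) := by
      change 1 - ((1 - (t : ℝ) : ℝ) • S.c₁.x p + (t : ℝ) • S.c₁.x q) / z i = _
      rw [hxq]
      simp only [Complex.real_smul]
      field_simp
      push_cast
      ring
    rw [h1, Complex.mem_slitPlane_iff, Complex.add_re, Complex.add_im, Complex.re_ofReal_mul,
      Complex.im_ofReal_mul, Complex.ofReal_re, Complex.ofReal_im, add_zero]
    rcases t.2.2.eq_or_lt with ht | ht
    · left
      rw [ht]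
      simpa using hr
    · rcases hp.2.2 with h | h
      · left
        have := mul_pos (sub_pos.2 ht) h
        have := mul_nonneg t.2.1 hr.le
        linarith
      · right
        exact mul_ne_zero (sub_pos.2 ht).ne' h
  obtain ⟨γ, hγ0, hγ⟩ := S.c₁.exists_lift (hz.continuousOn_sectorRoot m)
    (fun x hx => hz.sectorRoot_ne_zero m hx)
    (fun x _ => hz.sectorRoot_pow S.m_ne_zero S.C x) x hx hp.1 (by simp [x])
  have h1 := hF.apply_eq (γ := γ) fun t => ⟨(hγ t).1, by rw [(hγ t).2.1]; exact hx t⟩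
  obtain ⟨u, hu, hact⟩ := PlaneChart.exists_act S.compat₁ S.m_ne_zero hq (hγ 1).1
    (by rw [(hγ 1).2.1]; simp [x])
  have hx1 : x 1 = S.c₁.x q := by simp [x]
  rw [← hγ0, h1, hact, hFw u hu q ⟨hq, hx1 ▸ hx 1⟩, hFq, mul_zero]

lemma exp_mem_slitPlane_of_im {w : ℂ} (h1 : -Real.pi < w.im) (h2 : w.im < Real.pi) :
    Complex.exp w ∈ Complex.slitPlane := by
  rw [Complex.mem_slitPlane_iff_arg]
  refine ⟨?_, Complex.exp_ne_zero w⟩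
  rw [← Complex.log_im, Complex.log_exp h1 h2.le]
  exact h2.ne

/-- The trivializing coordinate over the complement of the segments from the origin to the points
`z i`. -/
def CyclicCover.sheet (q : X) : ℂ := S.c₂.y q / starRoot m 0 (fun k => (z k)⁻¹) (S.c₂.x q)

lemma CyclicCover.sheet_pow {q : X} (hq : q ∈ S.c₂.above (starSet 0 fun k => (z k)⁻¹)) :
    S.sheet q ^ m = S.C := by
  rw [sheet, div_pow, S.c₂.y_pow q hq.1, prod_eq_star_infty, ← starRoot_pow S.m_ne_zero, pow_zero,
    mul_one, mul_div_assoc, div_self (pow_ne_zero _ (starRoot_ne_zero hq.2)), mul_one]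

lemma CyclicCover.sheet_ne_zero {q : X} (hq : q ∈ S.c₂.above (starSet 0 fun k => (z k)⁻¹)) :
    S.sheet q ≠ 0 := by
  intro h
  have := S.sheet_pow hq
  rw [h, zero_pow S.m_ne_zero] at this
  exact S.C_ne_zero this.symm

lemma CyclicCover.sheet_act {q : X} (hq : q ∈ S.c₂.dom) {u : ℂ} (hu : u ^ m = 1) :
    S.sheet (S.D.act u hu q) = u * S.sheet q := by
  obtain ⟨-, d2, d3⟩ := S.compat₂ u hu q hq
  rw [sheet, sheet, d2, d3, mul_div_assoc]

lemma CyclicCover.continuousOn_sheet :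
    ContinuousOn S.sheet (S.c₂.above (starSet 0 fun k => (z k)⁻¹)) :=
  (S.c₂.continuousOn_y.mono fun _ hq => hq.1).div
    ((continuousOn_starRoot m _ _).comp (S.c₂.continuousOn_x.mono fun _ hq => hq.1)
      fun _ hq => hq.2) fun _ hq => starRoot_ne_zero hq.2

lemma CyclicCover.eventually_sheet_eq {q : X}
    (hq : q ∈ S.c₂.above (starSet 0 fun k => (z k)⁻¹)) :
    ∀ᶠ p in 𝓝 q, S.sheet p = S.sheet q := by
  have hU : S.c₂.above (starSet 0 fun k => (z k)⁻¹) ∈ 𝓝 q :=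
    (S.c₂.isOpen_above (isOpen_starSet _ _)).mem_nhds hq
  refine eventually_eq_of_pow_eq S.m_ne_zero (S.continuousOn_sheet.continuousAt hU) (κ := S.C) ?_
  filter_upwards [hU] with p hp using S.sheet_pow hp

/-- Lifting paths over the complement of the segments. -/
lemma CyclicCover.exists_lift_sheet (v : C(unitInterval, ℂ))
    (hv : ∀ t, v t ∈ starSet 0 fun k => (z k)⁻¹) {q : X} (hq : q ∈ S.c₂.dom)
    (hqv : S.c₂.x q = v 0) :
    ∃ γ : C(unitInterval, X), γ 0 = q ∧ ∀ t, γ t ∈ S.c₂.dom ∧ S.c₂.x (γ t) = v t ∧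
      S.sheet (γ t) = S.sheet q := by
  obtain ⟨γ, h0, hγ⟩ := S.c₂.exists_lift (continuousOn_starRoot m 0 fun k => (z k)⁻¹)
    (fun x hx => starRoot_ne_zero hx) (κ := S.C)
    (fun x _ => by rw [prod_eq_star_infty, starRoot_pow S.m_ne_zero, pow_zero, mul_one])
    v hv hq hqv
  refine ⟨γ, h0, fun t => ⟨(hγ t).1, (hγ t).2.1, ?_⟩⟩
  rw [sheet, (hγ t).2.1, (hγ t).2.2, mul_div_assoc, div_self (starRoot_ne_zero (hv t)), mul_one,
    sheet, hqv]

/-- On the complement of the segments and of one outer ray, locally constant functions of given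
weight are determined up to a constant. -/
lemma CyclicCover.exists_eq_sheet_pow (hz : Separated z δ) {b : ℕ} (j : Fin n) {F : X → ℂ}
    (hF : IsPotential 0 F (S.c₂.above (starSet 0 fun k => (z k)⁻¹) ∩
      S.c₁.above {x | 1 - x / z j ∈ Complex.slitPlane}))
    (hFw : S.D.HasWeight b F (S.c₂.above (starSet 0 fun k => (z k)⁻¹) ∩
      S.c₁.above {x | 1 - x / z j ∈ Complex.slitPlane})) :
    ∃ κ : ℂ, ∀ q ∈ S.c₂.above (starSet 0 fun k => (z k)⁻¹) ∩
      S.c₁.above {x | 1 - x / z j ∈ Complex.slitPlane}, F q = κ * S.sheet q ^ b := by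
  set U := S.c₂.above (starSet 0 fun k => (z k)⁻¹) ∩
      S.c₁.above {x | 1 - x / z j ∈ Complex.slitPlane} with hU
  have hzj := hz.ne_zero j
  let v (w : ℂ) : ℂ := -Complex.exp w / z j
  have hvc : Continuous v := by fun_prop
  have hv0 (w : ℂ) : v w ≠ 0 := div_ne_zero (neg_ne_zero.2 (Complex.exp_ne_zero w)) hzj
  have hmem {q : X} {w : ℂ} (hq : q ∈ S.c₂.dom) (hqw : S.c₂.x q = v w)
      (hw : v w ∈ starSet 0 fun k => (z k)⁻¹) (h1 : -Real.pi < w.im) (h2 : w.im < Real.pi) :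
      q ∈ U := by
    obtain ⟨d1, d2⟩ := S.mem_dom₁ q hq (by rw [hqw]; exact hv0 w)
    refine ⟨⟨hq, by rw [hqw]; exact hw⟩, d1, ?_⟩
    change 1 - S.c₁.x q / z j ∈ Complex.slitPlane
    rw [d2, hqw]
    refine one_sub_mem_slitPlane ?_
    have : -((v w)⁻¹ / z j) = (Complex.exp w)⁻¹ := by
      have := Complex.exp_ne_zero w
      simp only [v]
      field_simp
    rw [this]
    exact inv_mem_slitPlane (exp_mem_slitPlane_of_im h1 h2)
  have move {q : X} (hq : q ∈ S.c₂.dom) (p : C(unitInterval, ℂ)) (hqp : S.c₂.x q = v (p 0))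
      (h1 : ∀ t, -Real.pi < (p t).im) (h2 : ∀ t, (p t).im < Real.pi)
      (hp : ∀ t, v (p t) ∈ starSet 0 fun k => (z k)⁻¹) :
      ∃ q' ∈ U, S.c₂.x q' = v (p 1) ∧ S.sheet q' = S.sheet q ∧ F q' = F q := by
    obtain ⟨γ, h0, hγ⟩ := S.exists_lift_sheet ⟨fun t => v (p t), by fun_prop⟩ hp hq hqp
    have hγU (t) : γ t ∈ U := hmem (hγ t).1 (hγ t).2.1 (hp t) (h1 t) (h2 t)
    exact ⟨γ 1, hγU 1, (hγ 1).2.1, (hγ 1).2.2, by rw [← hF.apply_eq hγU, h0]⟩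
  obtain ⟨M, hM⟩ : ∃ M : ℝ, ∀ k, Real.exp (-M) * ‖z k‖ < ‖z j‖ := by
    have h : ∀ᶠ M : ℝ in atTop, ∀ k, Real.exp (-M) * ‖z k‖ < ‖z j‖ := by
      rw [eventually_all]
      intro k
      have : Tendsto (fun M : ℝ => Real.exp (-M) * ‖z k‖) atTop (𝓝 (0 * ‖z k‖)) :=
        (Real.tendsto_exp_neg_atTop_nhds_zero).mul_const _
      rw [zero_mul] at this
      exact this.eventually (gt_mem_nhds (norm_pos_iff.2 hzj))
    exact h.exists
  have hsmall {w : ℂ} (hw : w.re ≤ -M) : v w ∈ starSet 0 fun k => (z k)⁻¹ := by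
    intro k
    refine one_sub_mem_slitPlane_of_norm_lt ?_
    rw [sub_zero, div_inv_eq_mul, norm_mul, norm_div, norm_neg, Complex.norm_exp, div_mul_eq_mul_div,
      div_lt_one (norm_pos_iff.2 hzj)]
    refine lt_of_le_of_lt ?_ (hM k)
    gcongr
  have key {q : X} (hq : q ∈ U) :
      ∃ q' ∈ U, S.c₂.x q' = v (-M : ℝ) ∧ S.sheet q' = S.sheet q ∧ F q' = F q := by
    have hv : S.c₂.x q ≠ 0 := fun h => S.notMem_dom₁ q hq.1.1 h hq.2.1
    have hx := (S.mem_dom₁ q hq.1.1 hv).2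
    have hslit : -(S.c₂.x q * z j) ∈ Complex.slitPlane := by
      have h1 := hq.1.2 j
      have h2 : 1 - S.c₁.x q / z j ∈ Complex.slitPlane := hq.2.2
      rw [hx] at h2
      rw [sub_zero, div_inv_eq_mul] at h1
      by_contra hn
      obtain ⟨hre, him⟩ := notMem_slitPlane hn
      rw [Complex.neg_re] at hre
      rw [Complex.neg_im, neg_eq_zero] at him
      set s := (S.c₂.x q * z j).re with hs
      have hsx : S.c₂.x q * z j = s := Complex.ext rfl (by simpa using him)
      have hs0 : s ≠ 0 := by
        intro h0
        rw [h0, Complex.ofReal_zero] at hsx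
        exact mul_ne_zero hv hzj hsx
      have h2' : (S.c₂.x q)⁻¹ / z j = ((s⁻¹ : ℝ) : ℂ) := by
        rw [div_eq_mul_inv, ← mul_inv, hsx, Complex.ofReal_inv]
      rw [hsx] at h1
      rw [h2'] at h2
      have h1' : s < 1 := by
        rcases h1 with h | h
        · simpa using h
        · simp at h
      have h2' : s⁻¹ < 1 := by
        rcases h2 with h | h
        · simpa using h
        · simp at h
      have hs' : 0 < s := lt_of_le_of_ne (by linarith) (Ne.symm hs0)
      rw [inv_lt_one₀ hs'] at h2'
      linarith
    set w := Complex.log (-(S.c₂.x q * z j)) with hw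
    have hvw : S.c₂.x q = v w := by
      simp only [v, hw]
      rw [Complex.exp_log (Complex.slitPlane_ne_zero hslit)]
      field_simp
    have him1 : -Real.pi < w.im := Complex.neg_pi_lt_log_im _
    have him2 : w.im < Real.pi :=
      lt_of_le_of_ne (Complex.log_im_le_pi _) (by
        rw [hw, Complex.log_im]
        exact Complex.slitPlane_arg_ne_pi hslit)
    set R := max 0 (w.re + M) with hR
    obtain ⟨q₁, hq₁, hx₁, hs₁, hF₁⟩ := move hq.1.1
      ⟨fun t => w - ((t * R : ℝ) : ℂ), by fun_prop⟩ (by simpa using hvw)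
      (fun t => by simpa using him1) (fun t => by simpa using him2) (fun t => by
        have h0 : (0 : ℝ) ≤ t * R := mul_nonneg t.2.1 (le_max_left _ _)
        have := starSet_line hq.1.2 (Real.exp_pos (-(t * R))).le
          (Real.exp_le_one_iff.2 (neg_nonpos.2 h0))
        convert this using 1
        rw [hvw]
        simp only [v, ContinuousMap.coe_mk, sub_zero, zero_add]
        rw [sub_eq_add_neg, Complex.exp_add]
        push_cast
        ring)
    obtain ⟨q₂, hq₂, hx₂, hs₂, hF₂⟩ := move hq₁.1.1
      ⟨fun t => ((1 - t : ℝ) : ℂ) * (w - (R : ℝ)) + (t : ℝ) * ((-M : ℝ) : ℂ), by fun_prop⟩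
      (by rw [hx₁]; simp)
      (fun t => by
        have := t.2.1
        have := t.2.2
        simp only [ContinuousMap.coe_mk, Complex.add_im, Complex.im_ofReal_mul, Complex.sub_im,
          Complex.ofReal_im, sub_zero, mul_zero, add_zero]
        nlinarith [Real.pi_pos])
      (fun t => by
        have := t.2.1
        have := t.2.2
        simp only [ContinuousMap.coe_mk, Complex.add_im, Complex.im_ofReal_mul, Complex.sub_im,
          Complex.ofReal_im, sub_zero, mul_zero, add_zero]
        nlinarith [Real.pi_pos])
      (fun t => by
        apply hsmall
        have := le_max_right 0 (w.re + M)
        have := t.2.2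
        simp only [ContinuousMap.coe_mk, Complex.add_re, Complex.re_ofReal_mul, Complex.sub_re,
          Complex.ofReal_re]
        nlinarith)
    exact ⟨q₂, hq₂, by rw [hx₂]; simp, hs₂.trans hs₁, hF₂.trans hF₁⟩
  by_cases hne : U.Nonempty
  · obtain ⟨p, hp⟩ := hne
    obtain ⟨p', hp', hxp, -, -⟩ := key hp
    refine ⟨F p' / S.sheet p' ^ b, fun q hq => ?_⟩
    obtain ⟨q', hq', hxq, hsq, hFq⟩ := key hq
    obtain ⟨u, hu, rfl⟩ := PlaneChart.exists_act S.compat₂ S.m_ne_zero hp'.1.1 hq'.1.1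
      (hxp.trans hxq.symm)
    have h0 := S.sheet_ne_zero hp'.1
    rw [← hFq, ← hsq, hFw u hu p' hp', S.sheet_act hp'.1.1 hu]
    field_simp
    rw [mul_pow]
    ring
  · exact ⟨0, fun q hq => absurd ⟨q, hq⟩ hne⟩

/-- Locally constant functions of nontrivial weight on a punctured neighbourhood of a branch point
vanish. -/
lemma CyclicCover.eq_zero_of_punctured (hz : Separated z δ) {b : ℕ}
    (hb : Complex.exp (2 * Real.pi * Complex.I / m) ^ b ≠ 1) (j : Fin n) {ρ : ℝ} (hρ : ρ ≤ 1)
    (hρz : ∀ k, k ≠ j → ρ * ‖z j‖ < ‖z k - z j‖) {F : X → ℂ}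
    (hF : IsPotential 0 F (S.c₁.above {x | x ≠ z j ∧ ‖x / z j - 1‖ < ρ}))
    (hFw : S.D.HasWeight b F (S.c₁.above {x | x ≠ z j ∧ ‖x / z j - 1‖ < ρ})) :
    ∀ q ∈ S.c₁.above {x | x ≠ z j ∧ ‖x / z j - 1‖ < ρ}, F q = 0 := by
  intro q hq
  have hm := S.m_ne_zero
  have hzj := hz.ne_zero j
  set τ := S.c₁.x q / z j - 1 with hτ
  have hxq : S.c₁.x q = (1 + τ) * z j := by
    rw [hτ]
    field_simp
    ring
  have hτρ : ‖τ‖ < ρ := hq.2.2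
  have hτ0 : τ ≠ 0 := by
    intro h0
    rw [h0, add_zero, one_mul] at hxq
    exact hq.2.1 hxq
  obtain ⟨x, hx⟩ : ∃ x : C(unitInterval, ℂ), ∀ t,
      x t = (1 + τ * Complex.exp (2 * Real.pi * Complex.I * (t : ℝ))) * z j :=
    ⟨⟨fun t => (1 + τ * Complex.exp (2 * Real.pi * Complex.I * (t : ℝ))) * z j, by fun_prop⟩,
      fun _ => rfl⟩
  have hexp (t : unitInterval) : ‖Complex.exp (2 * Real.pi * Complex.I * (t : ℝ))‖ = 1 := by
    rw [show 2 * Real.pi * Complex.I * (t : ℝ) = ((2 * Real.pi * t : ℝ) : ℂ) * Complex.I by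
      push_cast; ring, Complex.norm_exp_ofReal_mul_I]
  have hxs (t) : x t ∈ starSet (z j) (starDir z j) := by
    have := circle_mem_starSet hzj (hτρ.trans_le hρ)
      (fun k hk => (mul_le_mul_of_nonneg_right hτρ.le (norm_nonneg (z j))).trans_lt (hρz k hk))
      (w := -(τ * Complex.exp (2 * Real.pi * Complex.I * (t : ℝ))))
      (by rw [norm_neg, norm_mul, hexp, mul_one])
    rwa [sub_neg_eq_add, ← hx] at this
  have hxV (t) : x t ∈ {x | x ≠ z j ∧ ‖x / z j - 1‖ < ρ} := by
    have h1 : x t / z j - 1 = τ * Complex.exp (2 * Real.pi * Complex.I * (t : ℝ)) := by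
      rw [hx, mul_div_cancel_right₀ _ hzj, add_sub_cancel_left]
    constructor
    · intro h
      rw [h, div_self hzj, sub_self] at h1
      exact mul_ne_zero hτ0 (Complex.exp_ne_zero _) h1.symm
    · rw [h1, norm_mul, hexp, mul_one]
      exact hτρ
  set G := starRoot m (z j) (starDir z j)
  have hx0 : x 0 = S.c₁.x q := by
    rw [hxq, hx]
    simp
  have hx1 : x 1 = S.c₁.x q := by
    rw [hxq, hx, Set.Icc.coe_one, Complex.ofReal_one, mul_one, Complex.exp_two_pi_mul_I, mul_one]
  have hG (t) : G (x t) ≠ 0 := starRoot_ne_zero (hxs t)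
  have hGc : Continuous fun t => G (x t) :=
    (continuousOn_starRoot m _ _).comp_continuous x.continuous hxs
  obtain ⟨y, hyt⟩ : ∃ y : C(unitInterval, ℂ), ∀ t, y t =
      S.c₁.y q / G (x 0) * Complex.exp (2 * Real.pi * Complex.I * (t : ℝ) / m) * G (x t) :=
    ⟨⟨fun t => S.c₁.y q / G (x 0) * Complex.exp (2 * Real.pi * Complex.I * (t : ℝ) / m) * G (x t),
      Continuous.mul (by fun_prop) hGc⟩, fun _ => rfl⟩
  have hy (t) : y t ^ m = S.C * x t * ∏ i, (x t - z i) := by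
    have h0 := S.c₁.y_pow q hq.1
    rw [← hx0, prod_eq_star j (hz.starDir_ne_zero j), ← starRoot_pow hm] at h0
    rw [prod_eq_star j (hz.starDir_ne_zero j), ← starRoot_pow hm]
    rw [hyt, mul_pow, mul_pow, div_pow, h0, ← Complex.exp_nat_mul,
      mul_div_cancel₀ _ (by exact_mod_cast hm), mul_div_assoc, div_self (pow_ne_zero _ (hG 0)),
      hx0, hxq, hx]
    ring
  have hγ := hF.apply_eq (γ := S.c₁.curve x y hy) fun t =>
    ⟨S.c₁.pt_mem (hy t), by
      change S.c₁.x (S.c₁.pt (x t) (y t)) ∈ _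
      rw [S.c₁.x_pt (hy t)]
      exact hxV t⟩
  have hy0 : y 0 = S.c₁.y q := by
    rw [hyt, Set.Icc.coe_zero, Complex.ofReal_zero, mul_zero, zero_div, Complex.exp_zero,
      mul_one, div_mul_cancel₀ _ (hG 0)]
  have hy1 : y 1 = Complex.exp (2 * Real.pi * Complex.I / m) * S.c₁.y q := by
    rw [hyt, hx1, ← hx0, Set.Icc.coe_one, Complex.ofReal_one, mul_one, mul_right_comm,
      div_mul_cancel₀ _ (hG 0), mul_comm]
  have e0 : S.c₁.curve x y hy 0 = q := by
    change S.c₁.pt (x 0) (y 0) = q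
    rw [hx0, hy0, S.c₁.pt_x_y q hq.1]
  have e1 : S.c₁.curve x y hy 1 = S.D.act _ (rootOfUnity_pow hm) q := by
    obtain ⟨d1, d2, d3⟩ := S.compat₁ _ (rootOfUnity_pow hm) q hq.1
    refine S.c₁.ext_of_coord (S.c₁.pt_mem (hy 1)) d1 ?_ ?_
    · rw [d2]
      exact (S.c₁.x_pt (hy 1)).trans hx1
    · rw [d3]
      exact (S.c₁.y_pt (hy 1)).trans hy1
  rw [e0, e1, hFw _ _ q hq] at hγ
  have : (1 - Complex.exp (2 * Real.pi * Complex.I / m) ^ b) * F q = 0 := by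
    linear_combination hγ
  exact (mul_eq_zero.1 this).resolve_left (sub_ne_zero.2 (Ne.symm hb))

end Comparison

section Primitives

open Filter Topology

lemma IsCocycle.exists_potential_iUnion {X : Type} [TopologicalSpace X]
    {ψ : C(unitInterval, X) → ℂ} (hψ : IsCocycle ψ) {ι : Type*} {U : ι → Set X} {F : ι → X → ℂ}
    (hopen : ∀ a, IsOpen (U a)) (hF : ∀ a, IsPotential ψ (F a) (U a))
    (hFF : ∀ a b, ∀ q ∈ U a, q ∈ U b → F a q = F b q) :
    ∃ G : X → ℂ, IsPotential ψ G (⋃ a, U a) ∧ ∀ a, ∀ q ∈ U a, G q = F a q := by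
  classical
  let G (q : X) : ℂ := if h : ∃ a, q ∈ U a then F h.choose q else 0
  have hG (a) (q) (hq : q ∈ U a) : G q = F a q := by
    have h : ∃ a, q ∈ U a := ⟨a, hq⟩
    simp only [G, dif_pos h]
    exact hFF _ _ q h.choose_spec hq
  refine ⟨G, hψ.isPotential_of_local fun q hq => ?_, hG⟩
  obtain ⟨a, ha⟩ := Set.mem_iUnion.1 hq
  exact ⟨U a, (hopen a).mem_nhds ha, (hF a).congr fun p hp => (hG a p hp).symm⟩

lemma PlaneChart.act_mem_above {X : Type} [TopologicalSpace X] {m : ℕ} {f : ℂ → ℂ}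
    {c : PlaneChart X m f} {D : DeckAction X m} (h : c.Compatible D) {V : Set ℂ} {u : ℂ}
    (hu : u ^ m = 1) {q : X} (hq : q ∈ c.above V) : D.act u hu q ∈ c.above V := by
  obtain ⟨d1, d2, -⟩ := h u hu q hq.1
  exact ⟨d1, by rw [d2]; exact hq.2⟩

variable {X : Type} [TopologicalSpace X] {m n : ℕ} {z : Fin n → ℂ} (S : CyclicCover X m z) {δ : ℝ}

/-- The domains for the construction of a primitive away from the point above `z j` and from
infinity. -/
def CyclicCover.innerDomain (δ : ℝ) (j : Fin n) (a : Option {i : Fin n // i ≠ j}) : Set X :=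
  a.elim (S.c₁.above (starSet 0 z)) fun i => S.c₁.above (sector δ (z i))

lemma CyclicCover.isOpen_innerDomain (δ : ℝ) (j : Fin n) (a) : IsOpen (S.innerDomain δ j a) := by
  cases a
  · exact S.c₁.isOpen_above (isOpen_starSet _ _)
  · exact S.c₁.isOpen_above (isOpen_sector _ _)

lemma CyclicCover.act_mem_innerDomain {j : Fin n} {u : ℂ} (hu : u ^ m = 1) {q : X} {a}
    (hq : q ∈ S.innerDomain δ j a) : S.D.act u hu q ∈ S.innerDomain δ j a := by
  cases a
  · exact PlaneChart.act_mem_above S.compat₁ hu hq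
  · exact PlaneChart.act_mem_above S.compat₁ hu hq

lemma CyclicCover.innerDomain_subset (hz : Separated z δ) (j : Fin n) (a) :
    S.innerDomain δ j a ⊆ S.c₁.above {x | 1 - x / z j ∈ Complex.slitPlane} := by
  intro q hq
  cases a with
  | none => exact ⟨hq.1, by simpa using hq.2 j⟩
  | some i => exact ⟨hq.1, one_sub_mem_slitPlane (hz.neg_div_mem i.2 hq.2)⟩

lemma Separated.exists_of_notMem_starSet (hz : Separated z δ) {x : ℂ} (hx : x ∉ starSet 0 z) :
    ∃ k, ∃ s : ℝ, 1 ≤ s ∧ x = s * z k := by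
  simp only [starSet, Set.mem_ofPred_eq, not_forall, sub_zero] at hx
  obtain ⟨k, hk⟩ := hx
  obtain ⟨h1, h2⟩ := notMem_slitPlane hk
  refine ⟨k, (x / z k).re, ?_, ?_⟩
  · simpa using h1
  · have : x / z k = (x / z k).re := Complex.ext rfl (by simpa using h2)
    rw [← this, div_mul_cancel₀ _ (hz.ne_zero k)]

lemma CyclicCover.mem_innerDomain (hz : Separated z δ) {j : Fin n} {q : X}
    (hq : q ∈ S.c₁.above {x | 1 - x / z j ∈ Complex.slitPlane}) :
    q ∈ ⋃ a, S.innerDomain δ j a := by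
  by_cases h : S.c₁.x q ∈ starSet 0 z
  · exact Set.mem_iUnion.2 ⟨none, hq.1, h⟩
  · obtain ⟨k, s, hs, hx⟩ := hz.exists_of_notMem_starSet h
    have hkj : k ≠ j := by
      rintro rfl
      have h2 : 1 - S.c₁.x q / z k ∈ Complex.slitPlane := hq.2
      rw [hx, mul_div_cancel_right₀ _ (hz.ne_zero k)] at h2
      rcases h2 with h2 | h2
      · simp at h2
        linarith
      · simp at h2
    refine Set.mem_iUnion.2 ⟨some ⟨k, hkj⟩, hq.1, ?_⟩
    rw [hx]
    exact smul_mem_sector hz.pos (hz.ne_zero k) (by linarith)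

/-- An equivariant cocycle of nontrivial weight which vanishes on all but one of the loops around
branch points has a primitive. -/
theorem CyclicCover.exists_primitive (hz : Separated z δ) {b : ℕ}
    (hb : Complex.exp (2 * Real.pi * Complex.I / m) ^ b ≠ 1) (j : Fin n)
    {ψ : C(unitInterval, X) → ℂ} (hψ : IsCocycle ψ) (hψD : S.D.IsEquivariant b ψ)
    {r : Fin n → ℝ} (hr : ∀ i, 0 < r i) (hr1 : ∀ i, r i < 1)
    (hrz : ∀ i k, k ≠ i → r i * ‖z i‖ < ‖z k - z i‖) {q₀ : X} (η : Fin n → Path q₀ q₀)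
    (hη : ∀ i t, η i t ∈ S.c₁.dom ∧ S.c₁.x (η i t) = lasso (z i) (r i) t)
    (h0 : ∀ i, i ≠ j → ψ (η i).toContinuousMap = 0) :
    ∃ F : X → ℂ, ∀ γ, ψ γ = F (γ 1) - F (γ 0) := by
  have hm := S.m_ne_zero
  obtain ⟨FA, hFA, hFAw⟩ := S.c₁.exists_potential S.D S.compat₁ hm
    (fun x => prod_eq_star_zero hz.ne_zero S.C x) hψ hψD
  obtain ⟨F₀, hF₀, hF₀w⟩ := S.c₂.exists_potential S.D S.compat₂ hm
    (fun x => prod_eq_star_infty z S.C x) hψ hψD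
  have hex (i : Fin n) := S.c₁.exists_potential S.D S.compat₁ hm
    (fun x => prod_eq_star i (hz.starDir_ne_zero i) S.C x) hψ hψD
  choose Fs hFs hFsw using hex
  have hslit (i : Fin n) : S.c₁.above (slitSector δ z i) ⊆ S.c₁.above (starSet 0 z) :=
    fun q hq => ⟨hq.1, hz.slitSector_subset hq.2⟩
  have hsec (i : Fin n) : S.c₁.above (sector δ (z i)) ⊆
      S.c₁.above (starSet (z i) (starDir z i)) :=
    fun q hq => ⟨hq.1, hz.sector_subset i hq.2⟩
  have hslit' (i : Fin n) : S.c₁.above (slitSector δ z i) ⊆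
      S.c₁.above (starSet (z i) (starDir z i)) :=
    fun q hq => hsec i ⟨hq.1, hq.2.1⟩
  have hAs (i : Fin n) (hij : i ≠ j) (q) (hq : q ∈ S.c₁.above (sector δ (z i)))
      (hqA : q ∈ S.c₁.above (starSet 0 z)) : FA q = Fs i q := by
    obtain ⟨p, hp, hxp, hval⟩ := S.lasso_value hz hψ hFA hFAw (hFs i) (hFsw i) (hr i) (hr1 i)
      (hrz i) (η i) (hη i)
    rw [h0 i hij, zero_eq_mul] at hval
    have hp0 : (FA - Fs i) p = 0 := hval.resolve_left (sub_ne_zero.2 (Ne.symm hb))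
    have hpot : IsPotential 0 (FA - Fs i) (S.c₁.above (slitSector δ z i)) :=
      (hFA.mono (hslit i)).sub_self ((hFs i).mono (hslit' i))
    have := S.eq_on_slitSector hz hpot ((hFAw.mono (hslit i)).sub ((hFsw i).mono (hslit' i)))
      (hr i) (hr1 i) hp hxp hp0 q ⟨hq.1, hq.2, by simpa using hqA.2 i⟩
    exact sub_eq_zero.1 this
  let Fin' (a : Option {i : Fin n // i ≠ j}) : X → ℂ := a.elim FA fun i => Fs i
  have hA2 {i k : Fin n} (hik : i ≠ k) {q : X} (hi : q ∈ S.c₁.above (sector δ (z i)))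
      (hk : q ∈ S.c₁.above (sector δ (z k))) : q ∈ S.c₁.above (starSet 0 z) :=
    ⟨hi.1, hz.mem_starSet_zero hi.2 (one_sub_mem_slitPlane (hz.neg_div_mem (Ne.symm hik) hk.2))⟩
  obtain ⟨FB, hFB, hFB'⟩ := hψ.exists_potential_iUnion (F := Fin') (S.isOpen_innerDomain δ j)
    (fun a => by
      cases a with
      | none => exact hFA
      | some i => exact (hFs i).mono (hsec i))
    (fun a b q ha hb => by
      rcases a with _ | i <;> rcases b with _ | k
      · rfl
      · exact hAs k k.2 q hb ha
      · exact (hAs i i.2 q ha hb).symm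
      · by_cases hik : i = k
        · rw [hik]
        · have hA := hA2 (fun h => hik (Subtype.ext h)) ha hb
          exact (hAs i i.2 q ha hA).symm.trans (hAs k k.2 q hb hA))
  have hFBw : S.D.HasWeight b FB (⋃ a, S.innerDomain δ j a) := by
    intro u hu q hq
    obtain ⟨a, ha⟩ := Set.mem_iUnion.1 hq
    rw [hFB' a _ (S.act_mem_innerDomain hu ha), hFB' a q ha]
    cases a with
    | none => exact hFAw u hu q ha
    | some i => exact hFsw i u hu q (hsec i ha)
  set E := S.c₂.above (starSet 0 fun k => (z k)⁻¹)
  set R := S.c₁.above {x | 1 - x / z j ∈ Complex.slitPlane}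
  have hER : E ∩ R ⊆ ⋃ a, S.innerDomain δ j a := fun q hq => S.mem_innerDomain hz hq.2
  have hBR : ⋃ a, S.innerDomain δ j a ⊆ R := Set.iUnion_subset (S.innerDomain_subset hz j)
  obtain ⟨κ, hκ⟩ := S.exists_eq_sheet_pow hz j
    ((hF₀.mono Set.inter_subset_left).sub_self (hFB.mono hER))
    ((hF₀w.mono Set.inter_subset_left).sub (hFBw.mono hER))
  set F₁ : X → ℂ := F₀ - fun q => κ * S.sheet q ^ b with hF₁
  have hF₁p : IsPotential ψ F₁ E := by
    have := hF₀.sub (isPotential_zero_of_eventually (F := fun q => κ * S.sheet q ^ b) (U := E)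
      fun q hq => (S.eventually_sheet_eq hq).mono fun p hp => by simp only [hp])
    rwa [sub_zero] at this
  have hF₁w : S.D.HasWeight b F₁ E := hF₀w.sub fun u hu q hq => by
    simp only [S.sheet_act hq.1 hu]
    ring
  obtain ⟨F₂, hF₂, hF₂'⟩ := hψ.exists_potential_iUnion
    (U := fun a : Bool => if a then E else ⋃ a, S.innerDomain δ j a)
    (F := fun a => if a then F₁ else FB)
    (fun a => by
      cases a
      · exact isOpen_iUnion (S.isOpen_innerDomain δ j)
      · exact S.c₂.isOpen_above (isOpen_starSet _ _))
    (fun a => by cases a <;> assumption)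
    (by
      have h (q : X) (hq : q ∈ E) (hq' : q ∈ ⋃ a, S.innerDomain δ j a) : F₁ q = FB q := by
        have := hκ q ⟨hq, hBR hq'⟩
        simp only [hF₁, Pi.sub_apply] at this ⊢
        linear_combination this
      rintro (_ | _) (_ | _) q h1 h2
      · rfl
      · exact (h q h2 h1).symm
      · exact h q h1 h2
      · rfl)
  have hF₂B := hF₂' false
  have hF₂E := hF₂' true
  simp only [if_true, Bool.false_eq_true, if_false] at hF₂B hF₂E
  set P := S.c₁.above {x | x ≠ z j}
  have hzj := hz.ne_zero j
  have hmem (q : X) : q ∈ E ∨ q ∈ (⋃ a, S.innerDomain δ j a) ∨ q ∈ S.c₁.dom ∧ S.c₁.x q = z j := by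
    by_cases hq : q ∈ S.c₁.dom
    · by_cases h : 1 - S.c₁.x q / z j ∈ Complex.slitPlane
      · exact Or.inr (Or.inl (S.mem_innerDomain hz ⟨hq, h⟩))
      · obtain ⟨h1, h2⟩ := notMem_slitPlane h
        set s := (S.c₁.x q / z j).re with hs
        have hx : S.c₁.x q / z j = s := Complex.ext rfl (by simpa using h2)
        have h1 : 1 ≤ s := by simpa using h1
        have hx : S.c₁.x q = s * z j := by rw [← hx, div_mul_cancel₀ _ hzj]
        rcases h1.eq_or_lt with h1 | h1
        · right; right
          refine ⟨hq, ?_⟩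
          rw [hx, ← h1, Complex.ofReal_one, one_mul]
        · left
          have hs0 : (s : ℂ) ≠ 0 := by
            exact_mod_cast (by linarith : s ≠ 0)
          obtain ⟨d1, d2, -⟩ := S.trans q hq (by rw [hx]; exact mul_ne_zero hs0 hzj)
          refine ⟨d1, ?_⟩
          rw [d2, hx]
          refine hz.inv_mem_starSet (smul_mem_sector hz.pos hzj (by linarith)) (Or.inl ?_)
          rw [mul_comm, ← div_div, div_self hzj, ← Complex.ofReal_one, ← Complex.ofReal_div,
            ← Complex.ofReal_sub, Complex.ofReal_re, sub_pos, one_div]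
          exact inv_lt_one_of_one_lt₀ h1
    · obtain ⟨d1, d2⟩ := S.mem_dom₂ q hq
      left
      refine ⟨d1, fun k => ?_⟩
      rw [d2]
      simp
  have hne (q : X) (hq : q ∈ S.c₁.dom) (h : q ∈ E ∨ q ∈ (⋃ a, S.innerDomain δ j a)) :
      S.c₁.x q ≠ z j := by
    intro hx
    rcases h with h | h
    · obtain ⟨-, d2, -⟩ := S.trans q hq (by rw [hx]; exact hzj)
      have := h.2 j
      rw [d2, hx, sub_zero, div_self (inv_ne_zero hzj), sub_self] at this
      exact Complex.slitPlane_ne_zero this rfl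
    · have : 1 - S.c₁.x q / z j ∈ Complex.slitPlane := (hBR h).2
      rw [hx, div_self hzj, sub_self] at this
      exact Complex.slitPlane_ne_zero this rfl
  obtain ⟨ρ, hρ0, hρ1, hρδ, hρz⟩ : ∃ ρ : ℝ, 0 < ρ ∧ ρ ≤ 1 ∧ ρ ≤ δ * (1 - ρ) ∧
      ∀ k, k ≠ j → ρ * ‖z j‖ < ‖z k - z j‖ := by
    have h1 : ∀ᶠ ρ : ℝ in 𝓝[>] 0, ρ < 1 :=
      nhdsWithin_le_nhds (gt_mem_nhds one_pos)
    have h2 : ∀ᶠ ρ : ℝ in 𝓝[>] 0, ρ < δ * (1 - ρ) := by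
      refine nhdsWithin_le_nhds (ContinuousAt.eventually_lt (f := fun ρ : ℝ => ρ)
        (g := fun ρ : ℝ => δ * (1 - ρ)) (by fun_prop) (by fun_prop) ?_)
      simpa using hz.pos
    have h3 : ∀ᶠ ρ : ℝ in 𝓝[>] 0, ∀ k, k ≠ j → ρ * ‖z j‖ < ‖z k - z j‖ := by
      simp only [eventually_all]
      intro k hk
      refine nhdsWithin_le_nhds (ContinuousAt.eventually_lt (f := fun ρ : ℝ => ρ * ‖z j‖)
        (g := fun ρ : ℝ => ‖z k - z j‖) (by fun_prop) (by fun_prop) ?_)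
      rw [zero_mul]
      exact norm_pos_iff.2 (hz.sub_ne_zero (Ne.symm hk))
    obtain ⟨ρ, ⟨⟨h1, h2⟩, h3⟩, h4⟩ := (((h1.and h2).and h3).and self_mem_nhdsWithin).exists
    exact ⟨ρ, h4, h1.le, h2.le, h3⟩
  set N := S.c₁.above {x | ‖x / z j - 1‖ < ρ}
  have hNopen : IsOpen N :=
    S.c₁.isOpen_above (isOpen_lt (by fun_prop) continuous_const)
  have hNsec : N ⊆ S.c₁.above (starSet (z j) (starDir z j)) := by
    intro q hq
    refine hsec j ⟨hq.1, ?_⟩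
    have hq2 : ‖S.c₁.x q / z j - 1‖ < ρ := hq.2
    have h1 := (Complex.abs_re_le_norm (S.c₁.x q / z j - 1)).trans_lt hq2
    have h2 := (Complex.abs_im_le_norm (S.c₁.x q / z j - 1)).trans_lt hq2
    rw [Complex.sub_re, Complex.one_re, abs_lt] at h1
    rw [Complex.sub_im, Complex.one_im, sub_zero] at h2
    change |(S.c₁.x q / z j).im| < δ * (S.c₁.x q / z j).re
    have := mul_lt_mul_of_pos_left (show 1 - ρ < (S.c₁.x q / z j).re by linarith) hz.pos
    linarith
  set N' := S.c₁.above {x | x ≠ z j ∧ ‖x / z j - 1‖ < ρ}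
  have hN' : N' ⊆ N := fun q hq => ⟨hq.1, hq.2.2⟩
  have hN'2 (q : X) (hq : q ∈ N') : q ∈ E ∨ q ∈ (⋃ a, S.innerDomain δ j a) := by
    rcases hmem q with h | h | h
    · exact Or.inl h
    · exact Or.inr h
    · exact absurd h.2 hq.2.1
  have hdomF₂ (q : X) (hq : q ∈ E ∨ q ∈ (⋃ a, S.innerDomain δ j a)) :
      q ∈ ⋃ a : Bool, if a then E else ⋃ a, S.innerDomain δ j a := by
    rcases hq with h | h
    · exact Set.mem_iUnion.2 ⟨true, by simpa using h⟩
    · exact Set.mem_iUnion.2 ⟨false, by simpa using h⟩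
  have hzero := S.eq_zero_of_punctured hz hb j hρ1 hρz
    ((hF₂.mono fun q hq => hdomF₂ q (hN'2 q hq)).sub_self ((hFs j).mono (hN'.trans hNsec)))
    (DeckAction.HasWeight.sub (fun u hu q hq => by
      rcases hN'2 q hq with h | h
      · rw [hF₂E _ (PlaneChart.act_mem_above S.compat₂ hu h), hF₂E q h, hF₁w u hu q h]
      · obtain ⟨a, ha⟩ := Set.mem_iUnion.1 h
        rw [hF₂B _ (Set.mem_iUnion.2 ⟨a, S.act_mem_innerDomain hu ha⟩), hF₂B q h, hFBw u hu q h])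
      ((hFsw j).mono (hN'.trans hNsec)))
  obtain ⟨F, hF, -⟩ := hψ.exists_potential_iUnion
    (U := fun a : Bool => if a then N else ⋃ a : Bool, if a then E else ⋃ a, S.innerDomain δ j a)
    (F := fun a => if a then Fs j else F₂)
    (fun a => by
      cases a
      · refine isOpen_iUnion fun a => ?_
        cases a
        · exact isOpen_iUnion (S.isOpen_innerDomain δ j)
        · exact S.c₂.isOpen_above (isOpen_starSet _ _)
      · exact hNopen)
    (fun a => by
      cases a
      · exact hF₂
      · exact (hFs j).mono hNsec)
    (by
      have h (q : X) (hq : q ∈ N)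
          (hq' : q ∈ ⋃ a : Bool, if a then E else ⋃ a, S.innerDomain δ j a) : Fs j q = F₂ q := by
        refine (sub_eq_zero.1 (hzero q ⟨hq.1, hne q hq.1 ?_, hq.2⟩)).symm
        obtain ⟨a, ha⟩ := Set.mem_iUnion.1 hq'
        cases a
        · exact Or.inr ha
        · exact Or.inl ha
      rintro (_ | _) (_ | _) q h1 h2
      · rfl
      · exact (h q h2 h1).symm
      · exact h q h1 h2
      · rfl)
  refine ⟨F, fun γ => hF γ fun t => ?_⟩
  rcases hmem (γ t) with h | h | h
  · exact Set.mem_iUnion.2 ⟨false, hdomF₂ _ (Or.inl h)⟩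
  · exact Set.mem_iUnion.2 ⟨false, hdomF₂ _ (Or.inr h)⟩
  · refine Set.mem_iUnion.2 ⟨true, h.1, ?_⟩
    change ‖S.c₁.x (γ t) / z j - 1‖ < ρ
    rw [h.2, div_self hzj, sub_self, norm_zero]
    exact hρ0

end Primitives

section CechCocycles

open Filter Topology

variable {X : Type} [TopologicalSpace X] {m : ℕ}

open Classical in
/-- An equivariant Čech cocycle on three invariant open sets defines an equivariant cocycle. -/
lemma DeckAction.exists_isCocycle (D : DeckAction X m) {b : ℕ} {U₀ U₁ U₂ : Set X}
    (hU₀ : IsOpen U₀) (hU₁ : IsOpen U₁) (hU₂ : IsOpen U₂) (hU : ∀ q, q ∈ U₀ ∨ q ∈ U₁ ∨ q ∈ U₂)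
    (hD₀ : ∀ u hu q, D.act u hu q ∈ U₀ ↔ q ∈ U₀) (hD₁ : ∀ u hu q, D.act u hu q ∈ U₁ ↔ q ∈ U₁)
    (hD₂ : ∀ u hu q, D.act u hu q ∈ U₂ ↔ q ∈ U₂) {f₀₁ f₀₂ f₁₂ : X → ℂ}
    (h₀₁ : ∀ q ∈ U₀, q ∈ U₁ → ∀ᶠ p in 𝓝 q, f₀₁ p = f₀₁ q)
    (h₀₂ : ∀ q ∈ U₀, q ∈ U₂ → ∀ᶠ p in 𝓝 q, f₀₂ p = f₀₂ q)
    (h₁₂ : ∀ q ∈ U₁, q ∈ U₂ → ∀ᶠ p in 𝓝 q, f₁₂ p = f₁₂ q)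
    (w₀₁ : D.HasWeight b f₀₁ (U₀ ∩ U₁)) (w₀₂ : D.HasWeight b f₀₂ (U₀ ∩ U₂))
    (w₁₂ : D.HasWeight b f₁₂ (U₁ ∩ U₂))
    (h : ∀ q ∈ U₀, q ∈ U₁ → q ∈ U₂ → f₀₂ q = f₀₁ q + f₁₂ q) :
    ∃ ψ : C(unitInterval, X) → ℂ, IsCocycle ψ ∧ D.IsEquivariant b ψ ∧ IsPotential ψ 0 U₀ ∧
      IsPotential ψ (fun q => if q ∈ U₀ then -f₀₁ q else 0) U₁ := by
  let F₁ (q : X) : ℂ := if q ∈ U₀ then -f₀₁ q else 0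
  let F₂ (q : X) : ℂ := if q ∈ U₀ then -f₀₂ q else if q ∈ U₁ then -f₁₂ q else 0
  let U : Fin 3 → Set X := ![U₀, U₁, U₂]
  let F : Fin 3 → X → ℂ := ![0, F₁, F₂]
  have hopen : ∀ a, IsOpen (U a) := by
    intro a
    fin_cases a
    exacts [hU₀, hU₁, hU₂]
  have hcov : ⋃ a, U a = Set.univ := by
    refine Set.eq_univ_of_forall fun q => Set.mem_iUnion.2 ?_
    rcases hU q with h | h | h
    exacts [⟨0, h⟩, ⟨1, h⟩, ⟨2, h⟩]
  have aux {V V' : Set X} (hV : IsOpen V) (hV' : IsOpen V') {G G' f : X → ℂ}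
      (hG : ∀ q ∈ V, q ∈ V' → G q - G' q = f q)
      (hf : ∀ q ∈ V, q ∈ V' → ∀ᶠ p in 𝓝 q, f p = f q) :
      ∀ q ∈ V ∩ V', ∀ᶠ p in 𝓝 q, G p - G' p = G q - G' q := by
    intro q hq
    filter_upwards [hV.mem_nhds hq.1, hV'.mem_nhds hq.2, hf q hq.1 hq.2] with p h1 h2 h3
    rw [hG p h1 h2, hG q hq.1 hq.2, h3]
  have aux' {V V' : Set X} {G G' : X → ℂ}
      (hG : ∀ q ∈ V ∩ V', ∀ᶠ p in 𝓝 q, G p - G' p = G q - G' q) :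
      ∀ q ∈ V' ∩ V, ∀ᶠ p in 𝓝 q, G' p - G p = G' q - G q := fun q hq =>
    (hG q ⟨hq.2, hq.1⟩).mono fun p hp => by linear_combination -hp
  have a01 := aux hU₀ hU₁ (G := 0) (G' := F₁) (f := f₀₁) (fun q h0 _ => by simp [F₁, h0]) h₀₁
  have a02 := aux hU₀ hU₂ (G := 0) (G' := F₂) (f := f₀₂) (fun q h0 _ => by simp [F₂, h0]) h₀₂
  have a12 := aux hU₁ hU₂ (G := F₁) (G' := F₂) (f := f₁₂) (fun q h1 h2 => by
    by_cases h0 : q ∈ U₀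
    · simp [F₁, F₂, h0, h q h0 h1 h2]
    · simp [F₁, F₂, h0, h1]) h₁₂
  have aii (i : Fin 3) : ∀ q ∈ U i ∩ U i, ∀ᶠ p in 𝓝 q, F i p - F i p = F i q - F i q :=
    fun q _ => Eventually.of_forall fun p => by ring
  obtain ⟨ψ, hψ, hpot⟩ := exists_isCocycle_of_branches (U := U) (F := F) hopen hcov (by
    intro a c
    fin_cases a <;> fin_cases c
    exacts [aii 0, a01, a02, aux' a01, aii 1, a12, aux' a02, aux' a12, aii 2])
  refine ⟨ψ, hψ, fun u hu γ => ?_, hpot 0, hpot 1⟩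
  have hUD : ∀ a q, D.act u hu q ∈ U a ↔ q ∈ U a := by
    intro a q
    fin_cases a
    exacts [hD₀ u hu q, hD₁ u hu q, hD₂ u hu q]
  have hw : ∀ a, ∀ q ∈ U a, F a (D.act u hu q) = u ^ b * F a q := by
    intro a q hq
    fin_cases a
    · exact (mul_zero _).symm
    · change F₁ _ = _ * F₁ _
      by_cases h0 : q ∈ U₀
      · simp [F₁, h0, hD₀, w₀₁ u hu q ⟨h0, hq⟩]
      · simp [F₁, h0, hD₀]
    · change F₂ _ = _ * F₂ _
      by_cases h0 : q ∈ U₀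
      · simp [F₂, h0, hD₀, w₀₂ u hu q ⟨h0, hq⟩]
      · by_cases h1 : q ∈ U₁
        · simp [F₂, h0, h1, hD₀, hD₁, w₁₂ u hu q ⟨h1, hq⟩]
        · simp [F₂, h0, h1, hD₀, hD₁]
  have := ((hψ.comp (D.act u hu)).add (hψ.smul (-u ^ b))).eq_sub_of_local (F := 0) γ fun t => by
    obtain ⟨a, ha⟩ := Set.mem_iUnion.1 (hcov.symm ▸ Set.mem_univ (γ t))
    refine ⟨U a, (hopen a).mem_nhds ha, fun γ' hγ' => ?_⟩
    have h1 := hpot a γ' hγ'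
    have h2 := hpot a ((D.act u hu).comp γ') fun t => (hUD a _).2 (hγ' t)
    rw [ContinuousMap.comp_apply, ContinuousMap.comp_apply, hw a _ (hγ' 1), hw a _ (hγ' 0)] at h2
    simp only [Pi.add_apply, Pi.smul_apply, smul_eq_mul, Pi.zero_apply]
    rw [h1, h2]
    ring
  simp only [Pi.add_apply, Pi.smul_apply, smul_eq_mul, Pi.zero_apply] at this
  linear_combination this

end CechCocycles

section SegmentCocycles

open Filter Topology

lemma proot_eq_mul_proot_neg {m : ℕ} {t : ℂ} (ht : t ≠ 0) {σ : ℝ}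
    (h : Complex.arg t = Complex.arg (-t) + σ) :
    proot m t = Complex.exp (σ * Complex.I / m) * proot m (-t) := by
  rw [proot, proot, Complex.cpow_def_of_ne_zero ht, Complex.cpow_def_of_ne_zero (neg_ne_zero.2 ht),
    ← Complex.exp_add, Complex.log, Complex.log, h, norm_neg]
  congr 1
  push_cast
  ring

variable {n : ℕ} {z : Fin n → ℂ} {δ : ℝ}

/-- The change from the trivialization at infinity to that over `slitSector`. -/
def sheetRatio (m e : ℕ) (z : Fin n → ℂ) (i : Fin n) (x : ℂ) : ℂ :=
  sectorRoot m z i x / (x ^ e * starRoot m 0 (fun k => (z k)⁻¹) x⁻¹)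

lemma Separated.sheetRatio_pow (hz : Separated z δ) {m e : ℕ} (hm : m ≠ 0) (he : e * m = n + 1)
    {i : Fin n} {x : ℂ} (hx : x ∈ slitSector δ z i)
    (hx' : x⁻¹ ∈ starSet 0 fun k => (z k)⁻¹) :
    sheetRatio m e z i x ^ m = ((∏ k, (-z k)) * z i)⁻¹ := by
  have hx0 := ne_zero_of_mem_sector hx.1
  have h1 := hz.sectorRoot_pow hm (i := i) 1 x
  have h2 := starRoot_pow hm 0 (fun k => (z k)⁻¹) x⁻¹
  have h3 := prod_eq_star_infty z 1 x⁻¹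
  rw [← h2] at h3
  have h4 : x * ∏ k, (x - z k) = x ^ (n + 1) * ∏ k, (1 - z k * x⁻¹) := by
    have : ∏ k, (x - z k) = x ^ n * ∏ k, (1 - z k * x⁻¹) := by
      rw [← Fin.prod_const n x, ← Finset.prod_mul_distrib]
      refine Finset.prod_congr rfl fun k _ => ?_
      field_simp
    rw [this]
    ring
  have h5 : ∏ k, (-z k) ≠ 0 := Finset.prod_ne_zero_iff.2 fun k _ => neg_ne_zero.2 (hz.ne_zero k)
  have h6 := starRoot_ne_zero (m := m) hx'
  have hzi := hz.ne_zero i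
  rw [sheetRatio, div_pow, mul_pow, ← pow_mul, he]
  refine eq_inv_of_mul_eq_one_left ?_
  have h7 : x ^ (n + 1) * starRoot m 0 (fun k => (z k)⁻¹) x⁻¹ ^ m ≠ 0 :=
    mul_ne_zero (pow_ne_zero _ hx0) (pow_ne_zero _ h6)
  rw [div_mul_eq_mul_div, div_eq_one_iff_eq h7]
  linear_combination -h1 + h4 + x ^ (n + 1) * h3

lemma mem_slitSector_of_im_ne {i : Fin n} {x : ℂ} (hx : x ∈ sector δ (z i))
    (h : (x / z i).im ≠ 0) : x ∈ slitSector δ z i :=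
  ⟨hx, Or.inr (by simpa using h)⟩

lemma Separated.inv_mem_starSet_of_im_ne (hz : Separated z δ) {i : Fin n} {x : ℂ}
    (hx : x ∈ sector δ (z i)) (h : (x / z i).im ≠ 0) : x⁻¹ ∈ starSet 0 fun k => (z k)⁻¹ := by
  refine hz.inv_mem_starSet hx (one_sub_mem_slitPlane ?_)
  rw [← inv_div, ← inv_neg]
  exact inv_mem_slitPlane (Or.inr (by simpa using h))

lemma Separated.sheetRatio_eq (hz : Separated z δ) {m e : ℕ} (hm : m ≠ 0) (he : e * m = n + 1)
    {i : Fin n} {ε : ℝ} {x x' : ℂ} (hx : x ∈ sector δ (z i)) (hε : 0 < ε * (x / z i).im)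
    (hx' : x' ∈ sector δ (z i)) (hε' : 0 < ε * (x' / z i).im) :
    sheetRatio m e z i x = sheetRatio m e z i x' := by
  set H := sector δ (z i) ∩ {x | 0 < ε * (x / z i).im}
  have hc : Convex ℝ H := by
    refine (convex_sector δ (z i)).inter fun x hx y hy s t hs ht hst => ?_
    simp only [Set.mem_ofPred_eq] at hx hy ⊢
    have : ((s • x + t • y) / z i).im = s * (x / z i).im + t * (y / z i).im := by
      rw [add_div, smul_div_assoc, smul_div_assoc]
      simp
    rw [this]
    rcases hs.eq_or_lt with rfl | hs'
    · obtain rfl : t = 1 := by linarith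
      linarith
    · have := mul_pos hs' hx
      have := mul_nonneg ht hy.le
      nlinarith
  have him {x : ℂ} (hx : x ∈ H) : (x / z i).im ≠ 0 := fun h => by
    have := hx.2
    simp [h] at this
  refine eq_of_pow_eq_of_isPreconnected hm hc.isPreconnected (w := sheetRatio m e z i) ?_
    (fun x hx => hz.sheetRatio_pow hm he (mem_slitSector_of_im_ne hx.1 (him hx))
      (hz.inv_mem_starSet_of_im_ne hx.1 (him hx))) ⟨hx, hε⟩ ⟨hx', hε'⟩
  have h0 {x : ℂ} (hx : x ∈ H) : x ≠ 0 := ne_zero_of_mem_sector hx.1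
  refine ((hz.continuousOn_sectorRoot m).mono
    fun x hx => mem_slitSector_of_im_ne hx.1 (him hx)).div ((continuousOn_id.pow e).mul
      ((continuousOn_starRoot m 0 _).comp (continuousOn_id.inv₀ fun x hx => h0 hx)
        fun x hx => hz.inv_mem_starSet_of_im_ne hx.1 (him hx))) fun x hx => ?_
  exact mul_ne_zero (pow_ne_zero _ (h0 hx))
    (starRoot_ne_zero (hz.inv_mem_starSet_of_im_ne hx.1 (him hx)))

lemma Separated.exists_sheetRatio (hz : Separated z δ) {m e : ℕ} (hm : m ≠ 0)
    (he : e * m = n + 1) (i : Fin n) (ε : ℝ) : ∃ g : ℂ, ∀ x ∈ sector δ (z i),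
      0 < ε * (x / z i).im → sheetRatio m e z i x = g := by
  by_cases h : ∃ x ∈ sector δ (z i), 0 < ε * (x / z i).im
  · obtain ⟨x, hx, hε⟩ := h
    exact ⟨_, fun x' hx' hε' => hz.sheetRatio_eq hm he hx' hε' hx hε⟩
  · push Not at h
    exact ⟨0, fun x hx hε => absurd hε (h x hx).not_gt⟩

/-- The coefficients of the cocycle around a segment. -/
lemma Separated.exists_coefficients (hz : Separated z δ) {m e : ℕ} (hm : m ≠ 0)
    (he : e * m = n + 1) {b : ℕ} (hb : Complex.exp (2 * Real.pi * Complex.I / m) ^ b ≠ 1)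
    (i : Fin n) : ∃ c c' : ℂ, ∀ x ∈ sector δ (z i), (x / z i).im ≠ 0 →
      c' * (proot m (x / z i) / proot m (-(x / z i))) ^ b = sheetRatio m e z i x ^ b + c := by
  obtain ⟨g, hg⟩ := hz.exists_sheetRatio hm he i 1
  obtain ⟨g', hg'⟩ := hz.exists_sheetRatio hm he i (-1)
  set k := Complex.exp ((Real.pi : ℝ) * Complex.I / m)
  set k' := Complex.exp ((-Real.pi : ℝ) * Complex.I / m)
  have hkk : k = Complex.exp (2 * Real.pi * Complex.I / m) * k' := by
    simp only [k, k']
    rw [← Complex.exp_add]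
    congr 1
    push_cast
    ring
  have hne : k ^ b - k' ^ b ≠ 0 := by
    rw [hkk, mul_pow, ← sub_one_mul]
    exact mul_ne_zero (_root_.sub_ne_zero.2 hb) (pow_ne_zero _ (Complex.exp_ne_zero _))
  refine ⟨(g ^ b - g' ^ b) / (k ^ b - k' ^ b) * k ^ b - g ^ b,
    (g ^ b - g' ^ b) / (k ^ b - k' ^ b), fun x hx him => ?_⟩
  have ht : x / z i ≠ 0 := div_ne_zero (ne_zero_of_mem_sector hx) (hz.ne_zero i)
  have hp := proot_ne_zero (m := m) (neg_ne_zero.2 ht)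
  rcases lt_or_gt_of_ne him with h | h
  · rw [proot_eq_mul_proot_neg ht (σ := -Real.pi)
      (by rw [Complex.arg_neg_eq_arg_add_pi_of_im_neg h]; ring), mul_div_assoc, div_self hp,
      mul_one, hg' x hx (by linarith)]
    change _ * k' ^ b = _
    field_simp
    ring
  · rw [proot_eq_mul_proot_neg ht (σ := Real.pi)
      (by rw [Complex.arg_neg_eq_arg_sub_pi_of_im_pos h]; ring), mul_div_assoc, div_self hp,
      mul_one, hg x hx (by linarith)]
    ring

end SegmentCocycles

section Independence

open Filter Topology

lemma PlaneChart.eventually_div_eq {X : Type} [TopologicalSpace X] {m : ℕ} {f : ℂ → ℂ}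
    (c : PlaneChart X m f) (hm : m ≠ 0) {V : Set ℂ} (hV : IsOpen V) {Y : ℂ → ℂ}
    (hYc : ContinuousOn Y V) (hY0 : ∀ x ∈ V, Y x ≠ 0) {κ : ℂ}
    (hY : ∀ x ∈ V, f x = κ * Y x ^ m) {q : X} (hq : q ∈ c.above V) :
    ∀ᶠ p in 𝓝 q, c.y p / Y (c.x p) = c.y q / Y (c.x q) := by
  have hU := (c.isOpen_above hV).mem_nhds hq
  refine eventually_eq_of_pow_eq hm (κ := κ) (w := fun p => c.y p / Y (c.x p)) ?_ ?_
  · refine (c.continuousAt_y hq.1).div (ContinuousAt.comp (f := c.x) ?_ (c.continuousAt_x hq.1))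
      (hY0 _ hq.2)
    exact hYc.continuousAt (hV.mem_nhds hq.2)
  · filter_upwards [hU] with p hp
    rw [div_pow, c.y_pow p hp.1, hY _ hp.2, mul_div_assoc, div_self (pow_ne_zero _ (hY0 _ hp.2)),
      mul_one]

variable {X : Type} [TopologicalSpace X] {m n : ℕ} {z : Fin n → ℂ} (S : CyclicCover X m z) {δ : ℝ}

lemma CyclicCover.act_mem_above₁_iff {V : Set ℂ} {u : ℂ} (hu : u ^ m = 1) {q : X} :
    S.D.act u hu q ∈ S.c₁.above V ↔ q ∈ S.c₁.above V := by
  refine ⟨fun h => ?_, PlaneChart.act_mem_above S.compat₁ hu⟩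
  by_cases hq : q ∈ S.c₁.dom
  · refine ⟨hq, ?_⟩
    rw [← (S.compat₁ u hu q hq).2.1]
    exact h.2
  · obtain ⟨d1, d2⟩ := S.mem_dom₂ q hq
    obtain ⟨e1, e2, -⟩ := S.compat₂ u hu q d1
    exact absurd h.1 (S.notMem_dom₁ _ e1 (e2.trans d2))

lemma CyclicCover.x_ne_zero {q : X} (h₁ : q ∈ S.c₁.dom) (h₂ : q ∈ S.c₂.dom) :
    S.c₁.x q ≠ 0 := by
  have h := fun h => S.notMem_dom₁ q h₂ h h₁
  rw [(S.mem_dom₁ q h₂ h).2]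
  exact inv_ne_zero h

lemma CyclicCover.act_mem_above₂_iff {V : Set ℂ} {u : ℂ} (hu : u ^ m = 1) {q : X} :
    S.D.act u hu q ∈ S.c₂.above V ↔ q ∈ S.c₂.above V := by
  refine ⟨fun h => ?_, PlaneChart.act_mem_above S.compat₂ hu⟩
  by_cases hq : q ∈ S.c₂.dom
  · refine ⟨hq, ?_⟩
    rw [← (S.compat₂ u hu q hq).2.1]
    exact h.2
  · have d1 : q ∈ S.c₁.dom := by_contra fun h => hq (S.mem_dom₂ q h).1
    have d2 : S.c₁.x q = 0 := by_contra fun h => hq (S.trans q d1 h).1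
    obtain ⟨e1, e2, -⟩ := S.compat₁ u hu q d1
    exact absurd (e2.trans d2) (S.x_ne_zero e1 h.1)

lemma CyclicCover.sheet_eq (hz : Separated z δ) {q : X} (h₁ : q ∈ S.c₁.dom) (h₂ : q ∈ S.c₂.dom)
    {i : Fin n} (hq : S.c₁.x q ∈ slitSector δ z i) :
    S.sheet q = sheetRatio m S.e z i (S.c₁.x q) *
      (S.c₁.y q / sectorRoot m z i (S.c₁.x q)) := by
  obtain ⟨-, d2, d3⟩ := S.trans q h₁ (S.x_ne_zero h₁ h₂)
  have h0 := hz.sectorRoot_ne_zero m hq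
  rw [sheet, d2, d3, sheetRatio]
  field_simp

/-- The points over the complement of the segment from the origin to `z i`. -/
def CyclicCover.offSegment (i : Fin n) : Set X :=
  S.c₂.above {v | 1 - z i * v ∈ Complex.slitPlane}

lemma CyclicCover.isOpen_offSegment (i : Fin n) : IsOpen (S.offSegment i) :=
  S.c₂.isOpen_above (Complex.isOpen_slitPlane.preimage
    (f := fun v : ℂ => 1 - z i * v) (by fun_prop))

lemma CyclicCover.mem_offSegment_of_mem_above {i : Fin n} {q : X}
    (hq : q ∈ S.c₂.above (starSet 0 fun k => (z k)⁻¹)) : q ∈ S.offSegment i := by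
  refine ⟨hq.1, ?_⟩
  have := hq.2 i
  rwa [sub_zero, div_inv_eq_mul, mul_comm] at this

/-- The equivariant cocycle which counts the crossings of the segment from the origin to `z i`. -/
theorem CyclicCover.exists_segment_cocycle (hz : Separated z δ) {b : ℕ}
    (hb : Complex.exp (2 * Real.pi * Complex.I / m) ^ b ≠ 1) (i : Fin n) :
    ∃ ψ : C(unitInterval, X) → ℂ, IsCocycle ψ ∧ S.D.IsEquivariant b ψ ∧
      IsPotential ψ 0 (S.offSegment i) ∧ ∃ F : X → ℂ,
        IsPotential ψ F (S.c₁.above (sector δ (z i))) ∧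
        (∀ q ∈ S.offSegment i, F q = -S.sheet q ^ b) ∧
        ∀ q ∈ S.c₁.dom, S.c₁.x q = z i → F q = 0 := by
  classical
  have hm := S.m_ne_zero
  have hzi := hz.ne_zero i
  obtain ⟨c, c', hcc⟩ := hz.exists_coefficients hm S.e_mul hb i
  have hx₂ {q : X} (h₁ : q ∈ S.c₁.dom) (h : q ∈ S.offSegment i) :
      1 - z i / S.c₁.x q ∈ Complex.slitPlane := by
    obtain ⟨-, d2, -⟩ := S.trans q h₁ (S.x_ne_zero h₁ h.1)
    have := h.2
    rwa [d2, Set.mem_ofPred_eq, ← div_eq_mul_inv] at this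
  have hE {q : X} (h : q ∈ S.offSegment i) (h₁ : q ∈ S.c₁.above (sector δ (z i))) :
      q ∈ S.c₂.above (starSet 0 fun k => (z k)⁻¹) := by
    obtain ⟨d1, d2, -⟩ := S.trans q h₁.1 (S.x_ne_zero h₁.1 h.1)
    exact ⟨d1, by rw [d2]; exact hz.inv_mem_starSet h₁.2 (hx₂ h₁.1 h)⟩
  have hslit {q : X} (h₁ : q ∈ S.c₁.above (sector δ (z i))) (h₂ : q ∈ S.c₁.above (starSet 0 z)) :
      q ∈ S.c₁.above (slitSector δ z i) :=
    ⟨h₁.1, h₁.2, by simpa using h₂.2 i⟩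
  set V := starSet 0 z ∩ {x | -(x / z i) ∈ Complex.slitPlane} with hV
  have hVopen : IsOpen V := (isOpen_starSet _ _).inter
    (Complex.isOpen_slitPlane.preimage (f := fun x : ℂ => -(x / z i)) (by fun_prop))
  have hVmem {q : X} (h : q ∈ S.offSegment i) (h₂ : q ∈ S.c₁.above (starSet 0 z)) :
      q ∈ S.c₁.above V := by
    refine ⟨h₂.1, h₂.2, ?_⟩
    by_contra hn
    obtain ⟨h3, h4⟩ := notMem_slitPlane hn
    rw [Complex.neg_re] at h3
    rw [Complex.neg_im, neg_eq_zero] at h4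
    set s := (S.c₁.x q / z i).re with hs
    have hxs : S.c₁.x q / z i = s := Complex.ext rfl (by simpa using h4)
    have hx0 := S.x_ne_zero h₂.1 h.1
    have hs0 : s ≠ 0 := by
      intro h0
      rw [h0, Complex.ofReal_zero] at hxs
      exact div_ne_zero hx0 hzi hxs
    have h5 := h₂.2 i
    rw [sub_zero, hxs] at h5
    have h6 := hx₂ h₂.1 h
    rw [← inv_div, hxs, ← Complex.ofReal_inv] at h6
    have h5' : s < 1 := by
      rcases h5 with h | h
      · simpa using h
      · simp at h
    have h6' : s⁻¹ < 1 := by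
      rcases h6 with h | h
      · simpa using h
      · simp at h
    have hs' : 0 < s := lt_of_le_of_ne (by linarith) (Ne.symm hs0)
    rw [inv_lt_one₀ hs'] at h6'
    linarith
  let Y (x : ℂ) : ℂ := proot m (-(x / z i)) * starRoot m 0 z x
  have hYc : ContinuousOn Y V := by
    refine ContinuousOn.mul (fun x hx => ContinuousAt.continuousWithinAt ?_)
      ((continuousOn_starRoot m 0 z).mono Set.inter_subset_left)
    exact (continuousAt_proot hx.2).comp (f := fun x => -(x / z i)) (by fun_prop)
  have hY0 (x) (hx : x ∈ V) : Y x ≠ 0 :=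
    mul_ne_zero (proot_ne_zero (Complex.slitPlane_ne_zero hx.2)) (starRoot_ne_zero hx.1)
  have hY (x) (_ : x ∈ V) : S.C * x * ∏ k, (x - z k) =
      -(S.C * (∏ k, (-z k)) * z i) * Y x ^ m := by
    rw [prod_eq_star_zero hz.ne_zero, mul_pow, proot_pow hm, starRoot_pow hm]
    field_simp
    ring
  have hopen : IsOpen (slitSector δ z i) := (isOpen_sector _ _).inter
    (Complex.isOpen_slitPlane.preimage (f := fun x : ℂ => 1 - x / z i) (by fun_prop))
  let f₁₂ (q : X) : ℂ := c * (S.c₁.y q / sectorRoot m z i (S.c₁.x q)) ^ b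
  let f₀₂ (q : X) : ℂ := c' * (S.c₁.y q / Y (S.c₁.x q)) ^ b
  have hcov (q : X) : q ∈ S.offSegment i ∨ q ∈ S.c₁.above (sector δ (z i)) ∨
      q ∈ S.c₁.above (starSet 0 z) := by
    by_cases hq : q ∈ S.c₁.dom
    · by_cases hx : S.c₁.x q = 0
      · exact Or.inr (Or.inr ⟨hq, fun k => by rw [hx]; simp⟩)
      · obtain ⟨d1, d2, -⟩ := S.trans q hq hx
        by_cases h : 1 - z i * S.c₂.x q ∈ Complex.slitPlane
        · exact Or.inl ⟨d1, h⟩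
        · right; left
          obtain ⟨h3, h4⟩ := notMem_slitPlane h
          rw [Complex.sub_re, Complex.one_re, sub_nonpos] at h3
          rw [Complex.sub_im, Complex.one_im, zero_sub, neg_eq_zero] at h4
          set s := (z i * S.c₂.x q).re with hs
          have hxs : z i * S.c₂.x q = s := Complex.ext rfl (by rw [h4, Complex.ofReal_im])
          refine ⟨hq, ?_⟩
          have : S.c₁.x q = ((s⁻¹ : ℝ) : ℂ) * z i := by
            rw [Complex.ofReal_inv, ← hxs, d2]
            field_simp
          rw [this]
          exact smul_mem_sector hz.pos hzi (inv_pos.2 (by linarith))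
    · obtain ⟨d1, d2⟩ := S.mem_dom₂ q hq
      exact Or.inl ⟨d1, by rw [d2]; simp⟩
  obtain ⟨ψ, h1, h2, h3, h4⟩ := S.D.exists_isCocycle (b := b) (f₀₁ := fun q => S.sheet q ^ b)
    (f₀₂ := f₀₂) (f₁₂ := f₁₂) (S.isOpen_offSegment i)
    (S.c₁.isOpen_above (isOpen_sector δ (z i))) (S.c₁.isOpen_above (isOpen_starSet 0 z)) hcov
    (fun u hu q => S.act_mem_above₂_iff hu) (fun u hu q => S.act_mem_above₁_iff hu)
    (fun u hu q => S.act_mem_above₁_iff hu)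
    (fun q h0 h1 => (S.eventually_sheet_eq (hE h0 h1)).mono fun p hp => by rw [hp])
    (fun q h0 h2 => (S.c₁.eventually_div_eq hm hVopen hYc hY0 hY (hVmem h0 h2)).mono
      fun p hp => by simp only [f₀₂, hp])
    (fun q h1 h2 => (S.c₁.eventually_div_eq hm hopen (hz.continuousOn_sectorRoot m)
      (fun x hx => hz.sectorRoot_ne_zero m hx) (fun x _ => hz.sectorRoot_pow hm S.C x)
      (hslit h1 h2)).mono fun p hp => by simp only [f₁₂, hp])
    (fun u hu q hq => by simp only [S.sheet_act hq.1.1 hu, mul_pow])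
    (fun u hu q hq => by
      obtain ⟨-, d2, d3⟩ := S.compat₁ u hu q hq.2.1
      simp only [f₀₂, d2, d3]
      rw [mul_div_assoc, mul_pow]
      ring)
    (fun u hu q hq => by
      obtain ⟨-, d2, d3⟩ := S.compat₁ u hu q hq.2.1
      simp only [f₁₂, d2, d3]
      rw [mul_div_assoc, mul_pow]
      ring)
    (fun q h0 h1 h2 => by
      have hs := hslit h1 h2
      have hv := hVmem h0 h2
      have ht : (S.c₁.x q / z i).im ≠ 0 := by
        rcases hv.2.2 with h | h
        · have := re_pos_of_mem_sector hz.pos h1.2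
          rw [Complex.neg_re] at h
          linarith
        · simpa using h
      have hk := hcc _ h1.2 ht
      have p1 := proot_ne_zero (m := m) (Complex.slitPlane_ne_zero (Or.inl
        (re_pos_of_mem_sector hz.pos h1.2)))
      have p2 := proot_ne_zero (m := m) (Complex.slitPlane_ne_zero hv.2.2)
      have p3 := starRoot_ne_zero (m := m) h2.2
      have : S.c₁.y q / Y (S.c₁.x q) = (proot m (S.c₁.x q / z i) / proot m (-(S.c₁.x q / z i))) *
          (S.c₁.y q / sectorRoot m z i (S.c₁.x q)) := by
        simp only [Y, sectorRoot]
        field_simp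
      simp only [f₀₂, f₁₂]
      rw [this, S.sheet_eq hz h1.1 h0.1 hs.2, mul_pow, mul_pow]
      linear_combination (S.c₁.y q / sectorRoot m z i (S.c₁.x q)) ^ b * hk)
  refine ⟨ψ, h1, h2, h3, _, h4, fun q hq => if_pos hq, fun q hq hx => if_neg fun h => ?_⟩
  have := hx₂ hq h
  rw [hx, div_self hzi, sub_self] at this
  exact Complex.slitPlane_ne_zero this rfl

/-- The cocycles around the segments are independent modulo their sum, up to scalars. -/
theorem CyclicCover.exists_cocycles (hz : Separated z δ) {b : ℕ}
    (hb : Complex.exp (2 * Real.pi * Complex.I / m) ^ b ≠ 1) :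
    ∃ ψ : Fin n → C(unitInterval, X) → ℂ, (∀ i, IsCocycle (ψ i)) ∧
      (∀ i, S.D.IsEquivariant b (ψ i)) ∧ ∀ (c : Fin n → ℂ) (F : X → ℂ),
        (∀ γ, ∑ i, c i * ψ i γ = F (γ 1) - F (γ 0)) → ∀ i j, c i = c j := by
  choose ψ h1 h2 h3 F₁ h4 h5 h6 using S.exists_segment_cocycle hz hb
  refine ⟨ψ, h1, h2, fun c F hF => ?_⟩
  have hm := S.m_ne_zero
  set ω := Complex.exp (2 * Real.pi * Complex.I / m) with hω
  have hωm : ω ^ m = 1 := rootOfUnity_pow hm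
  obtain ⟨s₀, hs₀⟩ : ∃ s, (s : ℂ) ^ m = S.C := ⟨proot m S.C, proot_pow hm _⟩
  have hs₀0 : s₀ ≠ 0 := by
    rintro rfl
    rw [zero_pow hm] at hs₀
    exact S.C_ne_zero hs₀.symm
  set R := starRoot m 0 fun k => (z k)⁻¹ with hR
  let Φ (s : ℂ) : ℂ := F (S.c₂.pt 0 (s * R 0))
  have key (i : Fin n) : ∃ κ, ∀ s, s ^ m = S.C → κ - Φ s = c i * s ^ b := by
    have hzi := hz.ne_zero i
    have hsec : (2 : ℂ) * z i ∈ sector δ (z i) := by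
      have := smul_mem_sector hz.pos hzi (t := 2) two_pos
      simpa using this
    have hv₀ : ((2 : ℂ) * z i)⁻¹ ∈ starSet 0 fun k => (z k)⁻¹ := by
      refine hz.inv_mem_starSet hsec (Or.inl ?_)
      rw [mul_comm, ← div_div, div_self hzi]
      norm_num
    refine ⟨F (S.c₁.pt (z i) 0), fun s hs => ?_⟩
    set v₀ := ((2 : ℂ) * z i)⁻¹
    have hv₀0 : v₀ ≠ 0 := inv_ne_zero (mul_ne_zero two_ne_zero hzi)
    have hs' (x : ℂ) : (s * R x) ^ m = S.C * ∏ i, (1 - z i * x) := by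
      rw [prod_eq_star_infty, mul_pow, hs, hR, starRoot_pow hm, pow_zero, mul_one]
    set p := S.c₂.pt v₀ (s * R v₀) with hp
    have hp₂ : p ∈ S.c₂.dom := S.c₂.pt_mem (hs' v₀)
    have hpx : S.c₂.x p = v₀ := S.c₂.x_pt (hs' v₀)
    have hpE : p ∈ S.c₂.above (starSet 0 fun k => (z k)⁻¹) := ⟨hp₂, by rw [hpx]; exact hv₀⟩
    have hps : S.sheet p = s := by
      rw [CyclicCover.sheet, hpx, S.c₂.y_pt (hs' v₀), mul_div_assoc, div_self, mul_one]
      exact starRoot_ne_zero hv₀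
    have hpΦ : F p = Φ s := by
      have hv (t : unitInterval) : ((1 - t : ℝ) : ℂ) * v₀ ∈ starSet 0 fun k => (z k)⁻¹ := by
        have := starSet_line hv₀ (sub_nonneg.2 t.2.2) (sub_le_self 1 t.2.1)
        simpa using this
      obtain ⟨γ, h0, hγ⟩ := S.exists_lift_sheet
        ⟨fun t => ((1 - t : ℝ) : ℂ) * v₀, by fun_prop⟩ hv hp₂ (by rw [hpx]; simp)
      have hγE (t) : γ t ∈ S.c₂.above (starSet 0 fun k => (z k)⁻¹) :=
        ⟨(hγ t).1, by rw [(hγ t).2.1]; exact hv t⟩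
      have hFγ := hF γ
      rw [Finset.sum_eq_zero fun k _ => by
        rw [h3 k γ fun t => S.mem_offSegment_of_mem_above (hγE t)]; simp] at hFγ
      have hx1 : S.c₂.x (γ 1) = 0 := by rw [(hγ 1).2.1]; simp
      have hs1 : S.c₂.y (γ 1) = s * R 0 := by
        have := (hγ 1).2.2
        rw [hps, CyclicCover.sheet, div_eq_iff (starRoot_ne_zero (hγE 1).2), hx1] at this
        exact this
      have : γ 1 = S.c₂.pt 0 (s * R 0) := by
        rw [← hs1, ← hx1, S.c₂.pt_x_y _ (hγ 1).1]
      rw [h0, this] at hFγ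
      exact (sub_eq_zero.1 hFγ.symm).symm
    obtain ⟨hp₁, hpx₁⟩ := S.mem_dom₁ p hp₂ (by rw [hpx]; exact hv₀0)
    rw [hpx, inv_inv] at hpx₁
    set G := starRoot m (z i) (starDir z i) with hG
    set K := S.C * ∏ k, (-starDir z i k) with hK
    have hf (x : ℂ) : S.C * x * ∏ i, (x - z i) = K * (x - z i) * G x ^ m := by
      rw [prod_eq_star i (hz.starDir_ne_zero i), hG, starRoot_pow hm, pow_one]
    have hxs (t : unitInterval) : ((1 + t : ℝ) : ℂ) * z i ∈ sector δ (z i) :=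
      smul_mem_sector hz.pos hzi (by linarith [t.2.1])
    have hGc : Continuous fun t : unitInterval => G (((1 + t : ℝ) : ℂ) * z i) :=
      (continuousOn_starRoot m _ _).comp_continuous (f := fun t : unitInterval =>
        ((1 + t : ℝ) : ℂ) * z i) (by fun_prop) fun t => hz.sector_subset i (hxs t)
    have hG0 : G (2 * z i) ≠ 0 := starRoot_ne_zero (hz.sector_subset i hsec)
    have hroot : Continuous fun t : unitInterval => (((t : ℝ) ^ ((m : ℝ)⁻¹) : ℝ) : ℂ) :=
      Complex.continuous_ofReal.comp (continuous_subtype_val.rpow_const fun t =>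
        Or.inr (by positivity))
    obtain ⟨x, hx⟩ : ∃ x : C(unitInterval, ℂ), ∀ t, x t = ((1 + t : ℝ) : ℂ) * z i :=
      ⟨⟨fun t => ((1 + t : ℝ) : ℂ) * z i, by fun_prop⟩, fun _ => rfl⟩
    obtain ⟨y, hy⟩ : ∃ y : C(unitInterval, ℂ), ∀ t, y t = (((t : ℝ) ^ ((m : ℝ)⁻¹) : ℝ) : ℂ) *
        (S.c₁.y p / G (2 * z i)) * G (((1 + t : ℝ) : ℂ) * z i) :=
      ⟨⟨fun t => (((t : ℝ) ^ ((m : ℝ)⁻¹) : ℝ) : ℂ) * (S.c₁.y p / G (2 * z i)) *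
        G (((1 + t : ℝ) : ℂ) * z i), (hroot.mul continuous_const).mul hGc⟩, fun _ => rfl⟩
    have hxy (t) : y t ^ m = S.C * x t * ∏ i, (x t - z i) := by
      have hyp := S.c₁.y_pow p hp₁
      rw [hpx₁, hf] at hyp
      rw [hf, hy, hx, mul_pow, mul_pow, div_pow, hyp, ← Complex.ofReal_pow,
        Real.rpow_inv_natCast_pow t.2.1 hm]
      field_simp
      push_cast
      ring
    set γ := S.c₁.curve x y hxy with hγ
    have hγd (t) : γ t ∈ S.c₁.dom := S.c₁.pt_mem (hxy t)
    have hγx (t) : S.c₁.x (γ t) = ((1 + t : ℝ) : ℂ) * z i := (S.c₁.x_pt (hxy t)).trans (hx t)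
    have hγs (t) : γ t ∈ S.c₁.above (sector δ (z i)) :=
      ⟨hγd t, by rw [hγx]; exact hxs t⟩
    have hγ0 : γ 0 = S.c₁.pt (z i) 0 := by
      change S.c₁.pt (x 0) (y 0) = _
      rw [hx, hy, Set.Icc.coe_zero, Real.zero_rpow (by positivity)]
      simp
    have hγ1 : γ 1 = p := by
      refine S.c₁.ext_of_coord (hγd 1) hp₁ ?_ ?_
      · rw [hγx, hpx₁]
        norm_num
      · refine (S.c₁.y_pt (hxy 1)).trans ?_
        rw [hy, Set.Icc.coe_one, Real.one_rpow]
        norm_num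
        field_simp
    have hFγ := hF γ
    rw [Finset.sum_eq_single i (fun k _ hki => by
      rw [h3 k γ fun t => ?_]
      · simp
      · have hne : S.c₁.x (γ t) ≠ 0 := ne_zero_of_mem_sector (hγs t).2
        obtain ⟨d1, d2, -⟩ := S.trans _ (hγd t) hne
        refine ⟨d1, ?_⟩
        rw [d2, Set.mem_ofPred_eq]
        refine one_sub_mem_slitPlane ?_
        rw [← div_eq_mul_inv, ← inv_div, ← inv_neg]
        exact inv_mem_slitPlane (hz.neg_div_mem (Ne.symm hki) (hγs t).2)) (by simp),
      h4 i γ hγs, hγ1, hγ0, h5 i p (S.mem_offSegment_of_mem_above hpE), hps, hpΦ,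
      h6 i (S.c₁.pt (z i) 0) (by rw [← hγ0]; exact hγd 0)
        (by rw [← hγ0, hγx]; norm_num)] at hFγ
    linear_combination hFγ
  have hc (i : Fin n) : Φ s₀ - Φ (ω * s₀) = c i * ((ω ^ b - 1) * s₀ ^ b) := by
    obtain ⟨κ, hκ⟩ := key i
    have e1 := hκ s₀ hs₀
    have e2 := hκ (ω * s₀) (by rw [mul_pow, hωm, one_mul, hs₀])
    rw [mul_pow] at e2
    linear_combination e2 - e1
  intro i j
  exact mul_right_cancel₀ (mul_ne_zero (sub_ne_zero.2 hb) (pow_ne_zero b hs₀0))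
    ((hc i).symm.trans (hc j))

end Independence

section Functoriality

variable {X : Type} [TopologicalSpace X]

lemma pushforward_id : pushforward (ContinuousMap.id X) = 1 := by
  have : TopCat.ofHom (ContinuousMap.id X) = 𝟙 (TopCat.of X) := rfl
  rw [pushforward, this, CategoryTheory.Functor.map_id]
  rfl

lemma pushforward_comp (g h : C(X, X)) :
    pushforward (g.comp h) = pushforward g * pushforward h := by
  rw [pushforward, TopCat.ofHom_comp, CategoryTheory.Functor.map_comp]
  rfl

lemma eigencomponent_of_mem {H : Type*} [AddCommGroup H] [Module ℂ H] {m : ℕ} (hm : m ≠ 0)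
    {T : Module.End ℂ H} {μ : ℂ} (hμ : μ ≠ 0) {x : H} (hx : x ∈ T.eigenspace μ) :
    eigencomponent m T μ x = x := by
  rw [Module.End.mem_eigenspace_iff] at hx
  have h (k : ℕ) : (T ^ k) x = μ ^ k • x := by
    induction k with
    | zero => simp
    | succ k ih => rw [pow_succ', Module.End.mul_apply, ih, map_smul, hx, smul_smul, pow_succ]
  rw [eigencomponent, Finset.sum_congr rfl fun k _ => by
    rw [h k, smul_smul, ← mul_pow, inv_mul_cancel₀ hμ, one_pow, one_smul]]
  rw [Finset.sum_const, Finset.card_range, ← Nat.cast_smul_eq_nsmul ℂ, smul_smul,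
    inv_mul_cancel₀ (by exact_mod_cast hm), one_smul]

end Functoriality

section Deck

variable {X : Type} [TopologicalSpace X] {m n : ℕ} {z : Fin n → ℂ} (S : CyclicCover X m z)

lemma CyclicCover.act_one (h : (1 : ℂ) ^ m = 1) (q : X) : S.D.act 1 h q = q := by
  by_cases hq : q ∈ S.c₁.dom
  · obtain ⟨d1, d2, d3⟩ := S.compat₁ 1 h q hq
    exact S.c₁.ext_of_coord d1 hq d2 (d3.trans (one_mul _))
  · have hq := (S.mem_dom₂ q hq).1
    obtain ⟨d1, d2, d3⟩ := S.compat₂ 1 h q hq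
    exact S.c₂.ext_of_coord d1 hq d2 (d3.trans (one_mul _))

lemma CyclicCover.act_mul {u v : ℂ} (hu : u ^ m = 1) (hv : v ^ m = 1) (huv : (u * v) ^ m = 1)
    (q : X) : S.D.act (u * v) huv q = S.D.act u hu (S.D.act v hv q) := by
  by_cases hq : q ∈ S.c₁.dom
  · obtain ⟨d1, d2, d3⟩ := S.compat₁ _ huv q hq
    obtain ⟨e1, e2, e3⟩ := S.compat₁ _ hv q hq
    obtain ⟨f1, f2, f3⟩ := S.compat₁ _ hu _ e1
    exact S.c₁.ext_of_coord d1 f1 (by rw [d2, f2, e2]) (by rw [d3, f3, e3, mul_assoc])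
  · have hq := (S.mem_dom₂ q hq).1
    obtain ⟨d1, d2, d3⟩ := S.compat₂ _ huv q hq
    obtain ⟨e1, e2, e3⟩ := S.compat₂ _ hv q hq
    obtain ⟨f1, f2, f3⟩ := S.compat₂ _ hu _ e1
    exact S.c₂.ext_of_coord d1 f1 (by rw [d2, f2, e2]) (by rw [d3, f3, e3, mul_assoc])

variable {ζ : ℂ} (hζ : ζ ^ m = 1)

lemma pow_pow_eq_one (hζ : ζ ^ m = 1) (k : ℕ) : (ζ ^ k) ^ m = 1 := by
  rw [← pow_mul, mul_comm, pow_mul, hζ, one_pow]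

lemma CyclicCover.pushforward_pow (k : ℕ) : pushforward (S.D.act ζ hζ) ^ k =
    pushforward (S.D.act (ζ ^ k) (pow_pow_eq_one hζ k)) := by
  induction k with
  | zero =>
    rw [pow_zero, ← pushforward_id]
    congr 1
    ext q
    exact (S.act_one (one_pow m) q).symm
  | succ k ih =>
    rw [pow_succ', ih, ← pushforward_comp]
    congr 1
    ext q
    have hk := pow_pow_eq_one hζ k
    have h := S.act_mul hζ hk (by rw [mul_pow, hζ, hk, one_mul]) q
    simp only [← pow_succ'] at h
    exact h.symm

lemma CyclicCover.pushforward_pow_eq_one : pushforward (S.D.act ζ hζ) ^ m = 1 := by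
  rw [S.pushforward_pow, ← pushforward_id]
  congr 1
  ext q
  simp only [hζ]
  exact S.act_one (one_pow m) q

/-- The action of a deck transformation on cochains. -/
def CyclicCover.pullback : Module.End ℂ (C(unitInterval, X) → ℂ) :=
  LinearMap.funLeft ℂ ℂ fun γ => (S.D.act ζ hζ).comp γ

lemma CyclicCover.pullback_pow (k : ℕ) (ψ : C(unitInterval, X) → ℂ) (γ : C(unitInterval, X)) :
    (S.pullback hζ ^ k) ψ γ = ψ ((S.D.act (ζ ^ k) (pow_pow_eq_one hζ k)).comp γ) := by
  induction k generalizing γ with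
  | zero =>
    rw [pow_zero, Module.End.one_apply]
    congr 1
    ext t
    exact (S.act_one (one_pow m) _).symm
  | succ k ih =>
    rw [pow_succ', Module.End.mul_apply]
    refine (ih ((S.D.act ζ hζ).comp γ)).trans ?_
    congr 1
    ext t
    have hk := pow_pow_eq_one hζ k
    have h := S.act_mul hk hζ (by rw [mul_pow, hζ, hk, one_mul]) (γ t)
    simp only [← pow_succ] at h
    exact h.symm

lemma CyclicCover.pullback_pow_eq_one : S.pullback hζ ^ m = 1 := by
  refine LinearMap.ext fun ψ => funext fun γ => ?_
  rw [S.pullback_pow, Module.End.one_apply]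
  congr 1
  ext t
  simp only [hζ]
  exact S.act_one (one_pow m) _

/-- The projection of cocycles to a given weight. -/
lemma CyclicCover.exists_isEquivariant (hζ : IsPrimitiveRoot ζ m) (b : ℕ)
    (φ : Module.Dual ℂ (H1 X)) :
    ∃ ψ : C(unitInterval, X) → ℂ, IsCocycle ψ ∧ S.D.IsEquivariant b ψ ∧
      ∀ (a : X) (c : Path a a), φ (eigencomponent m (pushforward (S.D.act ζ hζ.pow_eq_one)) (ζ ^ b)
        (loopClass c)) = ψ c.toContinuousMap := by
  have hm := S.m_ne_zero
  have : NeZero m := ⟨hm⟩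
  have hζm := hζ.pow_eq_one
  have hμ : (ζ ^ b) ^ m = 1 := pow_pow_eq_one hζm b
  obtain ⟨ψ, hψ, hφ⟩ := exists_isCocycle φ
  refine ⟨eigencomponent m (S.pullback hζm) (ζ ^ b) ψ, ?_, ?_, fun a c => ?_⟩
  · refine IsCocycle.smul (IsCocycle.sum _ fun k _ => IsCocycle.smul ?_ _) _
    have := hψ.comp (S.D.act (ζ ^ k) (pow_pow_eq_one hζm k))
    convert this using 1
    exact funext fun γ => S.pullback_pow hζm k ψ γ
  · have h1 := eigencomponent_mem (S.pullback_pow_eq_one hζm) hμ (Nat.pos_of_ne_zero hm) ψ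
    set Ψ := eigencomponent m (S.pullback hζm) (ζ ^ b) ψ
    rw [Module.End.mem_eigenspace_iff] at h1
    have h2 (k : ℕ) : (S.pullback hζm ^ k) Ψ = (ζ ^ b) ^ k • Ψ := by
      induction k with
      | zero => simp
      | succ k ih => rw [pow_succ', Module.End.mul_apply, ih, map_smul, h1, smul_smul, pow_succ]
    intro u hu γ
    obtain ⟨k, -, rfl⟩ := hζ.eq_pow_of_pow_eq_one hu
    rw [← S.pullback_pow hζm k Ψ γ, h2, Pi.smul_apply, smul_eq_mul, ← pow_mul, ← pow_mul,
      mul_comm b k]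
  · simp only [eigencomponent, map_smul, map_sum, Pi.smul_apply, Finset.sum_apply, S.pullback_pow,
      S.pushforward_pow, pushforward_loopClass, hφ]
    rfl

end Deck

section Eigenspace

variable {X : Type} [TopologicalSpace X] {m n : ℕ} {z : Fin n → ℂ} (S : CyclicCover X m z) {δ : ℝ}

/-- The eigencomponents of the loops around all but one of the branch points form a basis of the
eigenspace. -/
theorem CyclicCover.basis_eigenspace (hz : Separated z δ) {ζ : ℂ} (hζ : IsPrimitiveRoot ζ m)
    {b : ℕ} (hb : Complex.exp (2 * Real.pi * Complex.I / m) ^ b ≠ 1)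
    {r : Fin n → ℝ} (hr : ∀ i, 0 < r i) (hr1 : ∀ i, r i < 1)
    (hrz : ∀ i k, k ≠ i → r i * ‖z i‖ < ‖z k - z i‖) {q₀ : X} (η : Fin n → Path q₀ q₀)
    (hη : ∀ i t, η i t ∈ S.c₁.dom ∧ S.c₁.x (η i t) = lasso (z i) (r i) t)
    {T : Module.End ℂ (H1 X)} (hT : T = pushforward (S.D.act ζ hζ.pow_eq_one)) (j : Fin n) :
    LinearIndependent ℂ (fun i : {i : Fin n // i ≠ j} =>
      eigencomponent m T (ζ ^ b) (loopClass (η i))) ∧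
    Submodule.span ℂ (Set.range fun i : {i : Fin n // i ≠ j} =>
      eigencomponent m T (ζ ^ b) (loopClass (η i))) = T.eigenspace (ζ ^ b) := by
  have hm := S.m_ne_zero
  have hζm := hζ.pow_eq_one
  have hTm : T ^ m = 1 := hT ▸ S.pushforward_pow_eq_one hζm
  have hμ : (ζ ^ b) ^ m = 1 := pow_pow_eq_one hζm b
  have hμ0 : ζ ^ b ≠ 0 := pow_ne_zero _ (hζ.ne_zero hm)
  set μ := ζ ^ b with hμdef
  set E := T.eigenspace μ
  have hmem (x : H1 X) : eigencomponent m T μ x ∈ E :=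
    eigencomponent_mem hTm hμ (Nat.pos_of_ne_zero hm) x
  set s : {i : Fin n // i ≠ j} → H1 X := fun i => eigencomponent m T μ (loopClass (η i)) with hs
  have hspan : Submodule.span ℂ (Set.range s) = E := by
    refine le_antisymm (Submodule.span_le.2 ?_) fun x hx => ?_
    · rintro _ ⟨i, rfl⟩
      exact hmem _
    · by_contra hxs
      obtain ⟨φ, hφx, hφ⟩ := Submodule.exists_le_ker_of_notMem hxs
      obtain ⟨ψ, hψ, hψD, hψφ⟩ := S.exists_isEquivariant hζ b φ
      rw [← hT] at hψφ
      obtain ⟨F, hF⟩ := S.exists_primitive hz hb j hψ hψD hr hr1 hrz η hη fun i hij => by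
        rw [← hψφ]
        exact hφ (Submodule.subset_span ⟨⟨i, hij⟩, rfl⟩)
      let P : Module.End ℂ (H1 X) := (m : ℂ)⁻¹ • ∑ k ∈ Finset.range m, μ⁻¹ ^ k • T ^ k
      have hP (x) : P x = eigencomponent m T μ x := by
        simp [P, eigencomponent]
      have h0 : φ ∘ₗ P = 0 := dual_eq_zero _ fun a c => by
        rw [LinearMap.comp_apply, hP, hψφ, hF]
        change F (c 1) - F (c 0) = 0
        rw [c.target, c.source, sub_self]
      apply hφx
      have := LinearMap.congr_fun h0 x
      rwa [LinearMap.comp_apply, hP, eigencomponent_of_mem hm hμ0 hx] at this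
  refine ⟨?_, hspan⟩
  obtain ⟨ψ, hψ, hψD, hind⟩ := S.exists_cocycles hz hb
  choose φ hφ using fun i => (hψ i).exists_dual
  have hφT (i) : φ i ∘ₗ T = μ • φ i := by
    rw [← sub_eq_zero]
    refine dual_eq_zero _ fun a c => ?_
    rw [LinearMap.sub_apply, LinearMap.comp_apply, LinearMap.smul_apply, hT, pushforward_loopClass,
      hφ, hφ, smul_eq_mul, hμdef, ← hψD i ζ hζm, sub_eq_zero]
    rfl
  have hφk (i) (k : ℕ) (x) : φ i ((T ^ k) x) = μ ^ k * φ i x := by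
    induction k with
    | zero => simp
    | succ k ih =>
      have := LinearMap.congr_fun (hφT i) ((T ^ k) x)
      rw [LinearMap.comp_apply, LinearMap.smul_apply, smul_eq_mul, ih] at this
      rw [pow_succ', Module.End.mul_apply, this]
      ring
  have hφe (i x) : φ i (eigencomponent m T μ x) = φ i x := by
    simp only [eigencomponent, map_smul, map_sum, hφk, smul_eq_mul]
    rw [Finset.sum_congr rfl fun k _ => by
      rw [← mul_assoc, ← mul_pow, inv_mul_cancel₀ hμ0, one_pow, one_mul]]
    rw [Finset.sum_const, Finset.card_range, nsmul_eq_mul, ← mul_assoc,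
      inv_mul_cancel₀ (by exact_mod_cast hm), one_mul]
  have hfin : FiniteDimensional ℂ E := by
    rw [← hspan]
    exact FiniteDimensional.span_of_finite ℂ (Set.finite_range s)
  have hli : LinearIndependent ℂ fun i : {i : Fin n // i ≠ j} =>
      (φ i ∘ₗ E.subtype : Module.Dual ℂ E) := by
    rw [Fintype.linearIndependent_iff]
    intro c hc
    let c' (i : Fin n) : ℂ := if h : i ≠ j then c ⟨i, h⟩ else 0
    have hsum (g : Fin n → ℂ) : ∑ i, c' i * g i = ∑ i : {i : Fin n // i ≠ j}, c i * g i := by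
      rw [Fintype.sum_eq_add_sum_subtype_ne _ j]
      have h0 : c' j = 0 := dif_neg (not_not.2 rfl)
      rw [h0, zero_mul, zero_add]
      exact Finset.sum_congr rfl fun i _ => by rw [show c' i = c i from dif_pos i.2]
    have hzero (a : X) (l : Path a a) : ∑ i, c' i * ψ i l.toContinuousMap = 0 := by
      have h1 := LinearMap.congr_fun hc ⟨_, hmem (loopClass l)⟩
      simp only [LinearMap.sum_apply, LinearMap.smul_apply, LinearMap.comp_apply,
        Submodule.subtype_apply, hφe, hφ, smul_eq_mul, LinearMap.zero_apply] at h1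
      rw [hsum fun i => ψ i l.toContinuousMap, h1]
    have hcoc : IsCocycle (∑ i, c' i • ψ i) := IsCocycle.sum _ fun i _ => (hψ i).smul _
    obtain ⟨F, hF⟩ := hcoc.exists_primitive fun a l => by
      simpa [Finset.sum_apply] using hzero a l
    have hcc := hind c' F fun γ => by
      rw [← hF γ]
      simp [Finset.sum_apply]
    intro i
    have := hcc i j
    simpa [c', i.2] using this
  rw [linearIndependent_iff_card_le_finrank_span]
  have h1 := hli.fintype_card_le_finrank
  rw [Subspace.dual_finrank_eq] at h1
  rwa [Set.finrank, hspan]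

end Eigenspace

section Relation

/-- Vectors such that all but one, however chosen, form a basis. -/
lemma exists_relation {H : Type*} [AddCommGroup H] [Module ℂ H] {n : ℕ} (hn : 0 < n)
    {s : Fin n → H} {E : Submodule ℂ H} (hs : ∀ i, s i ∈ E)
    (hli : ∀ j, LinearIndependent ℂ fun i : {i : Fin n // i ≠ j} => s i)
    (hsp : ∀ j, Submodule.span ℂ (Set.range fun i : {i : Fin n // i ≠ j} => s i) = E) :
    Submodule.span ℂ (Set.range s) = E ∧
    ∃ α : Fin n → ℂ, (∀ i, α i ≠ 0) ∧ ∑ i, α i • s i = 0 ∧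
      (∀ β : Fin n → ℂ, ∑ i, β i • s i = 0 → ∃ c : ℂ, β = c • α) ∧
      ∃ φ : ((Fin n → ℂ) ⧸ Submodule.span ℂ {α}) ≃ₗ[ℂ] E,
        ∀ i, (φ (Submodule.Quotient.mk (Pi.single i 1)) : H) = s i := by
  have hspan : Submodule.span ℂ (Set.range s) = E := by
    refine le_antisymm (Submodule.span_le.2 ?_) ?_
    · rintro _ ⟨i, rfl⟩
      exact hs i
    · rw [← hsp ⟨0, hn⟩]
      refine Submodule.span_mono ?_
      rintro _ ⟨i, rfl⟩
      exact ⟨i, rfl⟩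
  have hsub (f : Fin n → H) (j : Fin n) :
      ∑ i, f i = f j + ∑ i : {i : Fin n // i ≠ j}, f i := by
    rw [Fintype.sum_eq_add_sum_subtype_ne f j]
  have hrel (j : Fin n) (β : Fin n → ℂ) (hβ : ∑ i, β i • s i = 0) (hj : β j = 0) : β = 0 := by
    rw [hsub _ j, hj, zero_smul, zero_add] at hβ
    have := Fintype.linearIndependent_iff.1 (hli j) (fun i => β i) hβ
    funext i
    by_cases hij : i = j
    · rw [hij, hj, Pi.zero_apply]
    · exact this ⟨i, hij⟩
  obtain ⟨α, hα, hα0⟩ : ∃ α : Fin n → ℂ, ∑ i, α i • s i = 0 ∧ α ≠ 0 := by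
    have h0 : s ⟨0, hn⟩ ∈ Submodule.span ℂ
        (Set.range fun i : {i : Fin n // i ≠ ⟨0, hn⟩} => s i) := by
      rw [hsp]
      exact hs _
    obtain ⟨c, hc⟩ := (Submodule.mem_span_range_iff_exists_fun ℂ).1 h0
    refine ⟨fun i => if h : i ≠ ⟨0, hn⟩ then -c ⟨i, h⟩ else 1, ?_, fun h => ?_⟩
    · rw [hsub _ ⟨0, hn⟩]
      beta_reduce
      rw [dif_neg (not_not.2 rfl), one_smul,
        Finset.sum_congr rfl fun (i : {i : Fin n // i ≠ ⟨0, hn⟩}) _ => by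
          rw [dif_pos i.2, neg_smul]]
      rw [Finset.sum_neg_distrib, hc, add_neg_cancel]
    · simpa using congrFun h ⟨0, hn⟩
  have hαi (i) : α i ≠ 0 := fun h => hα0 (hrel i α hα h)
  have huniq (β : Fin n → ℂ) (hβ : ∑ i, β i • s i = 0) : ∃ c : ℂ, β = c • α := by
    refine ⟨β ⟨0, hn⟩ / α ⟨0, hn⟩, sub_eq_zero.1 (hrel ⟨0, hn⟩ _ ?_ ?_)⟩
    · simp only [Pi.sub_apply, Pi.smul_apply, sub_smul, Finset.sum_sub_distrib, hβ, smul_assoc,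
        ← Finset.smul_sum, hα, smul_zero, sub_zero]
    · simp [div_mul_cancel₀ _ (hαi ⟨0, hn⟩)]
  refine ⟨hspan, α, hαi, hα, huniq, ?_⟩
  let L : (Fin n → ℂ) →ₗ[ℂ] E := (Fintype.linearCombination ℂ s).codRestrict E fun β => by
    rw [Fintype.linearCombination_apply]
    exact E.sum_mem fun i _ => E.smul_mem _ (hs i)
  have hL (β) : (L β : H) = ∑ i, β i • s i := Fintype.linearCombination_apply ℂ s β
  have hker : LinearMap.ker L = Submodule.span ℂ {α} := by
    ext β
    rw [LinearMap.mem_ker, Submodule.mem_span_singleton, ← Submodule.coe_eq_zero, hL]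
    refine ⟨fun h => ?_, ?_⟩
    · obtain ⟨c, hc⟩ := huniq β h
      exact ⟨c, hc.symm⟩
    · rintro ⟨c, rfl⟩
      simp only [Pi.smul_apply, smul_assoc, ← Finset.smul_sum, hα, smul_zero]
  have hsurj : Function.Surjective L := by
    rintro ⟨x, hx⟩
    rw [← hspan] at hx
    obtain ⟨c, hc⟩ := (Submodule.mem_span_range_iff_exists_fun ℂ).1 hx
    exact ⟨c, Subtype.ext ((hL c).trans hc)⟩
  refine ⟨(Submodule.quotEquivOfEq _ _ hker.symm).trans (L.quotKerEquivOfSurjective hsurj),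
    fun i => ?_⟩
  change (L (Pi.single i 1) : H) = s i
  rw [hL]
  simp [Pi.single_apply]

end Relation

section Charts

open Topology

variable {d : ℕ} {ℓ : Fin d → Module.Dual ℂ (Fin 3 → ℂ)} {W : Submodule ℂ (Fin 3 → ℂ)} {m : ℕ}

/-- The point with given weighted homogeneous coordinates. -/
def Cover.mk (a : CoverCone ℓ W m) : Cover ℓ W m := Quotient.mk (coverSetoid ℓ W m) a

lemma Cover.isQuotientMap_mk : IsQuotientMap (Cover.mk (ℓ := ℓ) (W := W) (m := m)) :=
  isQuotientMap_quotient_mk' (s := coverSetoid ℓ W m)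

lemma Cover.exists_mk (q : Cover ℓ W m) : ∃ a, q = Cover.mk a := by
  obtain ⟨a, ha⟩ := Quotient.exists_rep q
  exact ⟨a, ha.symm⟩

lemma Cover.mk_eq {a a' : CoverCone ℓ W m} {t : ℂ} (ht : t ≠ 0) (h₁ : a'.1.1 = t • a.1.1)
    (h₂ : a'.1.2 = t ^ (d / m) * a.1.2) : Cover.mk a = Cover.mk a' :=
  Quotient.sound (s := coverSetoid ℓ W m) ⟨Units.mk0 t ht, h₁, h₂⟩

variable (b : Module.Basis (Fin 2) ℂ W)

/-- The locus where the `i`-th coordinate does not vanish. -/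
def coverDom (i : Fin 2) : Set (Cover ℓ W m) :=
  Quotient.lift (fun a : CoverCone ℓ W m => b.repr a.1.1 i ≠ 0) (by
    rintro a a' ⟨t, h1, -⟩
    simp [h1])

/-- The quotient of the `j`-th by the `i`-th coordinate. -/
def coverX (i j : Fin 2) : Cover ℓ W m → ℂ :=
  Quotient.lift (fun a : CoverCone ℓ W m => b.repr a.1.1 j / b.repr a.1.1 i) (by
    rintro a a' ⟨t, h1, -⟩
    simp [h1, mul_div_mul_left])

/-- The fibre coordinate of the `i`-th chart. -/
def coverY (i : Fin 2) : Cover ℓ W m → ℂ :=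
  Quotient.lift (fun a : CoverCone ℓ W m => a.1.2 / b.repr a.1.1 i ^ (d / m)) (by
    rintro a a' ⟨t, h1, h2⟩
    simp [h1, h2, mul_pow, mul_div_mul_left])

variable {b}

lemma mk_mem_coverDom {i : Fin 2} {a : CoverCone ℓ W m} :
    Cover.mk a ∈ coverDom b i ↔ b.repr a.1.1 i ≠ 0 := Iff.rfl

lemma coverX_mk {i j : Fin 2} {a : CoverCone ℓ W m} :
    coverX b i j (Cover.mk a) = b.repr a.1.1 j / b.repr a.1.1 i := rfl

lemma coverY_mk {i : Fin 2} {a : CoverCone ℓ W m} :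
    coverY b i (Cover.mk a) = a.1.2 / b.repr a.1.1 i ^ (d / m) := rfl

lemma continuous_repr (i : Fin 2) :
    Continuous fun a : CoverCone ℓ W m => b.repr a.1.1 i := by
  have h : Continuous (b.coord i) := LinearMap.continuous_of_finiteDimensional _
  exact h.comp (continuous_fst.comp continuous_subtype_val)

lemma isOpen_coverDom (i : Fin 2) : IsOpen (coverDom b i : Set (Cover ℓ W m)) := by
  rw [← Cover.isQuotientMap_mk.isOpen_preimage]
  exact isOpen_ne_fun (continuous_repr i) continuous_const

variable (b)

/-- The point in the `i`-th chart with coordinates `x`, `y`. -/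
def coverCone (i j : Fin 2) (hij : i ≠ j) (x y : ℂ)
    (h : y ^ m = ∏ k, ℓ k (b i + x • b j : W)) : CoverCone ℓ W m :=
  ⟨(b i + x • b j, y), fun h0 => by
    have := congrArg (fun w => b.repr w i) h0
    simp [hij.symm] at this, h⟩

lemma eq_smul_of_repr_ne_zero {i j : Fin 2} (hij : i ≠ j) {a : CoverCone ℓ W m}
    (ha : b.repr a.1.1 i ≠ 0) :
    a.1.1 = b.repr a.1.1 i • (b i + coverX b i j (Cover.mk a) • b j) := by
  rw [coverX_mk, smul_add, smul_smul, mul_div_cancel₀ _ ha]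
  conv_lhs => rw [← b.sum_repr a.1.1]
  rw [Fin.sum_univ_two]
  fin_cases i <;> fin_cases j
  · exact absurd rfl hij
  · rfl
  · exact add_comm _ _
  · exact absurd rfl hij

lemma coverY_pow (hmd : m ∣ d) {i j : Fin 2} (hij : i ≠ j) {a : CoverCone ℓ W m}
    (ha : b.repr a.1.1 i ≠ 0) :
    coverY b i (Cover.mk a) ^ m = ∏ k, ℓ k (b i + coverX b i j (Cover.mk a) • b j : W) := by
  have h1 : ∏ k, ℓ k a.1.1 = b.repr a.1.1 i ^ d *
      ∏ k, ℓ k (b i + coverX b i j (Cover.mk a) • b j : W) := by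
    conv_lhs => rw [eq_smul_of_repr_ne_zero b hij ha]
    simp only [Submodule.coe_smul, map_smul, smul_eq_mul, Finset.prod_mul_distrib,
      Finset.prod_const, Finset.card_univ, Fintype.card_fin]
  rw [coverY_mk, div_pow, a.2.2, ← pow_mul, Nat.div_mul_cancel hmd, h1,
    mul_div_cancel_left₀ _ (pow_ne_zero _ ha)]

open Classical in
/-- The affine chart of the cyclic cover where the `i`-th coordinate does not vanish. -/
def coverChart (hmd : m ∣ d) (q₀ : Cover ℓ W m) (i j : Fin 2) (hij : i ≠ j) (f : ℂ → ℂ)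
    (hf : ∀ x, f x = ∏ k, ℓ k (b i + x • b j : W)) : PlaneChart (Cover ℓ W m) m f where
  dom := coverDom b i
  x := coverX b i j
  y := coverY b i
  pt x y := if h : y ^ m = ∏ k, ℓ k (b i + x • b j : W) then Cover.mk (coverCone b i j hij x y h)
    else q₀
  isOpen_dom := isOpen_coverDom i
  continuousOn_x := by
    rw [Cover.isQuotientMap_mk.continuousOn_isOpen_iff (isOpen_coverDom i)]
    exact (continuous_repr j).continuousOn.div (continuous_repr i).continuousOn fun a ha => ha
  continuousOn_y := by
    rw [Cover.isQuotientMap_mk.continuousOn_isOpen_iff (isOpen_coverDom i)]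
    exact (continuous_snd.comp continuous_subtype_val).continuousOn.div
      ((continuous_repr i).pow _).continuousOn fun a ha => pow_ne_zero _ ha
  y_pow q hq := by
    obtain ⟨a, rfl⟩ := q.exists_mk
    rw [mk_mem_coverDom] at hq
    rw [hf, coverY_pow b hmd hij hq]
  continuousOn_pt := by
    rw [continuousOn_iff_continuous_domRestrict]
    have : Continuous fun p : {p | (p : ℂ × ℂ).2 ^ m = f p.1} =>
        coverCone (ℓ := ℓ) (m := m) b i j hij p.1.1 p.1.2 (p.2.trans (hf _)) :=
      Continuous.subtype_mk (by fun_prop) _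
    convert Cover.isQuotientMap_mk.continuous.comp this using 1
    funext p
    exact dif_pos (p.2.trans (hf _))
  pt_mem {x y} h := by
    rw [hf] at h
    rw [dif_pos h, mk_mem_coverDom]
    simp [coverCone, hij.symm]
  x_pt {x y} h := by
    rw [hf] at h
    rw [dif_pos h, coverX_mk]
    simp [coverCone, hij, hij.symm]
  y_pt {x y} h := by
    rw [hf] at h
    rw [dif_pos h, coverY_mk]
    simp [coverCone, hij.symm]
  pt_x_y q hq := by
    obtain ⟨a, rfl⟩ := q.exists_mk
    rw [mk_mem_coverDom] at hq
    rw [dif_pos (coverY_pow b hmd hij hq)]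
    refine Cover.mk_eq hq (eq_smul_of_repr_ne_zero b hij hq) ?_
    change a.1.2 = _ * (a.1.2 / _)
    rw [mul_div_cancel₀ _ (pow_ne_zero _ hq)]

/-- The deck transformations of the cyclic cover. -/
def coverDeck : DeckAction (Cover ℓ W m) m := ⟨deck ℓ W m⟩

lemma coverChart_compatible (hmd : m ∣ d) (q₀ : Cover ℓ W m) (i j : Fin 2) (hij : i ≠ j)
    (f : ℂ → ℂ) (hf : ∀ x, f x = ∏ k, ℓ k (b i + x • b j : W)) :
    (coverChart b hmd q₀ i j hij f hf).Compatible coverDeck := by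
  intro u hu q hq
  obtain ⟨a, rfl⟩ := q.exists_mk
  refine ⟨hq, rfl, ?_⟩
  exact mul_div_assoc u a.1.2 _

lemma prod_affine {n : ℕ} {ℓ : Fin (n + 1) → Module.Dual ℂ (Fin 3 → ℂ)}
    (hP : ℓ (Fin.last n) (b 0) = 0) {z : Fin n → ℂ}
    (hz : ∀ i, ℓ i.castSucc (b 0 + z i • b 1 : W) = 0) (x : ℂ) :
    (∏ k, ℓ k (b 1)) * x * ∏ i, (x - z i) = ∏ k, ℓ k (b 0 + x • b 1 : W) := by
  have h (i : Fin n) : ℓ i.castSucc (b 0 + x • b 1 : W) = ℓ i.castSucc (b 1) * (x - z i) := by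
    have := hz i
    simp only [Submodule.coe_add, Submodule.coe_smul, map_add, map_smul, smul_eq_mul] at this ⊢
    linear_combination this
  rw [Fin.prod_univ_castSucc, Fin.prod_univ_castSucc (n := n) (f := fun k =>
    ℓ k (b 0 + x • b 1 : W)), Finset.prod_congr rfl fun i _ => h i, Finset.prod_mul_distrib]
  simp only [Submodule.coe_add, Submodule.coe_smul, map_add, map_smul, smul_eq_mul, hP]
  ring

lemma prod_affine_infty {n : ℕ} {ℓ : Fin (n + 1) → Module.Dual ℂ (Fin 3 → ℂ)}
    (hP : ℓ (Fin.last n) (b 0) = 0) {z : Fin n → ℂ}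
    (hz : ∀ i, ℓ i.castSucc (b 0 + z i • b 1 : W) = 0) (v : ℂ) :
    (∏ k, ℓ k (b 1)) * ∏ i, (1 - z i * v) = ∏ k, ℓ k (b 1 + v • b 0 : W) := by
  have h (i : Fin n) : ℓ i.castSucc (b 1 + v • b 0 : W) = ℓ i.castSucc (b 1) * (1 - z i * v) := by
    have := hz i
    simp only [Submodule.coe_add, Submodule.coe_smul, map_add, map_smul, smul_eq_mul] at this ⊢
    linear_combination v * this
  rw [Fin.prod_univ_castSucc, Fin.prod_univ_castSucc (n := n) (f := fun k =>
    ℓ k (b 1 + v • b 0 : W)), Finset.prod_congr rfl fun i _ => h i, Finset.prod_mul_distrib]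
  simp only [Submodule.coe_add, Submodule.coe_smul, map_add, map_smul, smul_eq_mul, hP]
  ring

/-- The cyclic cover of a line, branched at the origin and the points `z i`. -/
def coverCyclicCover {n : ℕ} {ℓ : Fin (n + 1) → Module.Dual ℂ (Fin 3 → ℂ)} (hm : m ≠ 0)
    (hmd : m ∣ n + 1) (q₀ : Cover ℓ W m) (hP : ℓ (Fin.last n) (b 0) = 0)
    (hinf : ∀ i, ℓ i (b 1) ≠ 0) {z : Fin n → ℂ}
    (hz : ∀ i, ℓ i.castSucc (b 0 + z i • b 1 : W) = 0) : CyclicCover (Cover ℓ W m) m z where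
  D := coverDeck
  C := ∏ k, ℓ k (b 1)
  e := (n + 1) / m
  c₁ := coverChart b hmd q₀ 0 1 (by decide) _ (prod_affine b hP hz)
  c₂ := coverChart b hmd q₀ 1 0 (by decide) _ (prod_affine_infty b hP hz)
  C_ne_zero := Finset.prod_ne_zero_iff.2 fun k _ => hinf k
  m_ne_zero := hm
  e_mul := Nat.div_mul_cancel hmd
  compat₁ := coverChart_compatible b hmd q₀ 0 1 _ _ _
  compat₂ := coverChart_compatible b hmd q₀ 1 0 _ _ _
  mem_dom₂ q hq := by
    obtain ⟨a, rfl⟩ := q.exists_mk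
    have h0 : b.repr a.1.1 0 = 0 := not_not.1 hq
    refine ⟨fun h1 => a.2.1 ?_, ?_⟩
    · rw [← b.sum_repr a.1.1, Fin.sum_univ_two, h0, h1, zero_smul, zero_smul, add_zero]
    · change b.repr a.1.1 0 / _ = 0
      rw [h0, zero_div]
  notMem_dom₁ q hq hx := by
    obtain ⟨a, rfl⟩ := q.exists_mk
    exact fun h0 => div_ne_zero h0 hq hx
  mem_dom₁ q hq hx := by
    obtain ⟨a, rfl⟩ := q.exists_mk
    exact ⟨(div_ne_zero_iff.1 hx).1, (inv_div (b.repr a.1.1 0) (b.repr a.1.1 1)).symm⟩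
  trans q hq hx := by
    obtain ⟨a, rfl⟩ := q.exists_mk
    have h0 : b.repr a.1.1 0 ≠ 0 := hq
    have h1 : b.repr a.1.1 1 ≠ 0 := (div_ne_zero_iff.1 hx).1
    refine ⟨h1, (inv_div (b.repr a.1.1 1) (b.repr a.1.1 0)).symm, ?_⟩
    change a.1.2 / b.repr a.1.1 1 ^ ((n + 1) / m) = a.1.2 / b.repr a.1.1 0 ^ ((n + 1) / m) /
      (b.repr a.1.1 1 / b.repr a.1.1 0) ^ ((n + 1) / m)
    rw [div_pow, div_div, mul_div_cancel₀ _ (pow_ne_zero _ h0)]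

variable {b}

lemma mem_coverDom_of_proj_eq {q : Cover ℓ W m} {x : ℂ} (h : proj ℓ W m q = affinePoint b x) :
    q ∈ coverDom b 0 ∧ coverX b 0 1 q = x := by
  obtain ⟨a, rfl⟩ := q.exists_mk
  obtain ⟨c, hc⟩ := (Projectivization.mk_eq_mk_iff' ℂ _ _ _ _).1 h
  have h0 : b.repr a.1.1 0 = c := by
    rw [← hc]
    simp
  have h1 : b.repr a.1.1 1 = c * x := by
    rw [← hc]
    simp
  have hc0 : c ≠ 0 := by
    rintro rfl
    rw [zero_smul] at hc
    exact a.2.1 hc.symm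
  refine ⟨?_, ?_⟩
  · rw [mk_mem_coverDom, h0]
    exact hc0
  · rw [coverX_mk, h0, h1, mul_div_cancel_left₀ _ hc0]

end Charts

lemma exists_separated_of_segment {n : ℕ} {z : Fin n → ℂ} (hz : ∀ i, z i ≠ 0)
    (hseg : ∀ i j, i ≠ j → segment ℝ 0 (z i) ∩ segment ℝ 0 (z j) = {0}) :
    ∃ δ, Separated z δ := by
  refine exists_separated hz fun i k hik => ?_
  by_contra hn
  obtain ⟨h1, h2⟩ := notMem_slitPlane hn
  rw [Complex.neg_re] at h1
  rw [Complex.neg_im, neg_eq_zero] at h2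
  set s := (z k / z i).re with hs
  have hzs : z k / z i = s := Complex.ext rfl (by rw [h2, Complex.ofReal_im])
  have hzk : z k = s • z i := by
    rw [Complex.real_smul, ← hzs, div_mul_cancel₀ _ (hz i)]
  have hs0 : 0 ≤ s := by linarith
  have hmem {t : ℝ} (h0 : 0 ≤ t) (h1 : t ≤ 1) (w : ℂ) : t • w ∈ segment ℝ 0 w :=
    ⟨1 - t, t, sub_nonneg.2 h1, h0, by ring, by simp⟩
  rcases le_total s 1 with h | h
  · have : z k ∈ segment ℝ 0 (z i) ∩ segment ℝ 0 (z k) :=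
      ⟨hzk ▸ hmem hs0 h (z i), right_mem_segment ℝ _ _⟩
    rw [hseg i k hik] at this
    exact hz k this
  · have hzi : z i = s⁻¹ • z k := by
      rw [hzk, smul_smul, inv_mul_cancel₀ (by linarith), one_smul]
    have : z i ∈ segment ℝ 0 (z i) ∩ segment ℝ 0 (z k) := by
      refine ⟨right_mem_segment ℝ _ _, ?_⟩
      have := hmem (inv_nonneg.2 hs0) (inv_le_one_of_one_le₀ h) (z k)
      rwa [← hzi] at this
    rw [hseg i k hik] at this
    exact hz i this

/-- The inverse of the standard root of unity is a power of `ζ`, of nontrivial weight. -/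
lemma exists_pow_eq_inv_rootOfUnity {m : ℕ} (hm : 2 ≤ m) {ζ : ℂ} (hζ : IsPrimitiveRoot ζ m) :
    ∃ b : ℕ, ζ ^ b = (Complex.exp (2 * Real.pi * Complex.I / m))⁻¹ ∧
      Complex.exp (2 * Real.pi * Complex.I / m) ^ b ≠ 1 := by
  have hm0 : m ≠ 0 := by omega
  have : NeZero m := ⟨hm0⟩
  have hω := Complex.isPrimitiveRoot_exp m hm0
  obtain ⟨b, -, hb⟩ := hζ.eq_pow_of_pow_eq_one hω.inv.pow_eq_one
  obtain ⟨a, -, ha⟩ := hζ.eq_pow_of_pow_eq_one hω.pow_eq_one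
  refine ⟨b, hb, fun h => ?_⟩
  have h1 : (Complex.exp (2 * Real.pi * Complex.I / m))⁻¹ ^ a = 1 := by
    rw [← hb, ← pow_mul, mul_comm, pow_mul, ha, h]
  obtain ⟨c, rfl⟩ := hω.inv.dvd_of_pow_eq_one a h1
  rw [pow_mul, hζ.pow_eq_one, one_pow] at ha
  exact hω.ne_one (by omega) ha.symm

end LineCover

end

open LineCover in
theorem proposition2p1
    (m n : ℕ) (hm : 2 ≤ m) (hmd : m ∣ n + 1)
    -- distinct lines `L 0, …, L n` in the projective plane (`d = n + 1`)
    (ℓ : Fin (n + 1) → Module.Dual ℂ (Fin 3 → ℂ))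
    (hℓ : Pairwise fun i j => LinearIndependent ℂ ![ℓ i, ℓ j])
    -- the line `Z = ℙ(W)` through the point `P = [b 0]` of the last line and of no other line,
    -- with the affine coordinate given by `b`, whose point at infinity is not on any line
    (W : Submodule ℂ (Fin 3 → ℂ)) (b : Module.Basis (Fin 2) ℂ W)
    (hP : ℓ (Fin.last n) (b 0) = 0) (hP' : ∀ i : Fin n, ℓ i.castSucc (b 0) ≠ 0)
    (hinf : ∀ i, ℓ i (b 1) ≠ 0)
    -- the coordinates `z i` of the other intersection points `Z ∩ L i`
    (z : Fin n → ℂ) (hz : ∀ i, ℓ i.castSucc (b 0 + z i • b 1 : W) = 0)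
    -- the segments from `P` to these points meet only in `P`
    (hseg : ∀ i j, i ≠ j → segment ℝ 0 (z i) ∩ segment ℝ 0 (z j) = {0})
    -- small circles: the closed disc around `z i` contains no other point of `Z ∩ L`
    (r : Fin n → ℝ) (hr : ∀ i, 0 < r i) (hr1 : ∀ i, r i < 1)
    (hrz : ∀ i j, j ≠ i → r i * ‖z i‖ < ‖z j - z i‖)
    -- a generator of the group of covering transformations
    (ζ : ℂ) (hζ : IsPrimitiveRoot ζ m)
    -- the point over `P`, and liftings of the loops
    (zd : Cover ℓ W m) (hzd : proj ℓ W m zd = affinePoint b 0)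
    (η : Fin n → Path zd zd)
    (hη : ∀ i t, proj ℓ W m (η i t) = affinePoint b (lasso (z i) (r i) t)) :
    let T : Module.End ℂ (H1 (Cover ℓ W m)) := pushforward (deck ℓ W m ζ hζ.pow_eq_one)
    let μ : ℂ := (Complex.exp (2 * Real.pi * Complex.I / m))⁻¹
    let s : Fin n → H1 (Cover ℓ W m) := fun i => eigencomponent m T μ (loopClass (η i))
    (∀ j : Fin n,
      LinearIndependent ℂ (fun i : {i : Fin n // i ≠ j} => s i) ∧
      Submodule.span ℂ (Set.range fun i : {i : Fin n // i ≠ j} => s i) = T.eigenspace μ) ∧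
    Submodule.span ℂ (Set.range s) = T.eigenspace μ ∧
    ∃ α : Fin n → ℂ, (∀ i, α i ≠ 0) ∧ ∑ i, α i • s i = 0 ∧
      (∀ β : Fin n → ℂ, ∑ i, β i • s i = 0 → ∃ c : ℂ, β = c • α) ∧
      ∃ φ : ((Fin n → ℂ) ⧸ Submodule.span ℂ {α}) ≃ₗ[ℂ] T.eigenspace μ,
        ∀ i, (φ (Submodule.Quotient.mk (Pi.single i 1)) : H1 (Cover ℓ W m)) = s i := by
  intro T μ s
  have hm0 : m ≠ 0 := by omega
  have hz0 (i : Fin n) : z i ≠ 0 := by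
    intro h0
    have := hz i
    rw [h0, zero_smul, add_zero] at this
    exact hP' i this
  obtain ⟨δ, hδ⟩ := exists_separated_of_segment hz0 hseg
  obtain ⟨c, hc, hc1⟩ := exists_pow_eq_inv_rootOfUnity hm hζ
  have hn : 0 < n := by
    have := Nat.le_of_dvd n.succ_pos hmd
    omega
  let S := coverCyclicCover b hm0 hmd zd hP hinf hz
  have hT : T = pushforward (S.D.act ζ hζ.pow_eq_one) := rfl
  have hbasis (j : Fin n) := S.basis_eigenspace hδ hζ hc1 hr hr1 hrz η
    (fun i t => mem_coverDom_of_proj_eq (hη i t)) hT j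
  simp only [hc] at hbasis
  refine ⟨hbasis, exists_relation hn (fun i => ?_) (fun j => (hbasis j).1) fun j => (hbasis j).2⟩
  refine eigencomponent_mem (hT ▸ S.pushforward_pow_eq_one hζ.pow_eq_one) ?_
    (Nat.pos_of_ne_zero hm0) _
  exact (Complex.isPrimitiveRoot_exp m hm0).inv.pow_eq_one
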